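/- **Definitions.** Let $\mathbf S^2$ be the unit sphere with its angular (intrinsic) metric. A metric space $X$ is *admissible* if 1. $X$ is homeomorphic to $\mathbf S^2$; 2. $X$ is piecewise spherical with constant curvature $1$ away from a finite set of cone points. That is, $X$ is a union of finitely many non-degenerate convex spherical triangles with disjoint interiors, with the gluing metric (the infimum of lengths of chains of moves inside single pieces). Moreover, every point $x$ has a ball isometric to a ball around the apex of the spherical cone of some angle $\theta_x>0$ (metric $dr^2+\sin^2 r\,d\varphi^2$ with $\varphi\in\mathbb R/\theta_x\mathbb Z$), and $\theta_x=2\pi$ except at finitely many points, called the cone points; 3. all cone points have cone angle $\theta_x>2\pi$; 4. every closed geodesic of $X$ (a non-constant closed curve which near each of its points, including the base point, is a shortest path) has length $>2\pi$. A metric space $Q$ with the structure of a finite cell complex is *ideally admissible* if 1. $Q$ is homeomorphic to $\mathbf S^2$; 2. the cell complex is combinatorially equivalent to a convex polyhedron in $\mathbf E^3$; 3. each closed $2$-cell is isometric, in its intrinsic metric, to a closed hemisphere of $\mathbf S^2$, and the metric of $Q$ is the one obtained by gluing these hemispheres; 4. along each edge exactly two $2$-cells are glued, isometrically along an arc of their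 equators whose length lies in $(0,\pi)$; 5. every simple cycle in the $1$-skeleton of $Q$ has length $>2\pi$, unless it is the boundary of a $2$-cell. Let $e_1(Q)$ be the length of the longest edge of $Q$. For $t>0$ the *$t$-expansion* $Q^t$ is constructed as follows. Divide each hemisphere $H$ of $Q$ into triangles with apex at the center of $H$, two sides that are radii of length $\pi/2$, and third side an edge of $Q$ in $\partial H$. Replace each triangle, of third side $\ell$, by the spherical triangle with two sides $\pi/2$ and third side $(1+t)\ell$. Glue these triangles, with the gluing metric, in the same pattern as in $Q$: points on the radii correspond by their distance to the apex, and points on the third sides by scaling with the factor $1+t$. **Theorem 4.4.** Let $Q$ be ideally admissible and let $0<t<\pi/e_1(Q)-1$. Then the $t$-expansion $Q^t$ is admissible. That is, $Q^t$ is homeomorphic to $\mathbf S^2$, it is piecewise spherical with constant curvature $1$ away from finitely many cone points, all its cone angles are $>2\pi$, and all its closed geodesics are longer than $2\pi$. -/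

import Mathlib

open Set

noncomputable section

namespace Spherical

/-! ### Metrics obtained by gluing pieces -/

section Gluing

variable {ι : Type*} {T : ι → Type*}

/-- `GlueChain d s a b L`: one can travel from `a` to `b` in the disjoint union of the pieces `T i`
by moving finitely many times inside one piece (a move from `p` to `q` in `T i` costs `d i p q`) and
by jumping for free between points that are identified by `s`; the total cost is `L`. -/
inductive GlueChain (d : ∀ i, T i → T i → ℝ) (s : Setoid (Σ i, T i)) :
    (Σ i, T i) → (Σ i, T i) → ℝ → Prop
  | glue {a b : Σ i, T i} (h : s a b) : GlueChain d s a b 0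
  | step {a b : Σ i, T i} {L : ℝ} (i : ι) (p q : T i) (h : s a ⟨i, p⟩)
      (h' : GlueChain d s ⟨i, q⟩ b L) : GlueChain d s a b (d i p q + L)

/-- The quotient (gluing) pseudo-distance: the infimum of the costs of all chains from `a` to
`b`. -/
def glueEDist (d : ∀ i, T i → T i → ℝ) (s : Setoid (Σ i, T i)) (a b : Σ i, T i) : ENNReal :=
  ⨅ (L : ℝ) (_ : GlueChain d s a b L), ENNReal.ofReal L

variable {d : ∀ i, T i → T i → ℝ} {s : Setoid (Σ i, T i)}

theorem GlueChain.of_rel {a a' b : Σ i, T i} {L : ℝ} (h : s a a') (hc : GlueChain d s a' b L) :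
    GlueChain d s a b L := by
  cases hc with
  | glue h' => exact .glue (s.trans h h')
  | step i p q h' hc => exact .step i p q (s.trans h h') hc

theorem GlueChain.trans {a b c : Σ i, T i} {L M : ℝ} (h : GlueChain d s a b L)
    (h' : GlueChain d s b c M) : GlueChain d s a c (L + M) := by
  induction h with
  | glue h => simpa using h'.of_rel h
  | step i p q h _ ih => rw [add_assoc]; exact .step i p q h (ih h')

theorem GlueChain.symm (hd : ∀ i p q, d i p q = d i q p) {a b : Σ i, T i} {L : ℝ}
    (h : GlueChain d s a b L) : GlueChain d s b a L := by
  induction h with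
  | glue h => exact .glue (s.symm h)
  | @step a b L i p q h _ ih =>
    have h1 : GlueChain d s ⟨i, q⟩ a (d i q p + 0) :=
      .step i q p (s.refl _) (.glue (s.symm h))
    have h2 := ih.trans h1
    rw [add_zero, add_comm, hd i q p] at h2
    exact h2

theorem GlueChain.single (d : ∀ i, T i → T i → ℝ) (s : Setoid (Σ i, T i)) (i : ι) (p q : T i) :
    GlueChain d s ⟨i, p⟩ ⟨i, q⟩ (d i p q + 0) :=
  .step i p q (s.refl _) (.glue (s.refl _))

theorem glueEDist_lt_top {a b : Σ i, T i} :
    glueEDist d s a b < ⊤ ↔ ∃ L, GlueChain d s a b L := by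
  simp [glueEDist, iInf_lt_iff]

/-- The gluing pseudo-distance on the disjoint union of the pieces, as a pseudo-metric, when any two
points are joined by a chain. -/
@[reducible] def gluePseudoMetric (d : ∀ i, T i → T i → ℝ) (s : Setoid (Σ i, T i))
    (hd0 : ∀ i p q, 0 ≤ d i p q) (hd : ∀ i p q, d i p q = d i q p)
    (hfin : ∀ a b, ∃ L, GlueChain d s a b L) : PseudoMetricSpace (Σ i, T i) :=
  letI : PseudoEMetricSpace (Σ i, T i) :=
    { edist := glueEDist d s
      edist_self := fun a => le_antisymm
        ((iInf₂_le 0 (GlueChain.glue (s.refl a))).trans (by simp)) bot_le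
      edist_comm := fun a b => by
        have key : ∀ a b, glueEDist d s a b ≤ glueEDist d s b a := fun a b =>
          le_iInf₂ fun L h => iInf₂_le L (h.symm hd)
        exact le_antisymm (key a b) (key b a)
      edist_triangle := fun a b c => by
        have nn : ∀ {a b L}, GlueChain d s a b L → 0 ≤ L := by
          intro a b L h
          induction h with
          | glue => exact le_rfl
          | step i p q _ _ ih => exact add_nonneg (hd0 i p q) ih
        refine ENNReal.le_of_forall_pos_le_add fun ε hε hlt => ?_
        have h1 : glueEDist d s a b < ⊤ := (ENNReal.add_lt_top.1 hlt).1
        have h2 : glueEDist d s b c < ⊤ := (ENNReal.add_lt_top.1 hlt).2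
        have hε2 : (ε / 2 : ENNReal) ≠ 0 := by simpa using hε.ne'
        have h1' := ENNReal.lt_add_right h1.ne hε2
        have h2' := ENNReal.lt_add_right h2.ne hε2
        obtain ⟨L, h⟩ := iInf_lt_iff.1 h1'
        obtain ⟨hL, h⟩ := iInf_lt_iff.1 h
        obtain ⟨M, h'⟩ := iInf_lt_iff.1 h2'
        obtain ⟨hM, h'⟩ := iInf_lt_iff.1 h'
        calc glueEDist d s a c ≤ ENNReal.ofReal (L + M) := iInf₂_le _ (hL.trans hM)
          _ = ENNReal.ofReal L + ENNReal.ofReal M := ENNReal.ofReal_add (nn hL) (nn hM)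
          _ ≤ (glueEDist d s a b + ε / 2) + (glueEDist d s b c + ε / 2) := add_le_add h.le h'.le
          _ = glueEDist d s a b + glueEDist d s b c + ε := by
            rw [add_add_add_comm, ENNReal.add_halves] }
  PseudoEMetricSpace.toPseudoMetricSpace fun a b => (glueEDist_lt_top.2 (hfin a b)).ne

end Gluing

/-! ### The unit sphere, hemispheres and triangles -/

/-- Euclidean `3`-space. -/
abbrev E3 : Type := EuclideanSpace ℝ (Fin 3)

/-- The unit sphere `S²`. -/
abbrev S2 : Type := Metric.sphere (0 : E3) 1

/-- The intrinsic (angular) distance of the unit sphere. -/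
def sphDist (x y : S2) : ℝ := InnerProductGeometry.angle (x : E3) (y : E3)

/-- The point of `S²` at distance `r` from the north pole on the meridian of longitude `φ`. -/
def polar (r φ : ℝ) : S2 :=
  ⟨!₂[Real.sin r * Real.cos φ, Real.sin r * Real.sin φ, Real.cos r], by
    rw [mem_sphere_zero_iff_norm, EuclideanSpace.norm_eq, Real.sqrt_eq_one]
    simp only [Fin.sum_univ_three, Real.norm_eq_abs, sq_abs]
    simp
    linear_combination Real.sin r ^ 2 * Real.sin_sq_add_cos_sq φ + Real.sin_sq_add_cos_sq r⟩

/-- The closed northern hemisphere of `S²`. -/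
abbrev Hemisphere : Type := {x : S2 // 0 ≤ (x : E3) 2}

/-- Polar coordinates on the hemisphere; `r = π / 2` is the equator and `r = 0` the center. -/
def hemi (r : Icc (0 : ℝ) (Real.pi / 2)) (φ : ℝ) : Hemisphere :=
  ⟨polar r φ, by
    have := Real.cos_nonneg_of_mem_Icc (x := r) ⟨by linarith [r.2.1, Real.pi_pos], r.2.2⟩
    simpa [polar] using this⟩

/-- The point of longitude `φ` on the equator. -/
def equator (φ : ℝ) : Hemisphere :=
  hemi ⟨Real.pi / 2, by constructor <;> linarith [Real.pi_pos]⟩ φ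

theorem exists_hemi_eq (h : Hemisphere) : ∃ r φ, h = hemi r φ := by
  obtain ⟨⟨x, hx⟩, hz⟩ := h
  have hn : x 0 ^ 2 + x 1 ^ 2 + x 2 ^ 2 = 1 := by
    rw [mem_sphere_zero_iff_norm, EuclideanSpace.norm_eq, Real.sqrt_eq_one] at hx
    simpa only [Fin.sum_univ_three, Real.norm_eq_abs, sq_abs] using hx
  have hz0 : 0 ≤ x 2 := hz
  have hz1 : x 2 ≤ 1 := by nlinarith [sq_nonneg (x 0), sq_nonneg (x 1)]
  refine ⟨⟨Real.arccos (x 2), Real.arccos_nonneg _, Real.arccos_le_pi_div_two.2 hz0⟩,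
    Complex.arg ⟨x 0, x 1⟩, ?_⟩
  have hs : Real.sin (Real.arccos (x 2)) = ‖(⟨x 0, x 1⟩ : ℂ)‖ := by
    rw [Real.sin_arccos, Complex.norm_def, Complex.normSq_mk]
    congr 1
    linarith
  apply Subtype.ext
  apply Subtype.ext
  ext i
  fin_cases i
  · simp [hemi, polar, hs, Complex.norm_mul_cos_arg]
  · simp [hemi, polar, hs, Complex.norm_mul_sin_arg]
  · simp [hemi, polar, Real.cos_arccos (by linarith : -1 ≤ x 2) hz1]

theorem hemi_eq_of_equator_eq (r : Icc (0 : ℝ) (Real.pi / 2)) {φ ψ : ℝ}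
    (h : equator φ = equator ψ) : hemi r φ = hemi r ψ := by
  have h0 := congrArg (fun p : Hemisphere => (p.1 : E3) 0) h
  have h1 := congrArg (fun p : Hemisphere => (p.1 : E3) 1) h
  simp [equator, hemi, polar] at h0 h1
  simp [hemi, polar, h0, h1]

/-- The closed convex spherical triangle with vertices `v 0`, `v 1`, `v 2`: the points of the sphere
in the convex cone generated by the vertices. -/
def sphTriangle (v : Fin 3 → S2) : Set S2 :=
  {x | ∃ w : Fin 3 → ℝ, (∀ k, 0 ≤ w k) ∧ (x : E3) = ∑ k, w k • (v k : E3)}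

/-- The interior of the spherical triangle with (linearly independent) vertices `v`. -/
def sphTriangleInterior (v : Fin 3 → S2) : Set S2 :=
  {x | ∃ w : Fin 3 → ℝ, (∀ k, 0 < w k) ∧ (x : E3) = ∑ k, w k • (v k : E3)}

/-! ### Admissible metric spaces -/

section Admissible

variable (X : Type*) [MetricSpace X]

/-- `X` is piecewise spherical: it is a union of finitely many (non-degenerate) spherical triangles
with disjoint interiors, and its metric is the one obtained by gluing these triangles. -/
def IsPiecewiseSpherical : Prop :=
  ∃ (n : ℕ) (v : Fin n → Fin 3 → S2) (c : ∀ i, sphTriangle (v i) → X),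
    (∀ i, LinearIndependent ℝ fun k => (v i k : E3)) ∧
    (∀ i, Function.Injective (c i)) ∧
    (∀ x, ∃ i p, c i p = x) ∧
    (∀ i j p q, i ≠ j → c i p = c j q → (p : S2) ∉ sphTriangleInterior (v i)) ∧
    ∀ a b : Σ i, sphTriangle (v i),
      edist (c a.1 a.2) (c b.1 b.2) =
        glueEDist (T := fun i => sphTriangle (v i)) (fun _ p q => sphDist p q)
          (Setoid.ker fun a => c a.1 a.2) a b

variable {X}

/-- A neighbourhood of `x` is isometric to a neighbourhood of the apex in the spherical cone of
angle `θ`, with polar coordinates `(r, φ)`, `φ ∈ ℝ / θℤ`, and metric `dr² + sin² r dφ²`; the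
distance in this cone is given by the spherical law of cosines, with the angle between `φ` and `φ'`
truncated at `π`. For `θ = 2π` this says that `X` has constant curvature `1` near `x`. -/
def HasConeAngle (x : X) (θ : ℝ) : Prop :=
  0 < θ ∧ ∃ ρ : ℝ, 0 < ρ ∧ ρ ≤ Real.pi / 2 ∧ ∃ c : ℝ → AddCircle θ → X,
    (∀ φ, c 0 φ = x) ∧
    (∀ r ∈ Ico 0 ρ, ∀ r' ∈ Ico 0 ρ, ∀ φ φ', dist (c r φ) (c r' φ') =
      Real.arccos (Real.cos r * Real.cos r' +
        Real.sin r * Real.sin r' * Real.cos (min ‖φ - φ'‖ Real.pi))) ∧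
    ∀ y, dist x y < ρ → ∃ r ∈ Ico 0 ρ, ∃ φ, c r φ = y

/-- `γ` is a closed geodesic of length `L`: a closed curve of period `L` which, near each parameter
(including the base point), is a shortest path parametrized by arc length. -/
def IsClosedGeodesic (γ : ℝ → X) (L : ℝ) : Prop :=
  0 < L ∧ Function.Periodic γ L ∧
    ∀ u, ∃ ε > 0, ∀ a ∈ Ioo (u - ε) (u + ε), ∀ b ∈ Ioo (u - ε) (u + ε), dist (γ a) (γ b) = |a - b|

variable (X)

/-- Admissible metric spaces. `K` is the set of cone points. -/
structure IsAdmissible : Prop where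
  sphere : Nonempty (X ≃ₜ S2)
  piecewise : IsPiecewiseSpherical X
  cone : ∃ K : Set X, K.Finite ∧ (∀ x ∉ K, HasConeAngle x (2 * Real.pi)) ∧
    ∀ x ∈ K, ∃ θ, 2 * Real.pi < θ ∧ HasConeAngle x θ
  geodesic : ∀ (γ : ℝ → X) (L : ℝ), IsClosedGeodesic γ L → 2 * Real.pi < L

end Admissible

/-! ### Spaces glued from hemispheres -/

/-- The data of a cell structure whose `2`-cells are hemispheres: finitely many vertices, edges
(parametrized by arc length on `[0, len e]`) and faces (parametrized by the hemisphere). For an edge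
`e` in the boundary of a face `f`, `start f e` and `dir f e = ± 1` say which arc of the equator it
is. -/
structure CellData (Q : Type*) where
  V : Type
  E : Type
  F : Type
  vert : V → Q
  len : E → ℝ
  edge : E → ℝ → Q
  face : F → Hemisphere → Q
  start : F → E → ℝ
  dir : F → E → ℝ

namespace CellData

variable {Q : Type*} (S : CellData Q)

/-- The set of cells. -/
abbrev Cell : Type := S.V ⊕ S.E ⊕ S.F

/-- Closed cells. -/
def closedCell : S.Cell → Set Q
  | .inl v => {S.vert v}
  | .inr (.inl e) => S.edge e '' Icc 0 (S.len e)
  | .inr (.inr f) => range (S.face f)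

/-- Open cells. -/
def openCell : S.Cell → Set Q
  | .inl v => {S.vert v}
  | .inr (.inl e) => S.edge e '' Ioo 0 (S.len e)
  | .inr (.inr f) => S.face f '' {p | 0 < (p.1 : E3) 2}

/-- The dimension of a cell. -/
def cellDim : S.Cell → ℕ
  | .inl _ => 0
  | .inr (.inl _) => 1
  | .inr (.inr _) => 2

/-- The edge `e` lies in the (boundary of the) face `f`. -/
def Incident (f : S.F) (e : S.E) : Prop :=
  S.closedCell (.inr (.inl e)) ⊆ S.closedCell (.inr (.inr f))

end CellData

/-- A metric space with the structure of a finite cell complex whose closed `2`-cells are unit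
hemispheres, glued isometrically along arcs of their equators. -/
structure HemisphereComplex (Q : Type*) [MetricSpace Q] extends CellData Q where
  finite_V : Finite V
  finite_E : Finite E
  finite_F : Finite F
  len_pos : ∀ e, 0 < len e
  /-- The open cells partition the space. -/
  partition : ∀ x, ∃! c, x ∈ toCellData.openCell c
  /-- The space is the union of its faces. -/
  cover : ∀ x, ∃ f p, face f p = x
  face_injective : ∀ f, Function.Injective (face f)
  /-- Edges end at vertices. -/
  edge_ends : ∀ e, edge e 0 ∈ range vert ∧ edge e (len e) ∈ range vert
  /-- The boundary of a face is a union of edges. -/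
  boundary : ∀ f φ, ∃ e, toCellData.Incident f e ∧
    face f (equator φ) ∈ toCellData.closedCell (.inr (.inl e))
  /-- An edge in the boundary of a face is identified isometrically with an arc of the equator. -/
  dir_eq : ∀ f e, dir f e = 1 ∨ dir f e = -1
  arc : ∀ f e, toCellData.Incident f e →
    ∀ u ∈ Icc 0 (len e), edge e u = face f (equator (start f e + dir f e * u))
  /-- Faces are glued in pairs along edges. -/
  two_faces : ∀ e, {f | toCellData.Incident f e}.ncard = 2
  /-- The metric is the one obtained by gluing the hemispheres. -/
  edist_eq : ∀ a b : Σ _ : F, Hemisphere, edist (face a.1 a.2) (face b.1 b.2) =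
    glueEDist (fun _ p q => sphDist p.1 q.1) (Setoid.ker fun a => face a.1 a.2) a b

/-- A (compact) convex polyhedron: a bounded intersection of finitely many half-spaces with
non-empty interior. -/
def IsConvexPolyhedron (P : Set E3) : Prop :=
  (∃ (n : ℕ) (a : Fin n → E3) (b : Fin n → ℝ), P = {x | ∀ i, inner ℝ (a i) x ≤ b i}) ∧
    Bornology.IsBounded P ∧ (interior P).Nonempty

/-- The proper faces (vertices, edges, `2`-faces) of a convex polyhedron. -/
def ProperFace (P : Set E3) : Type :=
  {A : Set E3 // IsExposed ℝ P A ∧ A.Nonempty ∧ A ≠ P}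

namespace HemisphereComplex

variable {Q : Type*} [MetricSpace Q] (S : HemisphereComplex Q)

/-- The cell complex is combinatorially equivalent to a convex polyhedron: there is a bijection
between cells and proper faces of a polyhedron which preserves dimensions and inclusions. -/
def IsPolyhedral : Prop :=
  ∃ P : Set E3, IsConvexPolyhedron P ∧ ∃ Φ : S.Cell ≃ ProperFace P,
    (∀ c, Module.finrank ℝ (vectorSpan ℝ (Φ c).1) = S.cellDim c) ∧
    ∀ c c', S.closedCell c ⊆ S.closedCell c' ↔ (Φ c).1 ⊆ (Φ c').1

/-- The edges `e i` form a simple cycle in the `1`-skeleton, `e i` joining `v i` to `v (i + 1)`. -/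
def IsSimpleCycle {n : ℕ} (v : ZMod n → S.V) (e : ZMod n → S.E) : Prop :=
  Function.Injective v ∧ Function.Injective e ∧ ∀ i,
    (S.edge (e i) 0 = S.vert (v i) ∧ S.edge (e i) (S.len (e i)) = S.vert (v (i + 1))) ∨
    (S.edge (e i) 0 = S.vert (v (i + 1)) ∧ S.edge (e i) (S.len (e i)) = S.vert (v i))

/-- `Q`, with the cell structure `S`, is ideally admissible. -/
structure IsIdeallyAdmissible : Prop where
  sphere : Nonempty (Q ≃ₜ S2)
  polyhedral : S.IsPolyhedral
  len_lt_pi : ∀ e, S.len e < Real.pi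
  cycle : ∀ (n : ℕ) [NeZero n] (v : ZMod n → S.V) (e : ZMod n → S.E), S.IsSimpleCycle v e →
    (∃ f, ∀ e', S.Incident f e' ↔ e' ∈ range e) ∨ 2 * Real.pi < ∑ i, S.len (e i)

/-- The length of the longest edge. -/
def longestEdge : ℝ := ⨆ e, S.len e

/-! ### The `t`-expansion -/

/-- The triangles into which the faces are divided: one for each edge of each face. -/
def Flag : Type := {fe : S.F × S.E // S.Incident fe.1 fe.2}

/-- The points of a triangle: `(r, u)` is the point at distance `r` from the apex (the center of the
face), on the radius that ends at the point with arc length parameter `u` of the edge. -/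
abbrev Tri (k : S.Flag) : Type := Icc (0 : ℝ) (Real.pi / 2) × Icc (0 : ℝ) (S.len k.1.2)

/-- The position in `Q` of a point of a triangle. -/
def pos (a : Σ k, S.Tri k) : Q :=
  S.face a.1.1.1 (hemi a.2.1 (S.start a.1.1.1 a.1.1.2 + S.dir a.1.1.1 a.1.1.2 * a.2.2))

/-- The gluing pattern: points of the triangles are identified if they have the same position in
`Q`. -/
def pattern : Setoid (Σ k, S.Tri k) := Setoid.ker S.pos

/-- The distance in the substituted triangle, whose side opposite to the apex has been multiplied by
`1 + t`. -/
def triDist (t : ℝ) (k : S.Flag) (p q : S.Tri k) : ℝ :=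
  sphDist (polar p.1 ((1 + t) * p.2)) (polar q.1 ((1 + t) * q.2))

theorem exists_pos_eq (f : S.F) (h : Hemisphere) :
    ∃ a : Σ k, S.Tri k, a.1.1.1 = f ∧ S.pos a = S.face f h := by
  obtain ⟨r, φ, rfl⟩ := exists_hemi_eq h
  obtain ⟨e, he, u, hu, hφ⟩ := S.boundary f φ
  have h1 : S.face f (equator (S.start f e + S.dir f e * u)) = S.face f (equator φ) :=
    (S.arc f e he u hu).symm.trans hφ
  refine ⟨⟨⟨(f, e), he⟩, r, ⟨u, hu⟩⟩, rfl, ?_⟩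
  exact congrArg (S.face f) (hemi_eq_of_equator_eq r (S.face_injective f h1))

theorem exists_chain_of_face (t : ℝ) (a b : Σ k, S.Tri k) (hab : a.1.1.1 = b.1.1.1) :
    ∃ L, GlueChain (S.triDist t) S.pattern a b L := by
  obtain ⟨⟨⟨f, e⟩, he⟩, r, u⟩ := a
  obtain ⟨⟨⟨g, e'⟩, he'⟩, r', u'⟩ := b
  obtain rfl : f = g := hab
  let o : Icc (0 : ℝ) (Real.pi / 2) := ⟨0, by constructor <;> linarith [Real.pi_pos]⟩
  have ho : S.pattern ⟨⟨(f, e), he⟩, o, u⟩ ⟨⟨(f, e'), he'⟩, o, u'⟩ := by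
    change S.face f (hemi o _) = S.face f (hemi o _)
    congr 1
    simp [hemi, polar, o]
  have h1 := GlueChain.single (S.triDist t) S.pattern ⟨(f, e), he⟩ (r, u) (o, u)
  have h2 := GlueChain.single (S.triDist t) S.pattern ⟨(f, e'), he'⟩ (o, u') (r', u')
  exact ⟨_, h1.trans (h2.of_rel ho)⟩

theorem exists_chain (t : ℝ) (a b : Σ k, S.Tri k) :
    ∃ L, GlueChain (S.triDist t) S.pattern a b L := by
  have key : ∀ {x y : Σ _ : S.F, Hemisphere} {L : ℝ},
      GlueChain (fun _ p q => sphDist p.1 q.1)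
        (Setoid.ker fun a : Σ _ : S.F, Hemisphere => S.face a.1 a.2) x y L →
      ∀ a b, S.pos a = S.face x.1 x.2 → S.pos b = S.face y.1 y.2 →
      ∃ L, GlueChain (S.triDist t) S.pattern a b L := by
    intro x y L h
    induction h with
    | glue h => exact fun a b ha hb => ⟨0, .glue ((ha.trans h).trans hb.symm)⟩
    | step f p q h _ ih =>
      intro a b ha hb
      obtain ⟨a₁, hf₁, ha₁⟩ := S.exists_pos_eq f p
      obtain ⟨a₂, hf₂, ha₂⟩ := S.exists_pos_eq f q
      obtain ⟨L₁, h₁⟩ := S.exists_chain_of_face t a₁ a₂ (hf₁.trans hf₂.symm)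
      obtain ⟨L₂, h₂⟩ := ih a₂ b ha₂ hb
      exact ⟨_, (h₁.of_rel ((ha.trans h).trans ha₁.symm)).trans h₂⟩
  have hlt : edist (S.pos a) (S.pos b) < ⊤ := edist_lt_top _ _
  have h := S.edist_eq ⟨a.1.1.1, hemi a.2.1 (S.start a.1.1.1 a.1.1.2 + S.dir a.1.1.1 a.1.1.2 * a.2.2)⟩
    ⟨b.1.1.1, hemi b.2.1 (S.start b.1.1.1 b.1.1.2 + S.dir b.1.1.1 b.1.1.2 * b.2.2)⟩
  rw [pos, pos, h] at hlt
  obtain ⟨L, hL⟩ := glueEDist_lt_top.1 hlt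
  exact key hL a b rfl rfl

/-- The pseudo-metric on the disjoint union of the expanded triangles that is given by gluing them
according to the pattern in `Q`. -/
@[reducible] def expansionPseudoMetric (t : ℝ) : PseudoMetricSpace (Σ k, S.Tri k) :=
  gluePseudoMetric (S.triDist t) S.pattern
    (fun _ _ _ => InnerProductGeometry.angle_nonneg _ _)
    (fun _ _ _ => InnerProductGeometry.angle_comm _ _) (S.exists_chain t)

/-- The `t`-expansion of `Q`: the metric space obtained by gluing the expanded triangles, that is,
the quotient of their disjoint union in which points at gluing distance `0` are identified. -/
def Expansion (t : ℝ) : Type :=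
  @SeparationQuotient (Σ k, S.Tri k) (S.expansionPseudoMetric t).toUniformSpace.toTopologicalSpace

instance (t : ℝ) : MetricSpace (S.Expansion t) :=
  @SeparationQuotient.instMetricSpace _ (S.expansionPseudoMetric t)

end HemisphereComplex

end Spherical

end

namespace Spherical

/-! ### Spherical trigonometry -/

/-! The space `Q` and its expansion have the same points: the map `toX` is a bijection, because
opening the triangles wider at their apex never shortens a distance, so the gluing metric of the
expansion dominates that of `Q` (`dist_le_dist_toX`). The inverse of `toX` is thus a 1-Lipschitz
bijection from a compact space, hence a homeomorphism, and the expansion is a sphere. The bound on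
`t` says exactly that every third side `(1 + t) * ℓ` is shorter than `π`, so the pieces are
non-degenerate convex triangles.

Locally, everything rests on `ConeChart`: polar coordinates in which a short chain of moves can be
lifted, move by move, to a spherical cone. The lift has no greater length, so near the base point
the gluing distance is the cone distance (`ConeChart.dist_eq`). At the center of a face the cone
angle is `(1 + t) * 2π`; at other interior points of a face the chart is a piece of the round
sphere. At a point of the `1`-skeleton the faces form a single cycle of length `k`, since the sphere
has no local cut points (`exists_linkCycle`), and each face contributes the straight angle `π` of a
hemisphere at its boundary. Hence the cone angle is `k * π`, with `k = 2` inside an edge and `k ≥ 3`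
at a vertex, the latter because two different faces of a polyhedron share at most one edge.

For closed geodesics, a geodesic that enters an open face runs along a great circle, or along two
radii if it meets the center. It therefore crosses the face in time exactly `π`, and its two
boundary points are separated by an angle between `π / (1 + t)` and `π`, measured in `Q`
(`exists_crossing`). Three cases remain for a closed geodesic of length `L`.

If it stays in the `1`-skeleton, scaling by `1 / (1 + t)` gives a closed edge path in `Q` without
backtracking, and such a path has length at least `2π`: it contains a simple cycle, which is long by
hypothesis or bounds a face (`EdgeLoop.two_pi_le`). Hence `L ≥ (1 + t) * 2π`. If it has one
crossing, the crossing is replaced by a boundary arc of the face of length at most `π`; when `L ≤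
2π` the rest has length `(L - π) / (1 + t) < π` in `Q`, and the closed edge path would be shorter
than `2π`. If it has two crossings, then `L ≥ 2π`, with equality only if the two crossings are
consecutive and have the same endpoints. These endpoints then lie in two different faces, hence in
one edge or vertex; but edges are shorter than `π / (1 + t)`, a contradiction
(`Crossing.not_mem_range`). -/

theorem S2.norm_coe (x : S2) : ‖(x : E3)‖ = 1 := by
  simp

theorem sphDist_nonneg (x y : S2) : 0 ≤ sphDist x y := InnerProductGeometry.angle_nonneg _ _

theorem sphDist_le_pi (x y : S2) : sphDist x y ≤ Real.pi := InnerProductGeometry.angle_le_pi _ _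

theorem sphDist_triangle (x y z : S2) : sphDist x z ≤ sphDist x y + sphDist y z :=
  InnerProductGeometry.angle_le_angle_add_angle _ _ _

theorem cos_sphDist (x y : S2) : Real.cos (sphDist x y) = inner ℝ (x : E3) (y : E3) := by
  rw [sphDist, InnerProductGeometry.cos_angle, x.norm_coe, y.norm_coe]; simp

theorem inner_E3 (x y : E3) : inner ℝ x y = x 0 * y 0 + x 1 * y 1 + x 2 * y 2 := by
  simp [PiLp.inner_apply, Fin.sum_univ_three, mul_comm]

theorem S2.sq_sum (x : S2) : (x : E3) 0 ^ 2 + (x : E3) 1 ^ 2 + (x : E3) 2 ^ 2 = 1 := by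
  have h := inner_E3 x x
  rw [real_inner_self_eq_norm_sq, x.norm_coe] at h
  linarith

theorem S2.ext_coord {x y : S2} (h0 : (x : E3) 0 = (y : E3) 0) (h1 : (x : E3) 1 = (y : E3) 1)
    (h2 : (x : E3) 2 = (y : E3) 2) : x = y := by
  apply Subtype.ext
  ext i
  fin_cases i
  exacts [h0, h1, h2]

@[simp] theorem polar_zero (r φ : ℝ) : (polar r φ : E3) 0 = Real.sin r * Real.cos φ := by
  simp [polar]
@[simp] theorem polar_one (r φ : ℝ) : (polar r φ : E3) 1 = Real.sin r * Real.sin φ := by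
  simp [polar]
@[simp] theorem polar_two (r φ : ℝ) : (polar r φ : E3) 2 = Real.cos r := by
  simp [polar]

theorem sphDist_eq_arccos (x y : S2) :
    sphDist x y = Real.arccos (inner ℝ (x : E3) (y : E3)) := by
  rw [← cos_sphDist, Real.arccos_cos (sphDist_nonneg _ _) (sphDist_le_pi _ _)]

theorem inner_polar (r a r' b : ℝ) : inner ℝ (polar r a : E3) (polar r' b : E3) =
    Real.cos r * Real.cos r' + Real.sin r * Real.sin r' * Real.cos (a - b) := by
  rw [inner_E3, Real.cos_sub]
  simp
  ring

theorem sphDist_polar (r a r' b : ℝ) : sphDist (polar r a) (polar r' b) =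
    Real.arccos (Real.cos r * Real.cos r' + Real.sin r * Real.sin r' * Real.cos (a - b)) := by
  rw [sphDist_eq_arccos, inner_polar]

theorem sphDist_self (x : S2) : sphDist x x = 0 := by
  rw [sphDist_eq_arccos, real_inner_self_eq_norm_sq, x.norm_coe]; simp

theorem sphDist_pole (r a : ℝ) (hr : r ∈ Icc 0 Real.pi) :
    sphDist (polar 0 0) (polar r a) = r := by
  rw [sphDist_polar]; simp [Real.arccos_cos hr.1 hr.2]

theorem eq_of_sphDist_eq_zero {x y : S2} (h : sphDist x y = 0) : x = y := by
  have h1 := cos_sphDist x y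
  rw [h, Real.cos_zero] at h1
  exact Subtype.ext ((inner_eq_one_iff_of_norm_eq_one x.norm_coe y.norm_coe).1 h1.symm)

theorem continuous_sphDist : Continuous fun p : S2 × S2 => sphDist p.1 p.2 := by
  simp only [sphDist_eq_arccos]
  exact Real.continuous_arccos.comp
    ((continuous_subtype_val.comp continuous_fst).inner (continuous_subtype_val.comp continuous_snd))

theorem continuous_comp_sphDist {Y : Type*} [TopologicalSpace Y] {f g : Y → S2} (hf : Continuous f)
    (hg : Continuous g) : Continuous fun y => sphDist (f y) (g y) := by
  have := continuous_sphDist.comp (hf.prodMk hg)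
  exact this

theorem continuous_polar : Continuous fun p : ℝ × ℝ => polar p.1 p.2 := by
  refine Continuous.subtype_mk ?_ _
  refine (PiLp.continuous_toLp 2 _).comp (continuous_pi fun i => ?_)
  fin_cases i <;> simp <;> fun_prop

theorem continuous_comp_polar {Y : Type*} [TopologicalSpace Y] {f g : Y → ℝ} (hf : Continuous f)
    (hg : Continuous g) : Continuous fun y => polar (f y) (g y) := by
  have := continuous_polar.comp (hf.prodMk hg)
  exact this

/-- Every point of the sphere has polar coordinates. -/
theorem exists_polar_eq (x : S2) : polar (Real.arccos ((x : E3) 2))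
    (Complex.arg ⟨(x : E3) 0, (x : E3) 1⟩) = x := by
  have hn := x.sq_sum
  have hs : Real.sin (Real.arccos ((x : E3) 2)) = ‖(⟨(x : E3) 0, (x : E3) 1⟩ : ℂ)‖ := by
    rw [Real.sin_arccos, Complex.norm_def, Complex.normSq_mk]
    congr 1
    linarith
  apply S2.ext_coord
  · rw [polar_zero, hs, Complex.norm_mul_cos_arg]
  · rw [polar_one, hs, Complex.norm_mul_sin_arg]
  · rw [polar_two, Real.cos_arccos] <;> nlinarith [sq_nonneg ((x : E3) 0), sq_nonneg ((x : E3) 1)]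

theorem exists_polar_sphDist_eq (v : S2) : ∃ a, polar (sphDist (polar 0 0) v) a = v := by
  refine ⟨Complex.arg ⟨(v : E3) 0, (v : E3) 1⟩, ?_⟩
  have h := exists_polar_eq v
  have h2 : sphDist (polar 0 0) v = Real.arccos ((v : E3) 2) := by
    have := sphDist_pole (Real.arccos ((v : E3) 2)) (Complex.arg ⟨(v : E3) 0, (v : E3) 1⟩)
      ⟨Real.arccos_nonneg _, Real.arccos_le_pi _⟩
    rwa [h] at this
  rw [h2, h]

/-- Two polar coordinates with cosines of the longitude difference equal give the same distance. -/
theorem sphDist_polar_congr {r r' a b a' b' : ℝ} (h : Real.cos (a - b) = Real.cos (a' - b')) :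
    sphDist (polar r a) (polar r' b) = sphDist (polar r a') (polar r' b') := by
  rw [sphDist_polar, sphDist_polar, h]

/-- The distance of two points at distances `r`, `r'` from the apex of a spherical cone, on rays that
enclose the angle `δ`. -/
noncomputable def coneDist (r r' δ : ℝ) : ℝ :=
  Real.arccos (Real.cos r * Real.cos r' + Real.sin r * Real.sin r' * Real.cos (min δ Real.pi))

theorem coneDist_eq_sphDist (r r' δ : ℝ) :
    coneDist r r' δ = sphDist (polar r 0) (polar r' (min δ Real.pi)) := by
  rw [sphDist_polar, coneDist, zero_sub, Real.cos_neg]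

theorem coneDist_nonneg (r r' δ : ℝ) : 0 ≤ coneDist r r' δ := Real.arccos_nonneg _

theorem coneDist_comm (r r' δ : ℝ) : coneDist r r' δ = coneDist r' r δ := by
  unfold coneDist; congr 1; ring

theorem sphDist_polar_eq_coneDist {r r' a b : ℝ} (h : |a - b| ≤ Real.pi) :
    sphDist (polar r a) (polar r' b) = coneDist r r' |a - b| := by
  rw [sphDist_polar, coneDist, min_eq_left h, Real.cos_abs]

theorem coneDist_mono {r r' δ δ' : ℝ} (hr : 0 ≤ r) (hr1 : r ≤ Real.pi) (hr' : 0 ≤ r')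
    (hr1' : r' ≤ Real.pi) (hδ : 0 ≤ δ) (h : δ ≤ δ') : coneDist r r' δ ≤ coneDist r r' δ' := by
  unfold coneDist
  apply Real.arccos_le_arccos
  have h1 := mul_nonneg (Real.sin_nonneg_of_nonneg_of_le_pi hr hr1)
    (Real.sin_nonneg_of_nonneg_of_le_pi hr' hr1')
  have h2 : Real.cos (min δ' Real.pi) ≤ Real.cos (min δ Real.pi) :=
    Real.cos_le_cos_of_nonneg_of_le_pi (le_min hδ Real.pi_pos.le) (min_le_right _ _)
      (min_le_min_right _ h)
  nlinarith

theorem coneDist_of_pi_le {r r' δ : ℝ} (hr : 0 ≤ r) (hr' : 0 ≤ r') (hs : r + r' ≤ Real.pi)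
    (h : Real.pi ≤ δ) : coneDist r r' δ = r + r' := by
  rw [coneDist, min_eq_right h, Real.cos_pi]
  have : Real.cos r * Real.cos r' + Real.sin r * Real.sin r' * -1 = Real.cos (r + r') := by
    rw [Real.cos_add]; ring
  rw [this, Real.arccos_cos (by linarith) hs]

theorem coneDist_zero_right (r r' : ℝ) (hr : 0 ≤ r) (hr1 : r ≤ Real.pi) (hr' : 0 ≤ r')
    (hr1' : r' ≤ Real.pi) : coneDist r r' 0 = |r - r'| := by
  rw [coneDist, min_eq_left Real.pi_pos.le, Real.cos_zero]
  have : Real.cos r * Real.cos r' + Real.sin r * Real.sin r' * 1 = Real.cos |r - r'| := by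
    rw [Real.cos_abs, Real.cos_sub]; ring
  rw [this, Real.arccos_cos (abs_nonneg _)]
  rw [abs_le]; constructor <;> linarith

theorem coneDist_zero_left (r' δ : ℝ) (hr' : 0 ≤ r') (hr1' : r' ≤ Real.pi) :
    coneDist 0 r' δ = r' := by
  simp [coneDist, Real.arccos_cos hr' hr1']

theorem abs_sub_le_coneDist {r r' δ : ℝ} (hr : 0 ≤ r) (hr1 : r ≤ Real.pi) (hr' : 0 ≤ r')
    (hr1' : r' ≤ Real.pi) (hδ : 0 ≤ δ) : |r - r'| ≤ coneDist r r' δ := by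
  rw [← coneDist_zero_right r r' hr hr1 hr' hr1']
  exact coneDist_mono hr hr1 hr' hr1' le_rfl hδ

theorem coneDist_le_add {r r' δ : ℝ} (hr : 0 ≤ r) (hr1 : r ≤ Real.pi) (hr' : 0 ≤ r')
    (hr1' : r' ≤ Real.pi) : coneDist r r' δ ≤ r + r' := by
  rcases le_total (r + r') Real.pi with h | h
  · rw [← coneDist_of_pi_le hr hr' h le_rfl]
    unfold coneDist
    apply Real.arccos_le_arccos
    rw [min_self, Real.cos_pi]
    have h1 := mul_nonneg (Real.sin_nonneg_of_nonneg_of_le_pi hr hr1)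
      (Real.sin_nonneg_of_nonneg_of_le_pi hr' hr1')
    have := Real.neg_one_le_cos (min δ Real.pi)
    nlinarith
  · exact (Real.arccos_le_pi _).trans h

/-- The triangle inequality in a spherical cone. -/
theorem coneDist_triangle {r s r' δ δ₁ δ₂ : ℝ} (hr : 0 ≤ r) (hs : 0 ≤ s) (hr' : 0 ≤ r')
    (hr1 : r ≤ Real.pi) (hs1 : s ≤ Real.pi) (hr1' : r' ≤ Real.pi) (hδ : 0 ≤ δ) (h1 : 0 ≤ δ₁)
    (h2 : 0 ≤ δ₂) (h : δ ≤ δ₁ + δ₂) :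
    coneDist r r' δ ≤ coneDist r s δ₁ + coneDist s r' δ₂ := by
  rcases le_total Real.pi δ₁ with h3 | h3
  -- The first leg has at least the length of the path through the apex, or through the antipode of
  -- the apex when `r + s > π`. What is left to the second leg is a difference of radii.
  · have : coneDist r s Real.pi ≤ coneDist r s δ₁ := coneDist_mono hr hr1 hs hs1 Real.pi_pos.le h3
    rcases le_total (r + s) Real.pi with h4 | h4
    · rw [coneDist_of_pi_le hr hs h4 le_rfl] at this
      have h5 := coneDist_le_add (δ := δ) hr hr1 hr' hr1'
      have h6 := (abs_le.1 (abs_sub_le_coneDist (δ := δ₂) hs hs1 hr' hr1' h2)).1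
      linarith
    · have e : coneDist r s Real.pi = 2 * Real.pi - (r + s) := by
        rw [coneDist, min_self, Real.cos_pi]
        have : Real.cos r * Real.cos s + Real.sin r * Real.sin s * -1
            = Real.cos (2 * Real.pi - (r + s)) := by
          rw [Real.cos_two_pi_sub, Real.cos_add]; ring
        rw [this, Real.arccos_cos] <;> linarith
      rw [e] at this
      have h5 : coneDist r r' δ ≤ coneDist r r' Real.pi := by
        unfold coneDist
        apply Real.arccos_le_arccos
        rw [min_self, Real.cos_pi]
        have h1 := mul_nonneg (Real.sin_nonneg_of_nonneg_of_le_pi hr hr1)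
          (Real.sin_nonneg_of_nonneg_of_le_pi hr' hr1')
        have := Real.neg_one_le_cos (min δ Real.pi)
        nlinarith
      have h6 := (abs_le.1 (abs_sub_le_coneDist (δ := δ₂) hs hs1 hr' hr1' h2))
      rcases le_total (r + r') Real.pi with h7 | h7
      · rw [coneDist_of_pi_le hr hr' h7 le_rfl] at h5
        linarith
      · have e : coneDist r r' Real.pi = 2 * Real.pi - (r + r') := by
          rw [coneDist, min_self, Real.cos_pi]
          have : Real.cos r * Real.cos r' + Real.sin r * Real.sin r' * -1
              = Real.cos (2 * Real.pi - (r + r')) := by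
            rw [Real.cos_two_pi_sub, Real.cos_add]; ring
          rw [this, Real.arccos_cos] <;> linarith
        linarith
  -- Truncating `δ₂` makes the total angle at most `π`, so that the three points fit on the sphere
  -- at longitudes `0`, `δ₁` and `δ₁ + d`. Nothing is lost, since `coneDist` does not see angles
  -- beyond `π`.
  · set d := min δ₂ (Real.pi - δ₁) with hd
    have hd0 : 0 ≤ d := le_min h2 (by linarith)
    have hd1 : δ₁ + d ≤ Real.pi := by linarith [min_le_right δ₂ (Real.pi - δ₁)]
    have k1 : coneDist r s δ₁ = sphDist (polar r 0) (polar s δ₁) := by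
      rw [sphDist_polar_eq_coneDist] <;> simp [abs_of_nonneg h1, h3]
    have k2 : coneDist s r' d = sphDist (polar s δ₁) (polar r' (δ₁ + d)) := by
      have : δ₁ - (δ₁ + d) = -d := by ring
      rw [sphDist_polar_eq_coneDist] <;> rw [this, abs_neg, abs_of_nonneg hd0]
      linarith
    have k3 : coneDist r r' (δ₁ + d) = sphDist (polar r 0) (polar r' (δ₁ + d)) := by
      rw [sphDist_polar_eq_coneDist] <;> rw [zero_sub, abs_neg, abs_of_nonneg (by linarith)]
      linarith
    have k4 : coneDist s r' d ≤ coneDist s r' δ₂ :=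
      coneDist_mono hs hs1 hr' hr1' hd0 (min_le_left _ _)
    have k5 : coneDist r r' δ ≤ coneDist r r' (δ₁ + d) := by
      rcases min_cases δ₂ (Real.pi - δ₁) with ⟨e, _⟩ | ⟨e, _⟩
      · exact coneDist_mono hr hr1 hr' hr1' hδ (by rw [hd, e]; exact h)
      · have : δ₁ + d = Real.pi := by rw [hd, e]; ring
        rw [this]
        have e2 : coneDist r r' δ = coneDist r r' (min δ Real.pi) := by simp [coneDist]
        rw [e2]
        exact coneDist_mono hr hr1 hr' hr1' (le_min hδ Real.pi_pos.le) (min_le_right _ _)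
    have := sphDist_triangle (polar r 0) (polar s δ₁) (polar r' (δ₁ + d))
    linarith

/-- The length `r + r'` is that of the path through the apex. Comparing cosines forces the truncated
angle to have cosine `-1`; this reads off the angle of a geodesic at a cone point. -/
theorem pi_le_of_coneDist_eq_add {r r' δ : ℝ} (hr : 0 < r) (hr' : 0 < r') (hs : r + r' < Real.pi)
    (hδ : 0 ≤ δ) (h : coneDist r r' δ = r + r') : Real.pi ≤ δ := by
  have h1 := congrArg Real.cos h
  have hb := sphDist_polar r 0 r' (min δ Real.pi)
  rw [coneDist_eq_sphDist, cos_sphDist, inner_polar, Real.cos_add, zero_sub, Real.cos_neg] at h1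
  have h2 : 0 < Real.sin r * Real.sin r' :=
    mul_pos (Real.sin_pos_of_pos_of_lt_pi hr (by linarith))
      (Real.sin_pos_of_pos_of_lt_pi hr' (by linarith))
  have h3 : Real.cos (min δ Real.pi) = -1 := by nlinarith
  rw [← Real.cos_pi] at h3
  have := Real.injOn_cos ⟨le_min hδ Real.pi_pos.le, min_le_right _ _⟩
    ⟨Real.pi_pos.le, le_rfl⟩ h3
  exact min_eq_right_iff.1 this

/-- A great circle arc that sweeps the angle `a + b < π` can be cut at the intermediate ray. -/
theorem exists_coneDist_add_eq {r r' a b : ℝ} (hr : r ∈ Icc 0 (Real.pi / 2))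
    (hr' : r' ∈ Icc 0 (Real.pi / 2)) (ha : 0 ≤ a) (hb : 0 ≤ b) (hab : a + b < Real.pi) :
    ∃ s ∈ Icc 0 (Real.pi / 2), coneDist r s a + coneDist s r' b = coneDist r r' (a + b) := by
  have hpi := Real.pi_pos
  rcases hr.1.eq_or_lt with h0 | h0
  · refine ⟨0, ⟨le_rfl, by linarith⟩, ?_⟩
    rw [← h0, coneDist_zero_left 0 _ le_rfl hpi.le, coneDist_zero_left r' _ hr'.1 (by linarith [hr'.2]),
      coneDist_zero_left r' _ hr'.1 (by linarith [hr'.2]), zero_add]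
  rcases hr'.1.eq_or_lt with h0' | h0'
  · refine ⟨0, ⟨le_rfl, by linarith⟩, ?_⟩
    rw [← h0', coneDist_comm r 0, coneDist_comm r 0, coneDist_zero_left 0 _ le_rfl hpi.le,
      coneDist_zero_left r _ hr.1 (by linarith [hr.2]),
      coneDist_zero_left r _ hr.1 (by linarith [hr.2]), add_zero]
  have hsr : 0 < Real.sin r := Real.sin_pos_of_pos_of_lt_pi h0 (by linarith [hr.2])
  have hsr' : 0 < Real.sin r' := Real.sin_pos_of_pos_of_lt_pi h0' (by linarith [hr'.2])
  rcases (add_nonneg ha hb).eq_or_lt with h1 | h1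
  · have ha0 : a = 0 := by linarith
    have hb0 : b = 0 := by linarith
    refine ⟨r', hr', ?_⟩
    rw [ha0, hb0, add_zero, coneDist_zero_right r' r' hr'.1 (by linarith [hr'.2]) hr'.1
      (by linarith [hr'.2])]
    simp
  have hsa : 0 ≤ Real.sin a := Real.sin_nonneg_of_nonneg_of_le_pi ha (by linarith)
  have hsb : 0 ≤ Real.sin b := Real.sin_nonneg_of_nonneg_of_le_pi hb (by linarith)
  have hsab : 0 < Real.sin (a + b) := Real.sin_pos_of_pos_of_lt_pi h1 hab
  set p := polar r 0
  set q := polar r' (a + b)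
  -- With these weights the combination `l • p + m • q` has longitude `a`, so its normalization is
  -- where the great circle arc from `p` to `q` meets the intermediate ray.
  set l := Real.sin r' * Real.sin b
  set m := Real.sin r * Real.sin a
  have hl : 0 ≤ l := mul_nonneg hsr'.le hsb
  have hm : 0 ≤ m := mul_nonneg hsr.le hsa
  set y : E3 := l • (p : E3) + m • (q : E3) with hy
  have ht : 0 < Real.sin r * Real.sin r' * Real.sin (a + b) := by positivity
  have y0 : y 0 = Real.sin r * Real.sin r' * Real.sin (a + b) * Real.cos a := by
    simp [hy, p, q, l, m, Real.sin_add, Real.cos_add]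
    have := Real.sin_sq_add_cos_sq a
    linear_combination (-Real.sin r' * Real.sin b * Real.sin r) * this
  have y1 : y 1 = Real.sin r * Real.sin r' * Real.sin (a + b) * Real.sin a := by
    simp [hy, p, q, l, m]; ring
  have y2 : 0 ≤ y 2 := by
    simp only [hy, PiLp.add_apply, PiLp.smul_apply, smul_eq_mul, p, q, polar_two]
    have := Real.cos_nonneg_of_mem_Icc (x := r) ⟨by linarith, hr.2⟩
    have := Real.cos_nonneg_of_mem_Icc (x := r') ⟨by linarith, hr'.2⟩
    positivity
  have hyn : y ≠ 0 := by
    intro h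
    rw [h] at y0 y1
    simp at y0 y1
    have := Real.sin_sq_add_cos_sq a
    grind
  have hyp : 0 < ‖y‖ := norm_pos_iff.2 hyn
  set s := Real.arccos (y 2 / ‖y‖) with hs
  have hns : ‖y‖ ^ 2 = y 0 ^ 2 + y 1 ^ 2 + y 2 ^ 2 := by
    rw [← real_inner_self_eq_norm_sq, inner_E3]; ring
  have hz1 : y 2 / ‖y‖ ≤ 1 := by
    rw [div_le_one hyp]; nlinarith [sq_nonneg (y 0), sq_nonneg (y 1)]
  have hz0 : 0 ≤ y 2 / ‖y‖ := div_nonneg y2 hyp.le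
  have hcs : Real.cos s = y 2 / ‖y‖ := Real.cos_arccos (by linarith) hz1
  have hss : Real.sin s = Real.sin r * Real.sin r' * Real.sin (a + b) / ‖y‖ := by
    rw [hs, Real.sin_arccos, Real.sqrt_eq_iff_mul_self_eq]
    · have := Real.sin_sq_add_cos_sq a
      field_simp
      rw [hns, y0, y1]
      linear_combination (Real.sin r * Real.sin r' * Real.sin (a + b)) ^ 2 * this
    · nlinarith
    · positivity
  have hpol : (polar s a : E3) = (‖y‖⁻¹ : ℝ) • y := by
    ext i
    fin_cases i
    · simp [hss, y0]; ring
    · simp [hss, y1]; ring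
    · simp [hcs]; ring
  refine ⟨s, ⟨Real.arccos_nonneg _, Real.arccos_le_pi_div_two.2 hz0⟩, ?_⟩
  have e1 : coneDist r s a = InnerProductGeometry.angle (p : E3) y := by
    rw [← InnerProductGeometry.angle_smul_right_of_pos (p : E3) y (inv_pos.2 hyp), ← hpol]
    change _ = sphDist (polar r 0) (polar s a)
    rw [sphDist_polar_eq_coneDist] <;> rw [zero_sub, abs_neg, abs_of_nonneg ha]
    linarith
  have e2 : coneDist s r' b = InnerProductGeometry.angle y (q : E3) := by
    rw [← InnerProductGeometry.angle_smul_left_of_pos y (q : E3) (inv_pos.2 hyp), ← hpol]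
    change _ = sphDist (polar s a) (polar r' (a + b))
    have : a - (a + b) = - b := by ring
    rw [sphDist_polar_eq_coneDist] <;> rw [this, abs_neg, abs_of_nonneg hb]
    linarith
  have e3 : coneDist r r' (a + b) = InnerProductGeometry.angle (p : E3) (q : E3) := by
    change _ = sphDist (polar r 0) (polar r' (a + b))
    rw [sphDist_polar_eq_coneDist] <;> rw [zero_sub, abs_neg, abs_of_nonneg h1.le]
    linarith
  rw [e1, e2, e3]
  refine (InnerProductGeometry.angle_eq_angle_add_add_angle_add_of_mem_span hyn ?_).symm
  rw [Submodule.mem_span_pair]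
  exact ⟨⟨l, hl⟩, ⟨m, hm⟩, rfl⟩

end Spherical

namespace Spherical

namespace HemisphereComplex

variable {Q : Type*} [MetricSpace Q] (S : HemisphereComplex Q)

/-! ### The cells of a hemisphere complex -/

/-- The point of the face `f` with polar coordinates `(r, φ)`. -/
noncomputable def pt (f : S.F) (r φ : ℝ) : Q :=
  S.face f (hemi (projIcc 0 (Real.pi / 2) (by positivity) r) φ)

/-- The point of longitude `φ` on the boundary of the face `f`. -/
noncomputable def rim (f : S.F) (φ : ℝ) : Q := S.face f (equator φ)

/-- The open face `f`. -/
def openFace (f : S.F) : Set Q := S.openCell (.inr (.inr f))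

/-- The `1`-skeleton: the complement of the open faces. -/
def skel : Set Q := {q | ∀ f, q ∉ S.openFace f}

variable {S}

theorem hemi_eq_iff {r r' : Icc (0 : ℝ) (Real.pi / 2)} {φ φ' : ℝ} :
    hemi r φ = hemi r' φ' ↔ r = r' ∧ ((r : ℝ) = 0 ∨ ∃ n : ℤ, φ = φ' + n * (2 * Real.pi)) := by
  have hpi := Real.pi_pos
  constructor
  · intro h
    have h0 := congrArg (fun p : Hemisphere => (p.1 : E3) 0) h
    have h1 := congrArg (fun p : Hemisphere => (p.1 : E3) 1) h
    have h2 := congrArg (fun p : Hemisphere => (p.1 : E3) 2) h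
    simp only [hemi, polar_zero, polar_one, polar_two] at h0 h1 h2
    have hr : r = r' := Subtype.ext (Real.injOn_cos ⟨r.2.1, by linarith [r.2.2]⟩
      ⟨r'.2.1, by linarith [r'.2.2]⟩ h2)
    refine ⟨hr, ?_⟩
    subst hr
    rcases r.2.1.eq_or_lt with h3 | h3
    · exact .inl h3.symm
    · right
      have hs : Real.sin r ≠ 0 :=
        (Real.sin_pos_of_pos_of_lt_pi h3 (by linarith [r.2.2])).ne'
      have := Real.Angle.cos_sin_inj (mul_left_cancel₀ hs h0) (mul_left_cancel₀ hs h1)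
      rw [Real.Angle.angle_eq_iff_two_pi_dvd_sub] at this
      obtain ⟨n, hn⟩ := this
      exact ⟨n, by linarith⟩
  · rintro ⟨rfl, h⟩
    apply Subtype.ext
    apply S2.ext_coord
    · rcases h with h | ⟨n, rfl⟩
      · simp [hemi, h]
      · simp [hemi, Real.cos_add_int_mul_two_pi]
    · rcases h with h | ⟨n, rfl⟩
      · simp [hemi, h]
      · simp [hemi, Real.sin_add_int_mul_two_pi]
    · simp [hemi]

theorem pt_eq_iff {f : S.F} {r r' φ φ' : ℝ} (hr : r ∈ Icc 0 (Real.pi / 2))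
    (hr' : r' ∈ Icc 0 (Real.pi / 2)) : S.pt f r φ = S.pt f r' φ' ↔
      r = r' ∧ (r = 0 ∨ ∃ n : ℤ, φ = φ' + n * (2 * Real.pi)) := by
  rw [pt, pt, (S.face_injective f).eq_iff, hemi_eq_iff, projIcc_of_mem _ hr, projIcc_of_mem _ hr']
  simp

theorem pt_half (f : S.F) (φ : ℝ) : S.pt f (Real.pi / 2) φ = S.rim f φ := by
  rw [pt, rim, equator]
  congr 1
  rw [projIcc_of_mem _ ⟨by positivity, le_rfl⟩]

theorem rim_eq_iff {f : S.F} {φ φ' : ℝ} :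
    S.rim f φ = S.rim f φ' ↔ ∃ n : ℤ, φ = φ' + n * (2 * Real.pi) := by
  have h : Real.pi / 2 ∈ Icc 0 (Real.pi / 2) := ⟨by positivity, le_rfl⟩
  rw [← pt_half, ← pt_half, pt_eq_iff h h]
  have := Real.pi_pos.ne'
  simp [this]

theorem eq_of_rim_eq {f : S.F} {φ φ' : ℝ} (h : S.rim f φ = S.rim f φ')
    (hlt : |φ - φ'| < 2 * Real.pi) : φ = φ' := by
  obtain ⟨n, hn⟩ := rim_eq_iff.1 h
  have h2 := Real.pi_pos
  have h1 : |(n : ℝ)| < 1 := by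
    have : φ - φ' = n * (2 * Real.pi) := by linarith
    rw [this, abs_mul, abs_of_pos (by positivity : 0 < 2 * Real.pi)] at hlt
    by_contra! h3
    nlinarith
  have : n = 0 := by
    rw [← Int.abs_lt_one_iff]; exact_mod_cast h1
  simpa [this] using hn

theorem pt_add_period (f : S.F) (r φ : ℝ) (n : ℤ) :
    S.pt f r (φ + n * (2 * Real.pi)) = S.pt f r φ := by
  rw [pt, pt, (S.face_injective f).eq_iff, hemi_eq_iff]
  exact ⟨rfl, .inr ⟨n, rfl⟩⟩

theorem pt_zero (f : S.F) (φ φ' : ℝ) : S.pt f 0 φ = S.pt f 0 φ' :=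
  (pt_eq_iff ⟨le_rfl, by positivity⟩ ⟨le_rfl, by positivity⟩).2 ⟨rfl, .inl rfl⟩

theorem cell_unique {x : Q} {c c' : S.Cell} (h : x ∈ S.openCell c) (h' : x ∈ S.openCell c') :
    c = c' := (S.partition x).unique h h'

theorem pt_mem_openFace {f : S.F} {r : ℝ} (hr : r ∈ Ico 0 (Real.pi / 2)) (φ : ℝ) :
    S.pt f r φ ∈ S.openFace f := by
  refine ⟨_, ?_, rfl⟩
  rw [projIcc_of_mem _ ⟨hr.1, hr.2.le⟩]
  simpa [hemi] using Real.cos_pos_of_mem_Ioo ⟨by linarith [Real.pi_pos, hr.1], hr.2⟩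

theorem pt_mem_range (f : S.F) (r φ : ℝ) : S.pt f r φ ∈ range (S.face f) := ⟨_, rfl⟩

theorem rim_mem_range (f : S.F) (φ : ℝ) : S.rim f φ ∈ range (S.face f) := ⟨_, rfl⟩

theorem openFace_subset (f : S.F) : S.openFace f ⊆ range (S.face f) := by
  rintro _ ⟨p, _, rfl⟩; exact ⟨p, rfl⟩

theorem exists_pt_eq {f : S.F} {q : Q} (h : q ∈ range (S.face f)) :
    ∃ r ∈ Icc 0 (Real.pi / 2), ∃ φ, q = S.pt f r φ := by
  obtain ⟨p, rfl⟩ := h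
  obtain ⟨r, φ, rfl⟩ := exists_hemi_eq p
  exact ⟨r, r.2, φ, by rw [pt, projIcc_val]⟩

theorem mem_openFace_iff {f : S.F} {q : Q} :
    q ∈ S.openFace f ↔ ∃ r ∈ Ico 0 (Real.pi / 2), ∃ φ, q = S.pt f r φ := by
  constructor
  · rintro ⟨p, hp, rfl⟩
    obtain ⟨r, φ, rfl⟩ := exists_hemi_eq p
    refine ⟨r, ⟨r.2.1, lt_of_le_of_ne r.2.2 fun h => ?_⟩, φ, by rw [pt, projIcc_val]⟩
    simp [hemi, h] at hp
  · rintro ⟨r, hr, φ, rfl⟩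
    exact pt_mem_openFace hr φ

theorem mem_closedCell_edge {e : S.E} {q : Q} (h : q ∈ S.closedCell (.inr (.inl e))) :
    q ∈ S.openCell (.inr (.inl e)) ∨ ∃ v, q = S.vert v := by
  obtain ⟨u, hu, rfl⟩ := h
  rcases hu.1.eq_or_lt with h1 | h1
  · obtain ⟨v, hv⟩ := (S.edge_ends e).1
    exact .inr ⟨v, by rw [← h1, hv]⟩
  rcases hu.2.eq_or_lt with h2 | h2
  · obtain ⟨v, hv⟩ := (S.edge_ends e).2
    exact .inr ⟨v, by rw [h2, hv]⟩
  · exact .inl ⟨u, ⟨h1, h2⟩, rfl⟩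

theorem vert_mem_skel (v : S.V) : S.vert v ∈ S.skel := fun f h => by
  have := cell_unique (S := S) (c := .inl v) rfl h
  simp at this

theorem openEdge_subset_skel (e : S.E) : S.openCell (.inr (.inl e)) ⊆ S.skel := fun q hq f h => by
  have := cell_unique hq h
  simp at this

theorem closedEdge_subset_skel (e : S.E) : S.closedCell (.inr (.inl e)) ⊆ S.skel := fun q hq => by
  rcases mem_closedCell_edge hq with h | ⟨v, rfl⟩
  · exact openEdge_subset_skel e h
  · exact vert_mem_skel v

theorem rim_mem_skel (f : S.F) (φ : ℝ) : S.rim f φ ∈ S.skel := by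
  obtain ⟨e, _, he⟩ := S.boundary f φ
  exact closedEdge_subset_skel e he

theorem mem_range_face {f : S.F} {q : Q} (h : q ∈ range (S.face f)) :
    q ∈ S.openFace f ∨ ∃ φ, q = S.rim f φ := by
  obtain ⟨r, hr, φ, rfl⟩ := exists_pt_eq h
  rcases hr.2.eq_or_lt with h2 | h2
  · exact .inr ⟨φ, by rw [h2, pt_half]⟩
  · exact .inl (pt_mem_openFace ⟨hr.1, h2⟩ φ)

theorem exists_rim_eq {f : S.F} {q : Q} (hq : q ∈ S.skel) (h : q ∈ range (S.face f)) :
    ∃ φ, q = S.rim f φ := (mem_range_face h).resolve_left (hq f)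

theorem eq_of_mem_openFace {f g : S.F} {q : Q} (h : q ∈ S.openFace f)
    (hg : q ∈ range (S.face g)) : g = f := by
  rcases mem_range_face hg with h1 | ⟨φ, rfl⟩
  · have := cell_unique h1 h
    simpa using this
  · exact absurd h (rim_mem_skel g φ f)

theorem skel_or_openFace (q : Q) : q ∈ S.skel ∨ ∃ f, q ∈ S.openFace f := by
  by_cases h : q ∈ S.skel
  · exact .inl h
  · right; simpa [skel] using h

theorem skel_cases {q : Q} (hq : q ∈ S.skel) :
    (∃ v, q = S.vert v) ∨ ∃ e, q ∈ S.openCell (.inr (.inl e)) := by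
  obtain ⟨c, hc, _⟩ := S.partition q
  rcases c with v | e | f
  · exact .inl ⟨v, hc⟩
  · exact .inr ⟨e, hc⟩
  · exact absurd hc (hq f)

/-- The point lies on some edge of the boundary of `f`, and an interior point of `e` is on no closed
edge other than `e`. -/
theorem incident_of_mem {e : S.E} {f : S.F} {q : Q} (hq : q ∈ S.openCell (.inr (.inl e)))
    (hf : q ∈ range (S.face f)) : S.Incident f e := by
  obtain ⟨φ, rfl⟩ := exists_rim_eq (openEdge_subset_skel e hq) hf
  obtain ⟨e', he', h⟩ := S.boundary f φ
  rcases mem_closedCell_edge h with h1 | ⟨v, hv⟩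
  · have := cell_unique hq h1
    simp only [Sum.inr.injEq, Sum.inl.injEq] at this
    rwa [this]
  · have := cell_unique (S := S) (c' := .inl v) hq hv
    simp at this

theorem exists_other_face {f : S.F} {e : S.E} (h : S.Incident f e) :
    ∃ g, g ≠ f ∧ S.Incident g e ∧ ∀ k, S.Incident k e → k = f ∨ k = g := by
  obtain ⟨a, b, hab, hs⟩ := ncard_eq_two.1 (S.two_faces e)
  have hm : ∀ k, S.Incident k e ↔ k = a ∨ k = b := fun k => by
    have := Set.ext_iff.1 hs k
    simpa using this
  rcases (hm f).1 h with rfl | rfl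
  · exact ⟨b, hab.symm, (hm b).2 (.inr rfl), fun k hk => (hm k).1 hk⟩
  · exact ⟨a, hab, (hm a).2 (.inl rfl), fun k hk => ((hm k).1 hk).symm⟩

theorem exists_incident_face (e : S.E) : ∃ f, S.Incident f e := by
  obtain ⟨a, b, hab, hs⟩ := ncard_eq_two.1 (S.two_faces e)
  have := Set.ext_iff.1 hs a
  exact ⟨a, by simpa using this⟩

theorem edge_eq_rim {f : S.F} {e : S.E} (h : S.Incident f e) {u : ℝ} (hu : u ∈ Icc 0 (S.len e)) :
    S.edge e u = S.rim f (S.start f e + S.dir f e * u) := S.arc f e h u hu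

theorem abs_dir (f : S.F) (e : S.E) : |S.dir f e| = 1 := by
  rcases S.dir_eq f e with h | h <;> simp [h]

theorem dir_mul_dir (f : S.F) (e : S.E) : S.dir f e * S.dir f e = 1 := by
  rcases S.dir_eq f e with h | h <;> simp [h]

theorem edge_injOn (hlen : ∀ e, S.len e < Real.pi) (e : S.E) :
    InjOn (S.edge e) (Icc 0 (S.len e)) := by
  intro u hu u' hu' h
  obtain ⟨f, hf⟩ := exists_incident_face e
  rw [edge_eq_rim hf hu, edge_eq_rim hf hu'] at h
  have h1 := eq_of_rim_eq h (by
    have : S.start f e + S.dir f e * u - (S.start f e + S.dir f e * u') = S.dir f e * (u - u') := by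
      ring
    rw [this, abs_mul, abs_dir, one_mul, abs_lt]
    constructor <;> linarith [hu.1, hu.2, hu'.1, hu'.2, hlen e])
  have h2 : S.dir f e * (u - u') = 0 := by linarith
  rcases mul_eq_zero.1 h2 with h3 | h3
  · have := abs_dir f e
    simp [h3] at this
  · linarith

/-- Near each boundary point of a face, in each of the two directions, the boundary follows an
edge. -/
theorem exists_edge_germ (hlen : ∀ e, S.len e < Real.pi) (f : S.F) (φ : ℝ) {σ : ℝ}
    (hσ : σ = 1 ∨ σ = -1) : ∃ (e : S.E) (u η : ℝ) (n : ℤ), S.Incident f e ∧ 0 < η ∧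
      S.start f e + S.dir f e * u = φ + n * (2 * Real.pi) ∧
      ∀ x ∈ Icc 0 η, u + S.dir f e * σ * x ∈ Icc 0 (S.len e) := by
  have hpi := Real.pi_pos
  have hσ1 : |σ| = 1 := by rcases hσ with h | h <;> simp [h]
  have hσ2 : σ * σ = 1 := by rcases hσ with h | h <;> simp [h]
  -- Points of the boundary that approach longitude `φ` from the side `σ`. There are finitely many
  -- edges, so one edge `e` contains infinitely many of them, hence also their limit, and by
  -- convexity the whole arc in between.
  let a : ℕ → ℝ := fun n => 1 / ((n : ℝ) + 1)
  have ha0 : ∀ n, 0 < a n := fun n => by positivity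
  have ha1 : ∀ n, a n ≤ 1 := fun n => by
    rw [div_le_one (by positivity)]; linarith [Nat.cast_nonneg (α := ℝ) n]
  have hlim : Filter.Tendsto a Filter.atTop (nhds 0) := tendsto_one_div_add_atTop_nhds_zero_nat
  choose E hE hmem using fun n => S.boundary f (φ + σ * a n)
  have := S.finite_E
  obtain ⟨e, he⟩ := Finite.exists_infinite_fiber E
  rw [Set.infinite_coe_iff] at he
  have hfi : ∃ᶠ n in Filter.atTop, E n = e := by
    rw [Nat.frequently_atTop_iff_infinite]; exact he
  have hinc : S.Incident f e := by
    obtain ⟨n, hn⟩ := he.nonempty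
    rw [← (hn : E n = e)]; exact hE n
  have key : ∀ n, E n = e → ∃ u ∈ Icc 0 (S.len e), ∃ m : ℤ,
      φ + σ * a n = S.start f e + S.dir f e * u + m * (2 * Real.pi) := fun n hn => by
    have h := hmem n
    rw [hn] at h
    obtain ⟨u, hu, h1⟩ := h
    rw [edge_eq_rim hinc hu] at h1
    exact ⟨u, hu, rim_eq_iff.1 h1.symm⟩
  obtain ⟨n₀, hn₀⟩ := he.nonempty
  obtain ⟨u₀, hu₀, m, hm⟩ := key n₀ hn₀
  have hd2 := dir_mul_dir f e
  have key2 : ∀ n, E n = e →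
      S.dir f e * (φ + σ * a n - S.start f e - m * (2 * Real.pi)) ∈ Icc 0 (S.len e) := by
    intro n hn
    obtain ⟨u, hu, k, hk⟩ := key n hn
    have h1 : ((k - m : ℤ) : ℝ) * (2 * Real.pi) = σ * (a n - a n₀) - S.dir f e * (u - u₀) := by
      push_cast; linarith
    -- The sampled longitudes vary by less than `1` and the edge parameters by less than `π`, so the
    -- number of full turns is the same for all samples on `e`.
    have h2 : |((k - m : ℤ) : ℝ) * (2 * Real.pi)| < 1 * (2 * Real.pi) := by
      rw [h1]
      calc _ ≤ |σ * (a n - a n₀)| + |S.dir f e * (u - u₀)| := abs_sub _ _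
        _ = |a n - a n₀| + |u - u₀| := by rw [abs_mul, abs_mul, hσ1, abs_dir, one_mul, one_mul]
        _ < 1 + Real.pi := by
          apply add_lt_add
          · rw [abs_lt]; constructor <;> linarith [ha0 n, ha0 n₀, ha1 n, ha1 n₀]
          · rw [abs_lt]; constructor <;> linarith [hu.1, hu.2, hu₀.1, hu₀.2, hlen e]
        _ < _ := by linarith [Real.pi_gt_three]
    rw [abs_mul, abs_of_pos (by positivity : 0 < 2 * Real.pi)] at h2
    have h3 := lt_of_mul_lt_mul_right h2 (by positivity)
    have h4 : k - m = 0 := by rw [← Int.abs_lt_one_iff]; exact_mod_cast h3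
    have h5 : k = m := by omega
    rw [h5] at hk
    have : S.dir f e * (φ + σ * a n - S.start f e - m * (2 * Real.pi)) = u := by
      rw [hk]; linear_combination u * hd2
    rwa [this]
  have hu : S.dir f e * (φ - S.start f e - m * (2 * Real.pi)) ∈ Icc 0 (S.len e) := by
    refine isClosed_Icc.mem_of_frequently_of_tendsto (hfi.mono key2) ?_
    have : Filter.Tendsto (fun n => S.dir f e * (φ + σ * a n - S.start f e - m * (2 * Real.pi)))
      Filter.atTop (nhds (S.dir f e * (φ + σ * 0 - S.start f e - m * (2 * Real.pi)))) :=
      ((((hlim.const_mul σ).const_add φ).sub_const _).sub_const _).const_mul _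
    simpa using this
  refine ⟨e, S.dir f e * (φ - S.start f e - m * (2 * Real.pi)), a n₀, -m, hinc, ha0 n₀, ?_, ?_⟩
  · push_cast
    linear_combination (φ - S.start f e - m * (2 * Real.pi)) * hd2
  · intro x hx
    have h1 := key2 n₀ hn₀
    have hl : (0:ℝ) ≤ x / a n₀ := div_nonneg hx.1 (ha0 n₀).le
    have hl1 : x / a n₀ ≤ 1 := by rw [div_le_one (ha0 n₀)]; exact hx.2
    have := (convex_Icc 0 (S.len e)) hu h1 (sub_nonneg.2 hl1) hl (by ring)
    convert this using 1
    simp only [smul_eq_mul]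
    have := (ha0 n₀).ne'
    field_simp
    ring

/-- Near a boundary point of the face `f`, in a given direction, the boundary of `f` coincides with
the boundary of exactly one other face `g`. -/
theorem exists_neighbour (hlen : ∀ e, S.len e < Real.pi) (f : S.F) (φ : ℝ) {σ : ℝ}
    (hσ : σ = 1 ∨ σ = -1) : ∃ (e : S.E) (u τ η : ℝ) (g : S.F) (ψ σ' : ℝ), g ≠ f ∧ 0 < η ∧
      (τ = 1 ∨ τ = -1) ∧ (σ' = 1 ∨ σ' = -1) ∧ u ∈ Icc 0 (S.len e) ∧
      (∀ x ∈ Ioc 0 η, u + τ * x ∈ Ioo 0 (S.len e)) ∧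
      (∀ x ∈ Icc 0 η, S.rim f (φ + σ * x) = S.edge e (u + τ * x)) ∧
      (∀ x ∈ Icc 0 η, S.rim g (ψ + σ' * x) = S.edge e (u + τ * x)) ∧
      (∀ k, S.Incident k e ↔ k = f ∨ k = g) := by
  obtain ⟨e, u, η, n, hinc, hη, hu, hx⟩ := exists_edge_germ hlen f φ hσ
  obtain ⟨g, hgf, hg, hk⟩ := exists_other_face hinc
  have hd2 := dir_mul_dir f e
  have hx' : ∀ x ∈ Icc 0 (η / 2), u + S.dir f e * σ * x ∈ Icc 0 (S.len e) := fun x h =>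
    hx x ⟨h.1, by linarith [h.2]⟩
  have h0 : u ∈ Icc 0 (S.len e) := by simpa using hx 0 ⟨le_rfl, hη.le⟩
  have hdir := S.dir_eq f e
  have hdir' := S.dir_eq g e
  -- Halving the interval keeps the parameters with `0 < x ≤ η / 2` strictly inside the edge.
  refine ⟨e, u, S.dir f e * σ, η / 2, g, S.start g e + S.dir g e * u, S.dir g e * (S.dir f e * σ),
    hgf, by positivity, ?_, ?_, h0, ?_, ?_, ?_, ?_⟩
  · rcases hσ with h | h <;> rcases hdir with h' | h' <;> simp [h, h']
  · rcases hσ with h | h <;> rcases hdir with h' | h' <;> rcases hdir' with h'' | h'' <;>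
      simp [h, h', h'']
  · intro x h
    have h2 := hx η ⟨hη.le, le_rfl⟩
    have h3 := h.1
    have h4 := h.2
    have : S.dir f e * σ = 1 ∨ S.dir f e * σ = -1 := by
      rcases hσ with h | h <;> rcases hdir with h' | h' <;> simp [h, h']
    rcases this with e1 | e1 <;> rw [e1] at h2 ⊢ <;> constructor <;>
      linarith [h0.1, h0.2, h2.1, h2.2]
  · intro x h
    rw [edge_eq_rim hinc (hx' x h), rim_eq_iff]
    refine ⟨-n, ?_⟩
    push_cast
    linear_combination -hu - σ * x * hd2
  · intro x h
    rw [edge_eq_rim hg (hx' x h)]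
    congr 1
    ring
  · intro k
    exact ⟨hk k, by rintro (rfl | rfl) <;> assumption⟩

end HemisphereComplex

end Spherical

namespace Spherical

/-! ### The sphere has no local cut points -/

/-- The action of a linear isometry on the sphere. -/
noncomputable def mapS2 (M : E3 ≃ₗᵢ[ℝ] E3) (x : S2) : S2 :=
  ⟨M x, by rw [mem_sphere_zero_iff_norm, M.norm_map, x.norm_coe]⟩

theorem sphDist_mapS2 (M : E3 ≃ₗᵢ[ℝ] E3) (x y : S2) :
    sphDist (mapS2 M x) (mapS2 M y) = sphDist x y := by
  rw [sphDist_eq_arccos, sphDist_eq_arccos]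
  simp [mapS2]

theorem continuous_mapS2 (M : E3 ≃ₗᵢ[ℝ] E3) : Continuous (mapS2 M) :=
  (M.continuous.comp continuous_subtype_val).subtype_mk _

theorem exists_mapS2_eq (x y : S2) : ∃ M, mapS2 M x = y := by
  refine ⟨Submodule.reflection (ℝ ∙ ((x : E3) - y))ᗮ, Subtype.ext ?_⟩
  exact Submodule.reflection_sub (by rw [x.norm_coe, y.norm_coe])

theorem mapS2_surjective (M : E3 ≃ₗᵢ[ℝ] E3) : Function.Surjective (mapS2 M) := fun y =>
  ⟨mapS2 M.symm y, Subtype.ext (M.apply_symm_apply _)⟩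

/-- Every point of the sphere has polar coordinates centered at the image of the pole. -/
theorem exists_mapS2_polar_eq (M : E3 ≃ₗᵢ[ℝ] E3) (w : S2) :
    ∃ a, w = mapS2 M (polar (sphDist (mapS2 M (polar 0 0)) w) a) := by
  obtain ⟨v, rfl⟩ := mapS2_surjective M w
  obtain ⟨a, ha⟩ := exists_polar_sphDist_eq v
  exact ⟨a, by rw [sphDist_mapS2, ha]⟩

/-- In polar coordinates centered at `p` a punctured disc is the continuous image of the rectangle
`(0, δ) × ℝ`. -/
theorem exists_preconnected_punctured {p : S2} {O : Set S2} (hO : IsOpen O) (hp : p ∈ O) :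
    ∃ W : Set S2, W ⊆ O \ {p} ∧ IsPreconnected W ∧ insert p W ∈ nhds p := by
  have hpi := Real.pi_pos
  have hc : Continuous fun w => sphDist p w :=
    continuous_comp_sphDist continuous_const continuous_id
  -- The topology comes from the chordal metric, so the angular radius is obtained by compactness,
  -- as the angular distance from `p` to the complement of `O`.
  have hδ : ∃ δ, 0 < δ ∧ δ ≤ Real.pi ∧ ∀ w, sphDist p w < δ → w ∈ O := by
    rcases (Oᶜ).eq_empty_or_nonempty with h | h
    · refine ⟨Real.pi, hpi, le_rfl, fun w _ => ?_⟩
      rw [compl_empty_iff] at h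
      rw [h]; trivial
    · obtain ⟨z, hz, hmin⟩ := hO.isClosed_compl.isCompact.exists_isMinOn h hc.continuousOn
      refine ⟨sphDist p z, ?_, sphDist_le_pi _ _, fun w hw => ?_⟩
      · refine lt_of_le_of_ne (sphDist_nonneg _ _) fun h0 => hz ?_
        rw [← eq_of_sphDist_eq_zero h0.symm]; exact hp
      · by_contra hwO
        exact absurd (hmin hwO) (not_le.2 hw)
  obtain ⟨δ, hδ0, hδ1, hδO⟩ := hδ
  obtain ⟨M, hM⟩ := exists_mapS2_eq (polar 0 0) p
  let W : Set S2 := (fun z : ℝ × ℝ => mapS2 M (polar z.1 z.2)) '' (Ioo 0 δ ×ˢ univ)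
  have hWd : ∀ w ∈ W, 0 < sphDist p w ∧ sphDist p w < δ := by
    rintro _ ⟨⟨r, a⟩, ⟨hr, _⟩, rfl⟩
    simp only
    rw [← hM, sphDist_mapS2, sphDist_pole _ _ ⟨hr.1.le, hr.2.le.trans hδ1⟩]
    exact hr
  refine ⟨W, fun w hw => ⟨hδO w (hWd w hw).2, ?_⟩, ?_, ?_⟩
  · rintro rfl
    have := (hWd _ hw).1
    rw [sphDist_self] at this
    exact lt_irrefl _ this
  · exact (isPreconnected_Ioo.prod isPreconnected_univ).image _
      ((continuous_mapS2 M).comp continuous_polar).continuousOn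
  · have : {w | sphDist p w < δ} ∈ nhds p := by
      refine (isOpen_lt hc continuous_const).mem_nhds ?_
      simpa [sphDist_self] using hδ0
    refine Filter.mem_of_superset this fun w hw => ?_
    obtain ⟨a, ha⟩ := exists_mapS2_polar_eq M w
    rw [hM] at ha
    rcases (sphDist_nonneg p w).eq_or_lt with h0 | h0
    · exact .inl (eq_of_sphDist_eq_zero h0.symm).symm
    · exact .inr ⟨(sphDist p w, a), ⟨⟨h0, hw⟩, trivial⟩, ha.symm⟩

/-- A connected punctured neighbourhood of `y` cannot be covered by two closed sets that both
accumulate at `y` and meet only there. Applied to unions of faces, this shows that the faces around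
a point form one cycle and not several. -/
theorem not_local_cut_point {Q : Type*} [TopologicalSpace Q] (h : Q ≃ₜ S2) {y : Q} {A B N : Set Q}
    (hA : IsClosed A) (hB : IsClosed B) (hN : IsOpen N) (hy : y ∈ N) (hAB : N ⊆ A ∪ B)
    (hint : A ∩ B ∩ N ⊆ {y}) (hyA : y ∈ closure (A \ {y})) (hyB : y ∈ closure (B \ {y})) :
    False := by
  obtain ⟨W, hWO, hWc, hWn⟩ := exists_preconnected_punctured (h.isOpenMap N hN) (mem_image_of_mem h hy)
  have hc : IsPreconnected (h ⁻¹' W) := h.isPreconnected_preimage.2 hWc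
  have hsub : h ⁻¹' W ⊆ N \ {y} := fun x hx => by
    obtain ⟨⟨z, hz, hzx⟩, h2⟩ := hWO hx
    rw [h.injective hzx] at hz
    exact ⟨hz, fun h3 => h2 (by rw [show x = y from h3]; rfl)⟩
  have hnb : insert y (h ⁻¹' W) ∈ nhds y := by
    have := h.continuous.continuousAt.preimage_mem_nhds hWn
    refine Filter.mem_of_superset this fun x hx => ?_
    rcases hx with hx | hx
    · exact .inl (h.injective hx)
    · exact .inr hx
  have hne : ∀ C : Set Q, y ∈ closure (C \ {y}) → (h ⁻¹' W ∩ C).Nonempty := fun C hC => by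
    obtain ⟨x, hx, hxC, hxy⟩ := mem_closure_iff_nhds.1 hC _ hnb
    rcases hx with hx | hx
    · exact absurd hx hxy
    · exact ⟨x, hx, hxC⟩
  obtain ⟨x, hx, hxA, hxB⟩ := isPreconnected_closed_iff.1 hc A B hA hB
    (fun x hx => hAB (hsub hx).1) (hne A hyA) (hne B hyB)
  exact (hsub hx).2 (hint ⟨⟨hxA, hxB⟩, (hsub hx).1⟩)

theorem exists_pos_le_of_finite {ι : Type*} [Finite ι] (η : ι → ℝ) (h : ∀ i, 0 < η i) :
    ∃ δ > 0, ∀ i, δ ≤ η i := by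
  rcases isEmpty_or_nonempty ι with _ | _
  · exact ⟨1, one_pos, fun i => isEmptyElim i⟩
  · obtain ⟨i, hi⟩ := Finite.exists_min η
    exact ⟨η i, h i, hi⟩

namespace HemisphereComplex

variable {Q : Type*} [MetricSpace Q] (S : HemisphereComplex Q)

/-! ### Links -/

variable {S} in
theorem dist_face_le (f : S.F) (p q : Hemisphere) :
    dist (S.face f p) (S.face f q) ≤ sphDist p.1 q.1 := by
  have h := S.edist_eq ⟨f, p⟩ ⟨f, q⟩
  have h2 : edist (S.face f p) (S.face f q) ≤ ENNReal.ofReal (sphDist p.1 q.1) := by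
    rw [h]
    have := GlueChain.single (fun (_ : S.F) (p q : Hemisphere) => sphDist p.1 q.1)
      (Setoid.ker fun a : Σ _ : S.F, Hemisphere => S.face a.1 a.2) f p q
    rw [add_zero] at this
    exact iInf₂_le _ this
  rw [edist_dist] at h2
  exact (ENNReal.ofReal_le_ofReal_iff (sphDist_nonneg _ _)).1 h2

variable {S} in
theorem continuous_face (f : S.F) : Continuous (S.face f) := by
  rw [continuous_iff_continuousAt]
  intro p
  rw [ContinuousAt, tendsto_iff_dist_tendsto_zero]
  refine squeeze_zero (fun _ => dist_nonneg) (fun q => dist_face_le f q p) ?_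
  have : Continuous fun q : Hemisphere => sphDist q.1 p.1 :=
    continuous_comp_sphDist continuous_subtype_val continuous_const
  simpa [sphDist_self] using this.tendsto p

theorem continuous_hemi :
    Continuous fun z : Icc (0 : ℝ) (Real.pi / 2) × ℝ => hemi z.1 z.2 := by
  have h1 : Continuous fun z : Icc (0 : ℝ) (Real.pi / 2) × ℝ => (z.1 : ℝ) := by fun_prop
  exact Continuous.subtype_mk (continuous_comp_polar h1 continuous_snd) _

variable {S} in
theorem continuous_pt (f : S.F) {Y : Type*} [TopologicalSpace Y] {r φ : Y → ℝ} (hr : Continuous r)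
    (hφ : Continuous φ) : Continuous fun y => S.pt f (r y) (φ y) := by
  have h1 : Continuous fun y =>
      (projIcc 0 (Real.pi / 2) (by positivity) (r y) : Icc (0 : ℝ) (Real.pi / 2)) :=
    continuous_projIcc.comp hr
  have := (continuous_face f).comp (continuous_hemi.comp (h1.prodMk hφ))
  exact this

variable {S} in
theorem continuous_rim (f : S.F) : Continuous (S.rim f) := by
  have h := continuous_pt f (r := fun _ : ℝ => Real.pi / 2) continuous_const continuous_id
  simp only [pt_half] at h
  exact h

instance : CompactSpace Hemisphere := by
  have : IsClosed {x : S2 | 0 ≤ (x : E3) 2} := by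
    refine isClosed_le continuous_const ?_
    exact (PiLp.continuous_apply 2 _ 2).comp continuous_subtype_val
  exact isCompact_iff_compactSpace.1 this.isCompact

variable {S} in
theorem isClosed_range_face (f : S.F) : IsClosed (range (S.face f)) :=
  (isCompact_range (continuous_face f)).isClosed

variable {S} in
theorem mem_closure_openFace {f : S.F} (φ : ℝ) : S.rim f φ ∈ closure (S.openFace f) := by
  have hpi := Real.pi_pos
  have hc : Continuous fun r => S.pt f r φ :=
    continuous_pt f continuous_id continuous_const
  rw [← pt_half]
  have h1 : Real.pi / 2 ∈ closure (Ico 0 (Real.pi / 2)) := by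
    rw [closure_Ico (by positivity)]; exact ⟨by positivity, le_rfl⟩
  exact map_mem_closure (f := fun r => S.pt f r φ) hc h1 fun r hr => pt_mem_openFace hr φ

/-- A longitude of the point `y` on the boundary of the face `f`. -/
noncomputable def lon (y : Q) (f : S.F) : ℝ :=
  open Classical in if h : ∃ φ, y = S.rim f φ then h.choose else 0

/-- The directions `-1` and `1`. -/
def sgn (b : Bool) : ℝ := if b then 1 else -1

theorem sgn_eq (b : Bool) : sgn b = 1 ∨ sgn b = -1 := by
  cases b <;> simp [sgn]

theorem sgn_not (b : Bool) : sgn (!b) = -sgn b := by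
  cases b <;> simp [sgn]

/-- The boundary directions at `y`: a face that contains `y` and a direction of its boundary. -/
abbrev Dart (y : Q) : Type := {f : S.F // y ∈ range (S.face f)} × Bool

/-- The boundary of the face in a given direction. -/
noncomputable def ray {y : Q} (d : S.Dart y) (x : ℝ) : Q :=
  S.rim d.1.1 (S.lon y d.1.1 + sgn d.2 * x)

variable {S}

theorem rim_lon {y : Q} (hy : y ∈ S.skel) {f : S.F} (hf : y ∈ range (S.face f)) :
    S.rim f (S.lon y f) = y := by
  have h := exists_rim_eq hy hf
  rw [lon, dif_pos h]
  exact h.choose_spec.symm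

/-- Two darts with different faces whose rays coincide. -/
def Twin {y : Q} (d d' : S.Dart y) : Prop :=
  d'.1 ≠ d.1 ∧ ∃ η > 0, ∀ x ∈ Icc 0 η, S.ray d x = S.ray d' x

theorem Twin.symm {y : Q} {d d' : S.Dart y} (h : Twin d d') : Twin d' d :=
  ⟨h.1.symm, h.2.imp fun _ h => ⟨h.1, fun x hx => (h.2 x hx).symm⟩⟩

/-- The neighbourhood of a dart: the edge that it follows and the two faces at this edge. -/
theorem exists_twin (hlen : ∀ e, S.len e < Real.pi) {y : Q} (hy : y ∈ S.skel) (d : S.Dart y) :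
    ∃ (d' : S.Dart y) (e : S.E) (u τ η : ℝ), Twin d d' ∧ 0 < η ∧ (τ = 1 ∨ τ = -1) ∧
      u ∈ Icc 0 (S.len e) ∧ (∀ x ∈ Ioc 0 η, u + τ * x ∈ Ioo 0 (S.len e)) ∧
      (∀ x ∈ Icc 0 η, S.ray d x = S.edge e (u + τ * x)) ∧
      (∀ x ∈ Icc 0 η, S.ray d x = S.ray d' x) ∧
      (∀ k, S.Incident k e ↔ k = d.1.1 ∨ k = d'.1.1) := by
  obtain ⟨e, u, τ, η, g, ψ, σ, hgf, hη, hτ, hσ, hu, hx, h1, h2, h3⟩ :=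
    exists_neighbour hlen d.1.1 (S.lon y d.1.1) (sgn_eq d.2)
  have hy1 : S.rim g ψ = y := by
    have e1 := h1 0 ⟨le_rfl, hη.le⟩
    have e2 := h2 0 ⟨le_rfl, hη.le⟩
    rw [mul_zero, add_zero] at e1 e2
    rw [e2, ← e1, rim_lon hy d.1.2]
  have hg : y ∈ range (S.face g) := by rw [← hy1]; exact rim_mem_range g ψ
  obtain ⟨n, hn⟩ := rim_eq_iff.1 ((rim_lon hy hg).trans hy1.symm)
  obtain ⟨b, hb⟩ : ∃ b, sgn b = σ := by
    rcases hσ with h | h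
    · exact ⟨true, by simp [sgn, h]⟩
    · exact ⟨false, by simp [sgn, h]⟩
  have h4 : ∀ x ∈ Icc 0 η, S.ray d x = S.ray (y := y) (⟨g, hg⟩, b) x := fun x hx => by
    refine ((h1 x hx).trans (h2 x hx).symm).trans ?_
    rw [ray, rim_eq_iff]
    exact ⟨-n, by simp only [hn, hb]; push_cast; ring⟩
  exact ⟨(⟨g, hg⟩, b), e, u, τ, η, ⟨fun h => hgf (congrArg Subtype.val h), η, hη, h4⟩, hη, hτ, hu,
    hx, h1, h4, h3⟩

theorem ray_mem_range {y : Q} (d : S.Dart y) (x : ℝ) : S.ray d x ∈ range (S.face d.1.1) :=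
  rim_mem_range _ _

/-- A point of the ray close to `y` is interior to an edge with exactly two faces, which determines
the face of the twin. The direction is determined too: at distance `x ≤ 1` the two directions give
longitudes less than a full turn apart. -/
theorem Twin.unique (hlen : ∀ e, S.len e < Real.pi) {y : Q} (hy : y ∈ S.skel) {d a b : S.Dart y}
    (ha : Twin d a) (hb : Twin d b) : a = b := by
  obtain ⟨c, e, u, τ, η, hc, hη, hτ, hu, hx, h1, h2, h3⟩ := exists_twin hlen hy d
  have key : ∀ a, Twin d a → a = c := by
    rintro a ⟨had, η', hη', h⟩
    set x := min (min η η') 1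
    have hx0 : 0 < x := by positivity
    have hxη : x ≤ η := (min_le_left _ _).trans (min_le_left _ _)
    have hxη' : x ≤ η' := (min_le_left _ _).trans (min_le_right _ _)
    have e1 := h1 x ⟨hx0.le, hxη⟩
    have e2 := h2 x ⟨hx0.le, hxη⟩
    have e3 := h x ⟨hx0.le, hxη'⟩
    have hmem : S.ray d x ∈ S.openCell (.inr (.inl e)) := by
      rw [e1]; exact ⟨_, hx x ⟨hx0, hxη⟩, rfl⟩
    have hia : a.1.1 = c.1.1 := by
      have := (h3 a.1.1).1 (incident_of_mem hmem (by rw [e3]; exact ray_mem_range a x))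
      exact this.resolve_left fun h => had (Subtype.ext h)
    have h5 : S.ray a x = S.ray c x := e3.symm.trans e2
    refine Prod.ext (Subtype.ext hia) ?_
    rw [ray, ray, hia] at h5
    have hx1 : x ≤ 1 := min_le_right _ _
    have := Real.pi_gt_three
    have h6 := eq_of_rim_eq h5 (by
      rcases sgn_eq a.2 with h | h <;> rcases sgn_eq c.2 with h' | h' <;> rw [h, h', abs_lt] <;>
        constructor <;> linarith)
    have h7 : (sgn a.2 - sgn c.2) * x = 0 := by linarith
    have h8 : sgn a.2 = sgn c.2 := by
      rcases mul_eq_zero.1 h7 with h | h <;> linarith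
    revert h8
    cases a.2 <;> cases c.2 <;> simp [sgn] <;> norm_num
  rw [key a ha, key b hb]

/-- The cyclic sequence of faces around a point `y` of the `1`-skeleton: the boundary of `f i` in the
direction `ε i` coincides with the boundary of `f (i + 1)` in the direction `- ε (i + 1)`. -/
structure LinkCycle (S : HemisphereComplex Q) (y : Q) where
  k : ℕ
  f : ℤ → S.F
  φ : ℤ → ℝ
  ε : ℤ → ℝ
  η : ℝ
  two_le : 2 ≤ k
  ε_eq : ∀ i, ε i = 1 ∨ ε i = -1
  η_pos : 0 < η
  periodic : ∀ i (n : ℤ), f (i + n * k) = f i ∧ φ (i + n * k) = φ i ∧ ε (i + n * k) = ε i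
  inj : ∀ i j, f i = f j → (k : ℤ) ∣ i - j
  base : ∀ i, S.rim (f i) (φ i) = y
  glue : ∀ i, ∀ x ∈ Icc 0 η,
    S.rim (f i) (φ i + ε i * x) = S.rim (f (i + 1)) (φ (i + 1) - ε (i + 1) * x)
  faces : ∀ g, y ∈ range (S.face g) → ∃ i, f i = g
  edges : ∀ i, ∃ (e : S.E) (u τ : ℝ), (τ = 1 ∨ τ = -1) ∧ u ∈ Icc 0 (S.len e) ∧
    (∀ x ∈ Ioc 0 η, u + τ * x ∈ Ioo 0 (S.len e)) ∧
    (∀ x ∈ Icc 0 η, S.rim (f i) (φ i + ε i * x) = S.edge e (u + τ * x)) ∧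
    ∀ g, S.Incident g e ↔ g = f i ∨ g = f (i + 1)

/-- Darts at `y` carry two involutions without fixed points: `fl` changes the direction inside a
face, `tw` passes to the neighbouring face along the same edge. Their composite `rot` walks around
`y`, and the orbit of one dart is the link cycle. It contains each face at most once per period
because no dart in it is the flip of another, and it contains all faces at `y` because `y` is not a
local cut point. -/
theorem exists_linkCycle (hlen : ∀ e, S.len e < Real.pi) (hQ : Nonempty (Q ≃ₜ S2)) {y : Q}
    (hy : y ∈ S.skel) : Nonempty (S.LinkCycle y) := by
  have := S.finite_F
  choose tw E U T H hTw hH hT hU hx hE hR hI using fun d => exists_twin hlen hy (y := y) d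
  have htw : ∀ d, tw (tw d) = d := fun d => (hTw (tw d)).unique hlen hy (hTw d).symm
  let fl : S.Dart y → S.Dart y := fun d => (d.1, !d.2)
  have hfl : ∀ d, fl (fl d) = d := fun d => by simp [fl]
  have hfl_ne : ∀ d, fl d ≠ d := fun d h => by
    have := congrArg Prod.snd h
    simp [fl] at this
  let rot : Equiv.Perm (S.Dart y) :=
    { toFun := fun d => tw (fl d)
      invFun := fun d => fl (tw d)
      left_inv := fun d => by simp only [htw, hfl]
      right_inv := fun d => by simp only [htw, hfl] }
  have hrot : ∀ d, rot d = tw (fl d) := fun _ => rfl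
  have hrot' : ∀ d, rot.symm d = fl (tw d) := fun _ => rfl
  obtain ⟨f₀, p₀, hp₀⟩ := S.cover y
  let d₀ : S.Dart y := (⟨f₀, p₀, hp₀⟩, true)
  let D : ℤ → S.Dart y := fun i => (rot ^ i) d₀
  have hD1 : ∀ i, D (i + 1) = rot (D i) := fun i => by
    simp only [D]; rw [add_comm, zpow_add, zpow_one]; rfl
  have hDs : ∀ i, D (i - 1) = rot.symm (D i) := fun i => by
    rw [Equiv.eq_symm_apply, ← hD1, sub_add_cancel]
  have hstep : ∀ i j, fl (D i) = D j → fl (D (i + 1)) = D (j - 1) := fun i j h => by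
    rw [hDs, ← h, hrot', hD1, hrot]
  have hstep' : ∀ i j, fl (D i) = D j → fl (D (i - 1)) = D (j + 1) := fun i j h => by
    rw [hD1, ← h, hrot, hfl, hDs, hrot', hfl]
  have hmir : ∀ i j, fl (D i) = D j → ∀ m : ℤ, fl (D (i + m)) = D (j - m) := fun i j h m => by
    induction m using Int.induction_on with
    | zero => simpa using h
    | succ n ih => rw [← add_assoc, ← sub_sub]; exact hstep _ _ ih
    | pred n ih =>
      rw [← add_sub_assoc, show j - (-(n : ℤ) - 1) = j - -(n : ℤ) + 1 by ring]; exact hstep' _ _ ih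
  -- If the flip of `D i` were in the orbit, flipping would reflect the orbit, exchanging `i + m`
  -- and `j - m`. At the middle of the reflection a dart would equal its own flip (`j - i` even) or
  -- its own twin (`j - i` odd).
  have hno : ∀ i j, fl (D i) ≠ D j := fun i j h => by
    rcases Int.even_or_odd' (j - i) with ⟨m, hm | hm⟩
    · have := hmir i j h m
      rw [show j - m = i + m by omega] at this
      exact hfl_ne _ this
    · have := hmir i j h m
      rw [show j - m = (i + m) + 1 by omega, hD1, hrot] at this
      exact (hTw (fl (D (i + m)))).1 (congrArg Prod.fst this).symm
  set k := Function.minimalPeriod (fun x => rot • x) d₀ with hk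
  have hper : ∀ n : ℤ, (rot ^ n) d₀ = d₀ ↔ (k : ℤ) ∣ n := fun n =>
    MulAction.zpow_smul_eq_iff_minimalPeriod_dvd (a := rot) (b := d₀)
  have hkpos : 0 < k := by
    refine Function.minimalPeriod_pos_of_mem_periodicPts ?_
    have := isOfFinOrder_of_finite rot
    obtain ⟨n, hn, h⟩ := isOfFinOrder_iff_pow_eq_one.1 this
    refine ⟨n, hn, ?_⟩
    rw [Function.IsPeriodicPt, Function.IsFixedPt, smul_iterate, h]
    exact one_smul _ _
  have hDeq : ∀ i j, D i = D j ↔ (k : ℤ) ∣ i - j := fun i j => by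
    rw [← hper]
    constructor
    · intro h
      rw [sub_eq_neg_add, zpow_add, Equiv.Perm.mul_apply, show (rot ^ i) d₀ = (rot ^ j) d₀ from h,
        ← Equiv.Perm.mul_apply, ← zpow_add, neg_add_cancel, zpow_zero, Equiv.Perm.one_apply]
    · intro h
      have : D i = (rot ^ j) ((rot ^ (i - j)) d₀) := by
        rw [← Equiv.Perm.mul_apply, ← zpow_add, add_sub_cancel]
      rw [this, h]
  have hface : ∀ i j, (D i).1 = (D j).1 → D i = D j := fun i j h => by
    by_contra hne
    refine hno j i (Prod.ext h.symm ?_)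
    have h2 : (D i).2 ≠ (D j).2 := fun h2 => hne (Prod.ext h h2)
    revert h2
    simp only [fl]
    cases (D i).2 <;> cases (D j).2 <;> simp
  have hnext : ∀ i, (D (i + 1)).1 ≠ (D i).1 := fun i => by
    rw [hD1, hrot]; exact (hTw (fl (D i))).1
  have hk2 : 2 ≤ k := by
    by_contra h
    have h1 : k = 1 := by omega
    exact hnext 0 (by rw [(hDeq (0 + 1) 0).2 (by simp [h1])])
  obtain ⟨η, hη, hηH⟩ := exists_pos_le_of_finite H hH
  have hall : ∀ g (hg : y ∈ range (S.face g)), ∃ i, (D i).1.1 = g := by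
    by_contra! hcon
    obtain ⟨g₀, hg₀, hg₀D⟩ := hcon
    let I : Set S.F := {g | ∃ i, (D i).1.1 = g}
    let J : Set S.F := {g | y ∈ range (S.face g) ∧ g ∉ I}
    let A : Set Q := ⋃ g ∈ I, range (S.face g)
    let B : Set Q := ⋃ g ∈ J, range (S.face g)
    let δ := min η 1
    have hδ : 0 < δ := by positivity
    -- `Z` collects the faces that miss `y` and the parts of the rims at distance at least `δ` from
    -- `y`. Outside `Z`, a point other than `y` common to `A` and `B` would be interior to an edge
    -- at `y` that bounds a face of the orbit; but then the other face at this edge is in the orbit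
    -- as well.
    let Z : Set Q := (⋃ g ∈ {g : S.F | y ∉ range (S.face g)}, range (S.face g)) ∪
      ⋃ g : S.F, S.rim g '' Icc (S.lon y g + δ) (S.lon y g + 2 * Real.pi - δ)
    have hcl : ∀ I : Set S.F, IsClosed (⋃ g ∈ I, range (S.face g)) := fun I =>
      I.toFinite.isClosed_biUnion fun g _ => isClosed_range_face g
    have hZ : IsClosed Z := (hcl _).union <| isClosed_iUnion_of_finite fun g =>
      ((isCompact_Icc).image (continuous_rim g)).isClosed
    have hIy : ∀ g ∈ I, y ∈ range (S.face g) := by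
      rintro g ⟨i, rfl⟩; exact (D i).1.2
    have hyZ : y ∉ Z := by
      rintro (h | h)
      · simp only [mem_ofPred_eq, mem_iUnion] at h
        obtain ⟨g, hg, h⟩ := h
        exact hg h
      · simp only [mem_iUnion] at h
        obtain ⟨g, φ, hφ, h⟩ := h
        have hg : y ∈ range (S.face g) := by rw [← h]; exact rim_mem_range g φ
        have := eq_of_rim_eq (h.trans (rim_lon hy hg).symm) (by
          rw [abs_lt]; constructor <;> linarith [hφ.1, hφ.2, Real.pi_pos])
        linarith [hφ.1]
    have hclos : ∀ g, y ∈ range (S.face g) → ∀ C, range (S.face g) ⊆ C → y ∈ closure (C \ {y}) :=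
      fun g hg C hC => by
        have := mem_closure_openFace (f := g) (S.lon y g)
        rw [rim_lon hy hg] at this
        refine closure_mono (fun x hxg => mem_sdiff_singleton.2 ⟨hC (openFace_subset g hxg), ?_⟩) this
        rintro rfl
        exact hy g hxg
    refine not_local_cut_point hQ.some (hcl I) (hcl J) hZ.isOpen_compl hyZ ?_ ?_ ?_ ?_
    · intro x hx
      obtain ⟨g, p, rfl⟩ := S.cover x
      have hg : y ∈ range (S.face g) := by
        by_contra hg
        exact hx (.inl (mem_iUnion₂.2 ⟨g, hg, p, rfl⟩))
      by_cases hgI : g ∈ I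
      · exact .inl (mem_iUnion₂.2 ⟨g, hgI, p, rfl⟩)
      · exact .inr (mem_iUnion₂.2 ⟨g, ⟨hg, hgI⟩, p, rfl⟩)
    · rintro x ⟨⟨hxA, hxB⟩, hxZ⟩
      obtain ⟨g, hgI, hxg⟩ := mem_iUnion₂.1 hxA
      obtain ⟨g', hg'J, hxg'⟩ := mem_iUnion₂.1 hxB
      have hne : g' ≠ g := fun h => hg'J.2 (h ▸ hgI)
      have hxs : ∃ φ, x = S.rim g φ := (mem_range_face hxg).resolve_left fun h =>
        hne (eq_of_mem_openFace h hxg')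
      obtain ⟨φ₁, hφ₁⟩ := hxs
      have h2pi : (0 : ℝ) < 2 * Real.pi := by positivity
      obtain ⟨φ, hφ, hxφ⟩ : ∃ φ ∈ Ico (S.lon y g) (S.lon y g + 2 * Real.pi), x = S.rim g φ := by
        refine ⟨toIcoMod h2pi (S.lon y g) φ₁, toIcoMod_mem_Ico _ _ _, ?_⟩
        rw [hφ₁, rim_eq_iff]
        refine ⟨toIcoDiv h2pi (S.lon y g) φ₁, ?_⟩
        have := toIcoMod_add_toIcoDiv_zsmul h2pi (S.lon y g) φ₁
        rw [zsmul_eq_mul] at this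
        exact this.symm
      have hφZ : φ ∉ Icc (S.lon y g + δ) (S.lon y g + 2 * Real.pi - δ) := fun h =>
        hxZ (.inr (mem_iUnion.2 ⟨g, φ, h, hxφ.symm⟩))
      have hgy := hIy g hgI
      -- the point lies on a ray of `g`
      obtain ⟨b, s, hs, hxs⟩ : ∃ b, ∃ s ∈ Ico 0 δ, x = S.ray (y := y) (⟨g, hgy⟩, b) s := by
        by_cases h1 : φ < S.lon y g + δ
        · refine ⟨true, φ - S.lon y g, ⟨by linarith [hφ.1], by linarith⟩, ?_⟩
          rw [hxφ, ray]; congr 1; simp [sgn]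
        · refine ⟨false, S.lon y g + 2 * Real.pi - φ, ⟨by linarith [hφ.2], ?_⟩, ?_⟩
          · by_contra h2
            exact hφZ ⟨by linarith, by linarith⟩
          · rw [hxφ, ray, rim_eq_iff]
            exact ⟨1, by simp [sgn]; ring⟩
      rcases hs.1.eq_or_lt with h0 | h0
      · rw [hxs, ← h0, ray]; simpa using rim_lon hy hgy
      exfalso
      set d : S.Dart y := (⟨g, hgy⟩, b)
      have hsH : s ≤ H d := hs.2.le.trans ((min_le_left _ _).trans (hηH d))
      have hme : x ∈ S.openCell (.inr (.inl (E d))) := by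
        rw [hxs, hE d s ⟨h0.le, hsH⟩]
        exact ⟨_, hx d s ⟨h0, hsH⟩, rfl⟩
      rcases (hI d g').1 (incident_of_mem hme hxg') with h | h
      · exact hne h
      · refine hg'J.2 ?_
        obtain ⟨i, hi⟩ := hgI
        have hi' : (D i).1 = d.1 := Subtype.ext hi
        by_cases h3 : (D i).2 = b
        · refine ⟨i - 1, ?_⟩
          rw [hDs, hrot', h, show D i = d from Prod.ext hi' h3]
        · refine ⟨i + 1, ?_⟩
          rw [hD1, hrot, h]
          have : fl (D i) = d := by
            refine Prod.ext hi' ?_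
            revert h3
            change _ → (!(D i).2) = b
            cases (D i).2 <;> cases b <;> simp
          rw [this]
    · exact hclos (D 0).1.1 (D 0).1.2 A (subset_biUnion_of_mem (u := fun g => range (S.face g))
        (show (D 0).1.1 ∈ I from ⟨0, rfl⟩))
    · exact hclos g₀ hg₀ B (subset_biUnion_of_mem (u := fun g => range (S.face g))
        (show g₀ ∈ J from ⟨hg₀, fun ⟨i, hi⟩ => hg₀D i hi⟩))
  have hray : ∀ i x, S.rim (D i).1.1 (S.lon y (D i).1.1 + -sgn (D i).2 * x) = S.ray (fl (D i)) x :=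
    fun i x => by simp only [ray, fl, sgn_not]
  have hray' : ∀ i x, S.rim (D i).1.1 (S.lon y (D i).1.1 - -sgn (D i).2 * x) = S.ray (D i) x :=
    fun i x => by simp only [ray]; congr 1; ring
  -- The dart `D i` points along the edge shared with face `i - 1`, so the direction towards face `i
  -- + 1` carries the opposite sign.
  refine ⟨⟨k, fun i => (D i).1.1, fun i => S.lon y (D i).1.1, fun i => -sgn (D i).2, η, hk2, ?_, hη,
    ?_, ?_, ?_, ?_, hall, ?_⟩⟩
  · intro i
    rcases sgn_eq (D i).2 with h | h <;> simp [h]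
  · intro i n
    have : D (i + n * k) = D i := (hDeq _ _).2 (by simp)
    simp only [this, and_self]
  · intro i j h
    exact (hDeq i j).1 (hface i j (Subtype.ext h))
  · intro i
    exact rim_lon hy (D i).1.2
  · intro i x h
    rw [hray, hray', hD1, hrot]
    exact hR _ x ⟨h.1, h.2.trans (hηH _)⟩
  · intro i
    refine ⟨E (fl (D i)), U (fl (D i)), T (fl (D i)), hT _, hU _, ?_, ?_, ?_⟩
    · intro x h
      exact hx _ x ⟨h.1, h.2.trans (hηH _)⟩
    · intro x h
      rw [hray]
      exact hE _ x ⟨h.1, h.2.trans (hηH _)⟩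
    · intro g
      rw [hI, hD1, hrot]

end HemisphereComplex

end Spherical

namespace Spherical

namespace HemisphereComplex

variable {Q : Type*} [MetricSpace Q] {S : HemisphereComplex Q}

/-! ### Consequences of polyhedrality -/

/-- A point that lies in two faces lies in a closed cell that is contained in both. -/
theorem exists_cell_subset {f g : S.F} (hfg : f ≠ g) {z : Q} (hf : z ∈ range (S.face f))
    (hg : z ∈ range (S.face g)) : ∃ c : S.Cell, z ∈ S.closedCell c ∧
      S.closedCell c ⊆ range (S.face f) ∧ S.closedCell c ⊆ range (S.face g) := by
  have hz : z ∈ S.skel := fun k hk =>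
    hfg ((eq_of_mem_openFace hk hf).trans (eq_of_mem_openFace hk hg).symm)
  rcases skel_cases hz with ⟨v, hv⟩ | ⟨e, he⟩
  · refine ⟨.inl v, hv, ?_, ?_⟩ <;> rintro _ rfl <;> rwa [← hv]
  · refine ⟨.inr (.inl e), ?_, incident_of_mem he hf, incident_of_mem he hg⟩
    obtain ⟨u, hu, rfl⟩ := he
    exact ⟨u, ⟨hu.1.le, hu.2.le⟩, rfl⟩

/-- The intersection of two different faces is contained in a closed cell of both. -/
theorem exists_common_cell (hP : S.IsPolyhedral) {f g : S.F} (hfg : f ≠ g) {x : Q}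
    (hf : x ∈ range (S.face f)) (hg : x ∈ range (S.face g)) :
    (∃ v, ∀ z ∈ range (S.face f), z ∈ range (S.face g) → z = S.vert v) ∨
    ∃ e, S.Incident f e ∧ S.Incident g e ∧
      ∀ z ∈ range (S.face f), z ∈ range (S.face g) → z ∈ S.closedCell (.inr (.inl e)) := by
  obtain ⟨P, hPc, Φ, hdim, hΦ⟩ := hP
  obtain ⟨c₀, hc₀, hc₀f, hc₀g⟩ := exists_cell_subset hfg hf hg
  have hsub : ∀ c c', S.closedCell c ⊆ S.closedCell c' ↔ (Φ c).1 ⊆ (Φ c').1 := hΦ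
  set A : Set E3 := (Φ (.inr (.inr f))).1 ∩ (Φ (.inr (.inr g))).1
  have hA : ∀ c, S.closedCell c ⊆ range (S.face f) → S.closedCell c ⊆ range (S.face g) →
      (Φ c).1 ⊆ A := fun c h1 h2 =>
    subset_inter ((hsub c (.inr (.inr f))).1 h1) ((hsub c (.inr (.inr g))).1 h2)
  -- The intersection of two exposed faces is exposed, and here it is non-empty and proper, hence it
  -- is a face of the polyhedron; `Φ` turns it back into a cell.
  let a : ProperFace P := ⟨A, (Φ (.inr (.inr f))).2.1.inter (Φ (.inr (.inr g))).2.1,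
    (Φ c₀).2.2.1.mono (hA c₀ hc₀f hc₀g), fun h => (Φ (.inr (.inr f))).2.2.2
      (subset_antisymm (Φ (.inr (.inr f))).2.1.subset (h.symm.subset.trans inter_subset_left))⟩
  obtain ⟨c, hc⟩ := Φ.surjective a
  have hcA : (Φ c).1 = A := congrArg Subtype.val hc
  have hcf : S.closedCell c ⊆ range (S.face f) :=
    (hsub c (.inr (.inr f))).2 (by rw [hcA]; exact inter_subset_left)
  have hcg : S.closedCell c ⊆ range (S.face g) :=
    (hsub c (.inr (.inr g))).2 (by rw [hcA]; exact inter_subset_right)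
  have hz : ∀ z ∈ range (S.face f), z ∈ range (S.face g) → z ∈ S.closedCell c :=
    fun z h1 h2 => by
      obtain ⟨c', h3, h4, h5⟩ := exists_cell_subset hfg h1 h2
      exact (hsub c' c).2 (by rw [hcA]; exact hA c' h4 h5) h3
  rcases c with v | e | k
  · exact .inl ⟨v, hz⟩
  · exact .inr ⟨e, hcf, hcg, hz⟩
  · exfalso
    have hk : S.pt k 0 0 ∈ S.openFace k := pt_mem_openFace ⟨le_rfl, by positivity⟩ 0
    exact hfg ((eq_of_mem_openFace hk (hcf (pt_mem_range k 0 0))).trans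
      (eq_of_mem_openFace hk (hcg (pt_mem_range k 0 0))).symm)

namespace LinkCycle

variable {y : Q} (c : S.LinkCycle y)

theorem mem_range (i : ℤ) : y ∈ range (S.face (c.f i)) :=
  ⟨_, c.base i⟩

/-- Two faces meet at a point in the interior of an edge. -/
theorem k_eq_two {e : S.E} (he : y ∈ S.openCell (.inr (.inl e))) : c.k = 2 := by
  by_contra hk
  have hk3 : 3 ≤ c.k := by have := c.two_le; omega
  have hne : ∀ i j : ℤ, i ≠ j → |i - j| ≤ 2 → c.f i ≠ c.f j := fun i j hij h2 h => by
    have := Int.eq_zero_of_abs_lt_dvd (c.inj i j h) (by omega)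
    omega
  have hi : ∀ i, S.Incident (c.f i) e := fun i => incident_of_mem he (c.mem_range i)
  obtain ⟨g, _, _, h⟩ := exists_other_face (hi 0)
  rcases h _ (hi 1) with h1 | h1
  · exact hne 1 0 (by omega) (by norm_num) h1
  rcases h _ (hi 2) with h2 | h2
  · exact hne 2 0 (by omega) (by norm_num) h2
  exact hne 1 2 (by omega) (by norm_num) (h1.trans h2.symm)

/-- At least three faces meet at a vertex. -/
theorem three_le (hlen : ∀ e, S.len e < Real.pi) (hP : S.IsPolyhedral) {v : S.V}
    (hv : y = S.vert v) : 3 ≤ c.k := by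
  by_contra hk
  have hk2 : c.k = 2 := by have := c.two_le; omega
  have hne : c.f 0 ≠ c.f 1 := fun h => by
    have := c.inj 0 1 h
    rw [hk2] at this
    omega
  obtain ⟨e₀, u₀, τ₀, hτ₀, hu₀, hx₀, hr₀, hi₀⟩ := c.edges 0
  obtain ⟨e₁, u₁, τ₁, hτ₁, hu₁, hx₁, hr₁, hi₁⟩ := c.edges 1
  have hper := c.periodic 0 1
  rw [hk2] at hper
  norm_num at hper hi₀ hi₁ hr₀ hr₁
  rw [hper.1] at hi₁
  have h0η : c.η ∈ Ioc 0 c.η := ⟨c.η_pos, le_rfl⟩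
  have key : ∀ e u τ, u + τ * c.η ∈ Ioo 0 (S.len e) → S.Incident (c.f 0) e →
      S.Incident (c.f 1) e → ∀ e', (∀ z ∈ range (S.face (c.f 0)), z ∈ range (S.face (c.f 1)) →
        z ∈ S.closedCell (.inr (.inl e'))) → e = e' := by
    intro e u τ hu h0 h1 e' h
    have hm : S.edge e (u + τ * c.η) ∈ S.openCell (.inr (.inl e)) := ⟨_, hu, rfl⟩
    have hm' : S.edge e (u + τ * c.η) ∈ S.closedCell (.inr (.inl e)) :=
      ⟨_, ⟨hu.1.le, hu.2.le⟩, rfl⟩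
    rcases mem_closedCell_edge (h _ (h0 hm') (h1 hm')) with h2 | ⟨w, hw⟩
    · simpa using cell_unique hm h2
    · have := cell_unique (S := S) (c' := .inl w) hm hw
      simp at this
  -- With two faces only, both edges at `y` lie in both faces, and the intersection of the two faces
  -- is contained in a single closed cell.
  have he : e₀ = e₁ := by
    rcases exists_common_cell hP hne (c.mem_range 0) (c.mem_range 1) with ⟨w, hw⟩ | ⟨e, _, _, h⟩
    · exfalso
      have hm : S.edge e₀ (u₀ + τ₀ * c.η) ∈ S.openCell (.inr (.inl e₀)) := ⟨_, hx₀ _ h0η, rfl⟩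
      have hm' : S.edge e₀ (u₀ + τ₀ * c.η) ∈ S.closedCell (.inr (.inl e₀)) :=
        ⟨_, ⟨(hx₀ _ h0η).1.le, (hx₀ _ h0η).2.le⟩, rfl⟩
      have := cell_unique (S := S) (c' := .inl w) hm
        (hw _ ((hi₀ _).2 (.inl rfl) hm') ((hi₀ _).2 (.inr rfl) hm'))
      simp at this
    · rw [key e₀ u₀ τ₀ (hx₀ _ h0η) ((hi₀ _).2 (.inl rfl)) ((hi₀ _).2 (.inr rfl)) e h,
        key e₁ u₁ τ₁ (hx₁ _ h0η) ((hi₁ _).2 (.inr rfl)) ((hi₁ _).2 (.inl rfl)) e h]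
  subst he
  have hy₀ : S.edge e₀ u₀ = y := by
    have := hr₀ 0 le_rfl c.η_pos.le
    rw [← c.base 0]; simpa using this.symm
  have hy₁ : S.edge e₀ u₁ = y := by
    have := hr₁ 0 le_rfl c.η_pos.le
    rw [← c.base 1]; simpa using this.symm
  have hu : u₀ = u₁ := edge_injOn hlen e₀ hu₀ hu₁ (hy₀.trans hy₁.symm)
  have hend : u₀ = 0 ∨ u₀ = S.len e₀ := by
    by_contra! h
    have hm : y ∈ S.openCell (.inr (.inl e₀)) :=
      ⟨u₀, ⟨lt_of_le_of_ne hu₀.1 h.1.symm, lt_of_le_of_ne hu₀.2 h.2⟩, hy₀⟩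
    have := cell_unique (S := S) (c' := .inl v) hm hv
    simp at this
  have hτ : τ₀ = τ₁ := by
    have a0 := hx₀ _ h0η
    have a1 := hx₁ _ h0η
    rw [← hu] at a1
    have := c.η_pos
    rcases hend with h | h <;> rcases hτ₀ with h1 | h1 <;> rcases hτ₁ with h2 | h2 <;>
      rw [h, h1] at a0 <;> rw [h, h2] at a1 <;> first
        | (rw [h1, h2]; done) | (exfalso; linarith [a0.1, a0.2, a1.1, a1.2])
  -- The edge leaves its endpoint `y` in one direction only, so the boundary of the face `c.f 1`
  -- would follow the same points on both sides of `y`.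
  set x := min c.η 1
  have hx0 : 0 < x := lt_min c.η_pos one_pos
  have hxη : x ≤ c.η := min_le_left _ _
  have hx1 : x ≤ 1 := min_le_right _ _
  have b0 := hr₀ x hx0.le hxη
  have b1 := hr₁ x hx0.le hxη
  have b2 := c.glue 0 x ⟨hx0.le, hxη⟩
  rw [← hu, ← hτ] at b1
  rw [b0, ← b1, zero_add] at b2
  have := Real.pi_gt_three
  have b3 := eq_of_rim_eq b2 (by
    rcases c.ε_eq 1 with h | h <;> rw [h, abs_lt] <;> constructor <;> linarith)
  rcases c.ε_eq 1 with h | h <;> rw [h] at b3 <;> linarith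

end LinkCycle

/-! ### Short cycles in the `1`-skeleton -/

/-- The edges of a face cover its boundary. -/
theorem two_pi_le_sum_len (f : S.F) (s : Finset S.E) (hs : ∀ e, S.Incident f e → e ∈ s) :
    2 * Real.pi ≤ ∑ e ∈ s, S.len e := by
  have hpi := Real.pi_pos
  have : Fact (0 < 2 * Real.pi) := ⟨by positivity⟩
  -- The arc of an edge is the closed ball around its midpoint. These arcs cover the circle of
  -- circumference `2π`, and their measures are at most the lengths of the edges.
  let C : S.E → Set (AddCircle (2 * Real.pi)) := fun e => Metric.closedBall
    ((S.start f e + S.dir f e * (S.len e / 2) : ℝ) : AddCircle (2 * Real.pi)) (S.len e / 2)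
  have hcov : (univ : Set (AddCircle (2 * Real.pi))) ⊆ ⋃ e ∈ s, C e := by
    rintro z -
    obtain ⟨φ, rfl⟩ := QuotientAddGroup.mk_surjective z
    obtain ⟨e, he, u, hu, h⟩ := S.boundary f φ
    rw [edge_eq_rim he hu] at h
    obtain ⟨n, hn⟩ := rim_eq_iff.1 h
    refine mem_iUnion₂.2 ⟨e, hs e he, ?_⟩
    have hz : ((φ : ℝ) : AddCircle (2 * Real.pi)) = ((S.start f e + S.dir f e * u : ℝ) :
        AddCircle (2 * Real.pi)) := by
      rw [hn, AddCircle.coe_add, ← zsmul_eq_mul, AddCircle.coe_zsmul, AddCircle.coe_period]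
      simp
    change ((φ : ℝ) : AddCircle (2 * Real.pi)) ∈ _
    rw [hz, Metric.mem_closedBall, dist_eq_norm, ← AddCircle.coe_sub]
    refine (QuotientAddGroup.norm_mk_le_norm).trans ?_
    have : S.start f e + S.dir f e * u - (S.start f e + S.dir f e * (S.len e / 2)) =
        S.dir f e * (u - S.len e / 2) := by ring
    rw [this, Real.norm_eq_abs, abs_mul, abs_dir, one_mul, abs_le]
    constructor <;> linarith [hu.1, hu.2]
  have h1 := (MeasureTheory.measure_mono (μ := MeasureTheory.volume) hcov).trans
    (MeasureTheory.measure_biUnion_finset_le s C)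
  rw [AddCircle.measure_univ] at h1
  have h2 : ∀ e ∈ s, MeasureTheory.volume (C e) ≤ ENNReal.ofReal (S.len e) := fun e _ => by
    rw [AddCircle.volume_closedBall]
    exact ENNReal.ofReal_le_ofReal ((min_le_right _ _).trans (by linarith))
  have h3 := h1.trans (Finset.sum_le_sum h2)
  rw [← ENNReal.ofReal_sum_of_nonneg fun e _ => (S.len_pos e).le] at h3
  exact (ENNReal.ofReal_le_ofReal_iff (Finset.sum_nonneg fun e _ => (S.len_pos e).le)).1 h3

/-- A closed curve in the `1`-skeleton, parametrized by arc length, that does not turn back. -/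
structure EdgeLoop (S : HemisphereComplex Q) (σ : ℝ → Q) (T : ℝ) : Prop where
  pos : 0 < T
  periodic : Function.Periodic σ T
  right : ∀ s, ∃ (e : S.E) (u τ ε : ℝ), 0 < ε ∧ (τ = 1 ∨ τ = -1) ∧
    ∀ x ∈ Icc 0 ε, u + τ * x ∈ Icc 0 (S.len e) ∧ σ (s + x) = S.edge e (u + τ * x)
  left : ∀ s, ∃ (e : S.E) (u τ ε : ℝ), 0 < ε ∧ (τ = 1 ∨ τ = -1) ∧
    ∀ x ∈ Icc 0 ε, u + τ * x ∈ Icc 0 (S.len e) ∧ σ (s - x) = S.edge e (u + τ * x)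
  turn : ∀ s, ∀ ε > 0, ∃ x ∈ Ioo 0 ε, σ (s - x) ≠ σ (s + x)

theorem edge_eq_edge (hlen : ∀ e, S.len e < Real.pi) {e e' : S.E} {u u' : ℝ}
    (hu : u ∈ Ioo 0 (S.len e)) (hu' : u' ∈ Icc 0 (S.len e')) (h : S.edge e u = S.edge e' u') :
    e' = e ∧ u' = u := by
  have hm : S.edge e u ∈ S.openCell (.inr (.inl e)) := ⟨u, hu, rfl⟩
  have hm' : S.edge e u ∈ S.closedCell (.inr (.inl e')) := ⟨u', hu', h.symm⟩
  have he : e' = e := by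
    rcases mem_closedCell_edge hm' with h2 | ⟨w, hw⟩
    · simpa using cell_unique h2 hm
    · have := cell_unique (S := S) (c' := .inl w) hm hw
      simp at this
  subst he
  exact ⟨rfl, (edge_injOn hlen e' ⟨hu.1.le, hu.2.le⟩ hu' h).symm⟩

/-- Let `m` be the supremum of the times up to which the curve follows the edge. The germ on the
left of `m` shares two interior points with the edge and so determines the value at `m`; continuity
of the curve is not needed. Before the end of the edge, the germ on the right must stay on the same
edge, and `turn` rules out the reversed direction. -/
theorem EdgeLoop.continue (hlen : ∀ e, S.len e < Real.pi) {σ : ℝ → Q} {T : ℝ}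
    (h : S.EdgeLoop σ T) {s : ℝ} {e : S.E} {u τ ε : ℝ} (hε : 0 < ε) (hτ : τ = 1 ∨ τ = -1)
    (hg : ∀ x ∈ Icc 0 ε, u + τ * x ∈ Icc 0 (S.len e) ∧ σ (s + x) = S.edge e (u + τ * x))
    {X : ℝ} (hX : 0 ≤ X) (hXe : u + τ * X ∈ Icc 0 (S.len e)) :
    σ (s + X) = S.edge e (u + τ * X) := by
  rcases le_total X ε with h1 | hεX
  · exact (hg X ⟨hX, h1⟩).2
  have hu0 : u ∈ Icc 0 (S.len e) := by simpa using (hg 0 ⟨le_rfl, hε.le⟩).1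
  have hX0 : 0 < X := hε.trans_le hεX
  have hin : ∀ x, 0 < x → x < X → u + τ * x ∈ Ioo 0 (S.len e) := fun x h0 h1 => by
    rcases hτ with rfl | rfl <;> constructor <;> linarith [hu0.1, hu0.2, hXe.1, hXe.2]
  let G : Set ℝ := {x | x ≤ X ∧ ∀ z ∈ Icc 0 x, σ (s + z) = S.edge e (u + τ * z)}
  have hGe : ε ∈ G := ⟨hεX, fun z hz => (hg z hz).2⟩
  have hGb : BddAbove G := ⟨X, fun x hx => hx.1⟩
  set m := sSup G
  have hmε : ε ≤ m := le_csSup hGb hGe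
  have hm0 : 0 < m := hε.trans_le hmε
  have hmX : m ≤ X := csSup_le ⟨_, hGe⟩ fun x hx => hx.1
  have hlt : ∀ z, 0 ≤ z → z < m → σ (s + z) = S.edge e (u + τ * z) := fun z h0 hz => by
    obtain ⟨x, hx, hzx⟩ := exists_lt_of_lt_csSup ⟨_, hGe⟩ hz
    exact hx.2 z ⟨h0, hzx.le⟩
  have hat : σ (s + m) = S.edge e (u + τ * m) := by
    obtain ⟨e', u', τ', ε', hε', hτ', hl⟩ := h.left (s + m)
    have key : ∀ x, 0 < x → x ≤ ε' → x < m → e' = e ∧ u' + τ' * x = u + τ * (m - x) :=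
      fun x h0 h1 h2 => by
        obtain ⟨a1, a2⟩ := hl x ⟨h0.le, h1⟩
        rw [show s + m - x = s + (m - x) by ring, hlt (m - x) (by linarith) (by linarith)] at a2
        exact edge_eq_edge hlen (hin (m - x) (by linarith) (by linarith)) a1 a2
    set x := min ε' (m / 2)
    have hx0 : 0 < x := by positivity
    have hx1 : x ≤ ε' := min_le_left _ _
    have hx2 : x < m := (min_le_right _ _).trans_lt (by linarith)
    obtain ⟨he, k1⟩ := key x hx0 hx1 hx2
    obtain ⟨_, k2⟩ := key (x / 2) (by positivity) (by linarith) (by linarith)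
    have := (hl 0 ⟨le_rfl, hε'.le⟩).2
    rw [sub_zero, mul_zero, add_zero] at this
    rw [this, he]
    congr 1
    linarith
  rcases hmX.eq_or_lt with h1 | h1
  · rw [← h1]; exact hat
  exfalso
  obtain ⟨e', u', τ', ε', hε', hτ', hr⟩ := h.right (s + m)
  have k0 := hr 0 ⟨le_rfl, hε'.le⟩
  simp only [mul_zero, add_zero] at k0
  obtain ⟨rfl, rfl⟩ := edge_eq_edge hlen (hin m hm0 h1) k0.1 (hat.symm.trans k0.2)
  have hττ : τ' = τ := by
    by_contra hne
    have hneg : τ' = -τ := by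
      rcases hτ with a | a <;> rcases hτ' with b | b <;>
        first | exact absurd (b.trans a.symm) hne | (rw [a, b]; done) | (rw [a, b]; norm_num)
    obtain ⟨x, hx, hxne⟩ := h.turn (s + m) (min ε' m) (by positivity)
    have hx1 : x < ε' := hx.2.trans_le (min_le_left _ _)
    have hx2 : x < m := hx.2.trans_le (min_le_right _ _)
    apply hxne
    rw [(hr x ⟨hx.1.le, hx1.le⟩).2, show s + m - x = s + (m - x) by ring,
      hlt (m - x) (by linarith) (by linarith [hx.1]), hneg]
    congr 1; ring
  subst hττ
  set δ := min ε' (X - m)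
  have hδ : 0 < δ := lt_min hε' (by linarith)
  have hδ1 : δ ≤ ε' := min_le_left _ _
  have hδ2 : δ ≤ X - m := min_le_right _ _
  have : m + δ ∈ G := by
    refine ⟨by linarith, fun z hz => ?_⟩
    rcases lt_or_ge z m with h2 | h2
    · exact hlt z hz.1 h2
    · have := (hr (z - m) ⟨by linarith, by linarith [hz.2]⟩).2
      rw [show s + m + (z - m) = s + z by ring] at this
      rw [this]
      congr 1; ring
  linarith [le_csSup hGb this]

/-- From a vertex, the curve runs through a whole edge. -/
theorem EdgeLoop.exists_edge (hlen : ∀ e, S.len e < Real.pi) {σ : ℝ → Q} {T : ℝ}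
    (h : S.EdgeLoop σ T) {s : ℝ} {v : S.V} (hv : σ s = S.vert v) :
    ∃ e, (∀ x ∈ Icc 0 (S.len e), σ (s + x) = S.edge e x) ∨
      ∀ x ∈ Icc 0 (S.len e), σ (s + x) = S.edge e (S.len e - x) := by
  obtain ⟨e, u, τ, ε, hε, hτ, hr⟩ := h.right s
  refine ⟨e, ?_⟩
  have h0 := hr 0 ⟨le_rfl, hε.le⟩
  simp only [mul_zero, add_zero] at h0
  have hend : u = 0 ∨ u = S.len e := by
    by_contra! hne
    have hm : σ s ∈ S.openCell (.inr (.inl e)) := by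
      rw [h0.2]
      exact ⟨u, ⟨lt_of_le_of_ne h0.1.1 hne.1.symm, lt_of_le_of_ne h0.1.2 hne.2⟩, rfl⟩
    have := cell_unique (S := S) (c' := .inl v) hm hv
    simp at this
  have hε1 := (hr ε ⟨hε.le, le_rfl⟩).1
  rcases hend with hu | hu <;> rcases hτ with h1 | h1
  · left
    intro x hx
    have := h.continue hlen hε (.inl h1) hr hx.1 (by simpa [hu, h1] using hx)
    simpa [hu, h1] using this
  · rw [hu, h1] at hε1; linarith [hε1.1]
  · rw [hu, h1] at hε1; linarith [hε1.2]
  · right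
    intro x hx
    have e1 : u + τ * x = S.len e - x := by rw [hu, h1]; ring
    have := h.continue hlen hε (.inr h1) hr hx.1 (by
      rw [e1]; constructor <;> linarith [hx.1, hx.2])
    rwa [e1] at this

theorem EdgeLoop.exists_vertex (hlen : ∀ e, S.len e < Real.pi) {σ : ℝ → Q} {T : ℝ}
    (h : S.EdgeLoop σ T) : ∃ s v, σ s = S.vert v := by
  obtain ⟨e, u, τ, ε, hε, hτ, hr⟩ := h.right 0
  have h0 := (hr 0 ⟨le_rfl, hε.le⟩).1
  simp only [mul_zero, add_zero] at h0
  rcases hτ with h1 | h1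
  · obtain ⟨v, hv⟩ := (S.edge_ends e).2
    have e1 : u + τ * (S.len e - u) = S.len e := by rw [h1]; ring
    have := h.continue hlen hε (.inl h1) hr (X := S.len e - u) (by linarith [h0.2]) (by
      rw [e1]; exact ⟨(S.len_pos e).le, le_rfl⟩)
    exact ⟨_, v, by rw [this, e1, hv]⟩
  · obtain ⟨v, hv⟩ := (S.edge_ends e).1
    have e1 : u + τ * u = 0 := by rw [h1]; ring
    have := h.continue hlen hε (.inr h1) hr (X := u) h0.1 (by
      rw [e1]; exact ⟨le_rfl, (S.len_pos e).le⟩)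
    exact ⟨_, v, by rw [this, e1, hv]⟩

/-- Closed curves in the `1`-skeleton of an ideally admissible space that do not turn back have
length at least `2π`. -/
theorem EdgeLoop.two_pi_le (hS : S.IsIdeallyAdmissible) {σ : ℝ → Q} {T : ℝ}
    (h : S.EdgeLoop σ T) : 2 * Real.pi ≤ T := by
  have hlen := hS.len_lt_pi
  have := S.finite_E
  obtain ⟨δ, hδ, hδlen⟩ := exists_pos_le_of_finite S.len S.len_pos
  obtain ⟨s₀, v₀, hv₀⟩ := h.exists_vertex hlen
  let W : Type := {p : ℝ × S.V // σ p.1 = S.vert p.2}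
  choose E hE using fun w : W => h.exists_edge hlen w.2
  have hnext : ∀ w : W, ∃ v, σ (w.1.1 + S.len (E w)) = S.vert v := fun w => by
    have h0 : S.len (E w) ∈ Icc 0 (S.len (E w)) := ⟨(S.len_pos _).le, le_rfl⟩
    rcases hE w with h1 | h1
    · obtain ⟨v, hv⟩ := (S.edge_ends (E w)).2
      exact ⟨v, by rw [h1 _ h0, hv]⟩
    · obtain ⟨v, hv⟩ := (S.edge_ends (E w)).1
      exact ⟨v, by rw [h1 _ h0, sub_self, hv]⟩
  choose N hN using hnext
  let next : W → W := fun w => ⟨(w.1.1 + S.len (E w), N w), hN w⟩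
  let w : ℕ → W := fun n => next^[n] ⟨(s₀, v₀), hv₀⟩
  have hw : ∀ n, w (n + 1) = next (w n) := fun n => Function.iterate_succ_apply' _ _ _
  let t : ℕ → ℝ := fun n => (w n).1.1
  let v : ℕ → S.V := fun n => (w n).1.2
  let e : ℕ → S.E := fun n => E (w n)
  have ht : ∀ n, t (n + 1) = t n + S.len (e n) := fun n => by simp only [t, hw]; rfl
  have hσv : ∀ n, σ (t n) = S.vert (v n) := fun n => (w n).2
  have hσe : ∀ n, (∀ x ∈ Icc 0 (S.len (e n)), σ (t n + x) = S.edge (e n) x) ∨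
      ∀ x ∈ Icc 0 (S.len (e n)), σ (t n + x) = S.edge (e n) (S.len (e n) - x) := fun n => hE (w n)
  have hsum : ∀ n i, t (i + n) = t i + ∑ k ∈ Finset.range n, S.len (e (i + k)) := fun n i => by
    induction n with
    | zero => simp
    | succ n ih => rw [← add_assoc, ht, ih, Finset.sum_range_succ, add_assoc]
  have hgrow : ∀ n : ℕ, s₀ + n * δ ≤ t n := fun n => by
    induction n with
    | zero => simp [t, w]
    | succ n ih => rw [ht]; push_cast; linarith [hδlen (e n)]
  have hvinj : ∀ a b, S.vert a = S.vert b → a = b := fun a b hab => by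
    simpa using cell_unique (S := S) (c := .inl a) (c' := .inl b) (x := S.vert a) rfl hab
  -- the return to the first vertex after one period
  obtain ⟨n, hn⟩ : ∃ n, t n = s₀ + T := by
    obtain ⟨M, hM⟩ := exists_nat_gt (T / δ)
    rw [div_lt_iff₀ hδ] at hM
    have hex : ∃ n, s₀ + T < t (n + 1) := ⟨M, by
      have := hgrow (M + 1)
      push_cast at this
      linarith⟩
    classical
    refine ⟨Nat.find hex, ?_⟩
    have h1 := Nat.find_spec hex
    have h2 : t (Nat.find hex) ≤ s₀ + T := by
      rcases Nat.eq_zero_or_pos (Nat.find hex) with h0 | h0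
      · rw [h0]; simp only [t, w, Function.iterate_zero, id]; linarith [h.pos]
      · have := Nat.find_min hex (m := Nat.find hex - 1) (by omega)
        rw [Nat.sub_add_cancel h0] at this
        exact not_lt.1 this
    set m := Nat.find hex
    rcases h2.eq_or_lt with h3 | h3
    · exact h3
    exfalso
    rw [ht] at h1
    have h4 : σ (s₀ + T) = S.vert v₀ := by rw [h.periodic]; exact hv₀
    have h5 : σ (s₀ + T) ∈ S.openCell (.inr (.inl (e m))) := by
      have hx : s₀ + T = t m + (s₀ + T - t m) := by ring
      have hx' : s₀ + T - t m ∈ Icc 0 (S.len (e m)) := ⟨by linarith, by linarith⟩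
      rw [hx]
      rcases hσe m with h6 | h6
      · rw [h6 _ hx']; exact ⟨_, ⟨by linarith, by linarith⟩, rfl⟩
      · rw [h6 _ hx']; exact ⟨_, ⟨by linarith, by linarith⟩, rfl⟩
    have := cell_unique (S := S) (c' := .inl v₀) h5 h4
    simp at this
  have hn0 : 0 < n := by
    rcases Nat.eq_zero_or_pos n with h0 | h0
    · rw [h0] at hn
      simp only [t, w, Function.iterate_zero, id] at hn
      linarith [h.pos]
    · exact h0
  have hret : v 0 = v (0 + n) := by
    apply hvinj
    rw [← hσv, ← hσv, zero_add, hn, h.periodic]; rfl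
  -- a shortest closed segment of the sequence of vertices
  have hex : ∃ d, 0 < d ∧ ∃ i, i + d ≤ n ∧ v i = v (i + d) := ⟨n, hn0, 0, by omega, hret⟩
  classical
  obtain ⟨hm0, i, him, hvi⟩ := Nat.find_spec hex
  set m := Nat.find hex
  have hmin : ∀ a b, a < b → b - a < m → b ≤ n → v a ≠ v b := fun a b hab hlt hbn hv => by
    refine Nat.find_min hex hlt ⟨by omega, a, by omega, ?_⟩
    rw [hv]; congr 1; omega
  have : NeZero m := ⟨hm0.ne'⟩
  let v' : ZMod m → S.V := fun z => v (i + z.val)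
  let e' : ZMod m → S.E := fun z => e (i + z.val)
  have hends : ∀ k, (S.edge (e k) 0 = S.vert (v k) ∧
      S.edge (e k) (S.len (e k)) = S.vert (v (k + 1)) ∧
      ∀ x ∈ Icc 0 (S.len (e k)), σ (t k + x) = S.edge (e k) x) ∨
      (S.edge (e k) 0 = S.vert (v (k + 1)) ∧ S.edge (e k) (S.len (e k)) = S.vert (v k) ∧
      ∀ x ∈ Icc 0 (S.len (e k)), σ (t k + x) = S.edge (e k) (S.len (e k) - x)) := fun k => by
    have hl := (S.len_pos (e k)).le
    rcases hσe k with h1 | h1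
    · refine .inl ⟨?_, ?_, h1⟩
      · rw [← h1 0 ⟨le_rfl, hl⟩, add_zero, hσv]
      · rw [← h1 _ ⟨hl, le_rfl⟩, ← ht, hσv]
    · refine .inr ⟨?_, ?_, h1⟩
      · rw [← hσv, ht, h1 _ ⟨hl, le_rfl⟩, sub_self]
      · rw [← hσv, ← add_zero (t k), h1 0 ⟨le_rfl, hl⟩, sub_zero]
  have hval : ∀ z : ZMod m, z.val < m := fun z => ZMod.val_lt z
  have hv' : Function.Injective v' := by
    intro a b hab
    have ha := hval a
    have hb := hval b
    apply ZMod.val_injective m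
    rcases lt_trichotomy a.val b.val with h1 | h1 | h1
    · exact absurd hab (hmin _ _ (by omega) (by omega) (by omega))
    · exact h1
    · exact absurd hab.symm (hmin _ _ (by omega) (by omega) (by omega))
  -- Running twice through an edge in the same direction would repeat a vertex. In opposite
  -- directions, minimality forces the two passages to be consecutive, and the curve would turn
  -- back. This also covers cycles of two edges.
  have hne : ∀ a b, a < b → b < i + m → i ≤ a → e a ≠ e b := by
    intro a b hab hb ha hee
    have hvab : v a ≠ v b := hmin a b hab (by omega) (by omega)
    have ea := hends a
    have eb := hends b
    have hopp : ∀ p q : ℝ, σ (t (a + 1)) = S.vert (v b) → b = a + 1 →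
        (∀ x ∈ Icc 0 (S.len (e b)), σ (t (a + 1) - x) = σ (t (a + 1) + x)) → False := by
      intro _ _ _ _ h3
      obtain ⟨x, hx, hxne⟩ := h.turn (t (a + 1)) (S.len (e b)) (S.len_pos _)
      exact hxne (h3 x ⟨hx.1.le, hx.2.le⟩)
    have hadj : v (a + 1) = v b → b = a + 1 := fun h1 => by
      by_contra h2
      exact hmin (a + 1) b (by omega) (by omega) (by omega) h1
    rw [hee] at ea
    rcases ea with ⟨a0, a1, a2⟩ | ⟨a0, a1, a2⟩ <;> rcases eb with ⟨b0, b1, b2⟩ | ⟨b0, b1, b2⟩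
    · exact hvab (hvinj _ _ (a0.symm.trans b0))
    · have h1 := hvinj _ _ (a1.symm.trans b1)
      have h2 := hadj h1
      refine hopp 0 0 (by rw [hσv, h1]) h2 fun x hx => ?_
      have h3 := a2 (S.len (e b) - x) ⟨by linarith [hx.2], by linarith [hx.1]⟩
      have h4 := b2 x hx
      rw [h2] at h4
      rw [← h2] at h4
      rw [ht, hee, show t a + S.len (e b) - x = t a + (S.len (e b) - x) by ring, h3, ← h4, ← hee,
        ← ht, ← h2]
    · have h1 := hvinj _ _ (a0.symm.trans b0)
      have h2 := hadj h1
      refine hopp 0 0 (by rw [hσv, h1]) h2 fun x hx => ?_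
      have h3 := a2 (S.len (e b) - x) ⟨by linarith [hx.2], by linarith [hx.1]⟩
      have h4 := b2 x hx
      rw [sub_sub_cancel] at h3
      rw [ht, hee, show t a + S.len (e b) - x = t a + (S.len (e b) - x) by ring, h3, ← h4, ← hee,
        ← ht, ← h2]
    · exact hvab (hvinj _ _ (a1.symm.trans b1))
  have he' : Function.Injective e' := by
    intro a b hab
    have ha := hval a
    have hb := hval b
    apply ZMod.val_injective m
    rcases lt_trichotomy a.val b.val with h1 | h1 | h1
    · exact absurd hab (hne _ _ (by omega) (by omega) (by omega))
    · exact h1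
    · exact absurd hab.symm (hne _ _ (by omega) (by omega) (by omega))
  have hv1 : ∀ z : ZMod m, v' (z + 1) = v (i + z.val + 1) := fun z => by
    have h1 : (z + 1).val = (z.val + 1) % m := by
      rw [ZMod.val_add, ZMod.val_one_eq_one_mod, Nat.add_mod_mod]
    simp only [v', h1]
    have := hval z
    rcases eq_or_ne (z.val + 1) m with h2 | h2
    · rw [h2, Nat.mod_self, add_zero, add_assoc, h2, hvi]
    · rw [Nat.mod_eq_of_lt (by omega), add_assoc]
  have hcyc : S.IsSimpleCycle v' e' := by
    refine ⟨hv', he', fun z => ?_⟩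
    rw [hv1]
    rcases hends (i + z.val) with ⟨a0, a1, _⟩ | ⟨a0, a1, _⟩
    · exact .inl ⟨a0, a1⟩
    · exact .inr ⟨a0, a1⟩
  have hsum' : ∑ z, S.len (e' z) = ∑ k ∈ Finset.range m, S.len (e (i + k)) := by
    refine Finset.sum_bij (fun z _ => z.val) (fun z _ => Finset.mem_range.2 (hval z))
      (fun a _ b _ hab => ZMod.val_injective m hab) (fun k hk => ?_) (fun z _ => rfl)
    exact ⟨(k : ZMod m), Finset.mem_univ _, ZMod.val_cast_of_lt (Finset.mem_range.1 hk)⟩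
  have hmono : Monotone t := monotone_nat_of_le_succ fun n => by
    rw [ht]; linarith [S.len_pos (e n)]
  have hle : ∑ z, S.len (e' z) ≤ T := by
    rw [hsum']
    have h1 := hsum m i
    have h2 := hmono him
    have h3 := hmono (Nat.zero_le i)
    have h4 : t 0 = s₀ := rfl
    linarith
  -- A cycle that bounds a face contains all its edges, which together cover a full equator; any
  -- other cycle is long by hypothesis.
  rcases hS.cycle m v' e' hcyc with ⟨f, hf⟩ | h1
  · have := two_pi_le_sum_len f (Finset.univ.image e') fun k hk => by
      obtain ⟨z, hz⟩ := (hf k).1 hk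
      exact Finset.mem_image.2 ⟨z, Finset.mem_univ _, hz⟩
    rw [Finset.sum_image fun a _ b _ hab => he' hab] at this
    linarith
  · linarith

end HemisphereComplex

end Spherical

namespace Spherical

/-! ### Comparison of gluing distances -/

section Gluing

variable {ι ι' : Type*} {T : ι → Type*} {T' : ι' → Type*} {d : ∀ i, T i → T i → ℝ}
  {d' : ∀ i, T' i → T' i → ℝ} {s : Setoid (Σ i, T i)} {s' : Setoid (Σ i, T' i)}

theorem GlueChain.nonneg (hd : ∀ i p q, 0 ≤ d i p q) {a b : Σ i, T i} {L : ℝ}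
    (h : GlueChain d s a b L) : 0 ≤ L := by
  induction h with
  | glue => exact le_rfl
  | step i p q _ _ ih => exact add_nonneg (hd i p q) ih

/-- Isometric descriptions of the pieces give the same gluing distance. -/
theorem glueEDist_comap (G : (Σ i, T' i) → Σ i, T i)
    (h1 : ∀ i' (p' q' : T' i'), ∃ i p q, G ⟨i', p'⟩ = ⟨i, p⟩ ∧ G ⟨i', q'⟩ = ⟨i, q⟩ ∧
      d i p q = d' i' p' q')
    (h2 : ∀ i (p q : T i), ∃ i' p' q', s (G ⟨i', p'⟩) ⟨i, p⟩ ∧ s (G ⟨i', q'⟩) ⟨i, q⟩ ∧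
      d i p q = d' i' p' q')
    (hs : ∀ a b, s' a b ↔ s (G a) (G b)) (a b : Σ i, T' i) :
    glueEDist d' s' a b = glueEDist d s (G a) (G b) := by
  have hf : ∀ {a b L}, GlueChain d' s' a b L → GlueChain d s (G a) (G b) L := by
    intro a b L h
    induction h with
    | glue h => exact .glue ((hs _ _).1 h)
    | step i p q h _ ih =>
      obtain ⟨j, p', q', hp, hq, hd⟩ := h1 i p q
      rw [← hd]
      refine .step j p' q' ?_ ?_
      · rw [← hp]; exact (hs _ _).1 h
      · rw [← hq]; exact ih
  -- Lifting only works up to the identification `s`, so the induction carries arbitrary endpoints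
  -- `a`, `b` over `x`, `y`.
  have hb : ∀ {x y L}, GlueChain d s x y L → ∀ a b, s (G a) x → s (G b) y →
      GlueChain d' s' a b L := by
    intro x y L h
    induction h with
    | glue h => exact fun a b ha hb => .glue ((hs _ _).2 (s.trans (s.trans ha h) (s.symm hb)))
    | step i p q h _ ih =>
      intro a b ha hb
      obtain ⟨j, p', q', hp, hq, hd⟩ := h2 i p q
      rw [hd]
      exact .step j p' q' ((hs _ _).2 (s.trans (s.trans ha h) (s.symm hp))) (ih _ b hq hb)
  exact le_antisymm (le_iInf₂ fun L h => iInf₂_le L (hb h a b (s.refl _) (s.refl _)))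
    (le_iInf₂ fun L h => iInf₂_le L (hf h))

end Gluing

namespace HemisphereComplex

variable {Q : Type*} [MetricSpace Q] (S : HemisphereComplex Q) (t : ℝ)

/-! ### The expansion as a metric on the same set -/

/-- The point of the expansion given by a point of a triangle. -/
noncomputable def toExp (a : Σ k, S.Tri k) : S.Expansion t :=
  @SeparationQuotient.mk _ (S.expansionPseudoMetric t).toUniformSpace.toTopologicalSpace a

theorem edist_toExp (a b : Σ k, S.Tri k) :
    edist (S.toExp t a) (S.toExp t b) = glueEDist (S.triDist t) S.pattern a b := rfl

theorem toExp_surjective : Function.Surjective (S.toExp t) :=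
  @SeparationQuotient.surjective_mk _ (S.expansionPseudoMetric t).toUniformSpace.toTopologicalSpace

theorem exists_pos_eq' (q : Q) : ∃ a, S.pos a = q := by
  obtain ⟨f, p, rfl⟩ := S.cover q
  obtain ⟨a, _, h⟩ := S.exists_pos_eq f p
  exact ⟨a, h⟩

/-- The point of the expansion that corresponds to a point of `Q`. -/
noncomputable def toX (q : Q) : S.Expansion t := S.toExp t (S.exists_pos_eq' q).choose

variable {S t}

theorem edist_toExp_le {a b : Σ k, S.Tri k} {L : ℝ}
    (h : GlueChain (S.triDist t) S.pattern a b L) :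
    edist (S.toExp t a) (S.toExp t b) ≤ ENNReal.ofReal L := by
  rw [edist_toExp]; exact iInf₂_le L h

theorem triDist_nonneg (k : S.Flag) (p q : S.Tri k) : 0 ≤ S.triDist t k p q := sphDist_nonneg _ _

/-- Points of triangles with the same position in `Q` are at gluing distance `0`, so the choice made
in `toX` is immaterial. -/
theorem toX_pos (a : Σ k, S.Tri k) : S.toX t (S.pos a) = S.toExp t a := by
  have h : S.pattern (S.exists_pos_eq' (S.pos a)).choose a := (S.exists_pos_eq' (S.pos a)).choose_spec
  have := edist_toExp_le (t := t) (.glue h)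
  rw [ENNReal.ofReal_zero] at this
  exact edist_le_zero.1 this

theorem dist_toX_le (k : S.Flag) (p q : S.Tri k) :
    dist (S.toX t (S.pos ⟨k, p⟩)) (S.toX t (S.pos ⟨k, q⟩)) ≤ S.triDist t k p q := by
  have := edist_toExp_le (GlueChain.single (S.triDist t) S.pattern k p q)
  rw [add_zero, ← toX_pos, ← toX_pos, edist_dist] at this
  exact (ENNReal.ofReal_le_ofReal_iff (triDist_nonneg k p q)).1 this

theorem exists_chain_lt {a b : Σ k, S.Tri k} {L : ℝ}
    (h : dist (S.toX t (S.pos a)) (S.toX t (S.pos b)) < L) :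
    ∃ M < L, GlueChain (S.triDist t) S.pattern a b M := by
  have h1 : edist (S.toExp t a) (S.toExp t b) < ENNReal.ofReal L := by
    rw [toX_pos, toX_pos] at h
    rw [edist_dist]
    exact (ENNReal.ofReal_lt_ofReal_iff (dist_nonneg.trans_lt h)).2 h
  rw [edist_toExp] at h1
  obtain ⟨M, hM⟩ := iInf_lt_iff.1 h1
  obtain ⟨hc, hM⟩ := iInf_lt_iff.1 hM
  exact ⟨M, ((ENNReal.ofReal_lt_ofReal_iff (dist_nonneg.trans_lt h)).1 hM), hc⟩

theorem pos_eq_pt (a : Σ k, S.Tri k) : S.pos a = S.pt a.1.1.1 a.2.1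
    (S.start a.1.1.1 a.1.1.2 + S.dir a.1.1.1 a.1.1.2 * a.2.2) := by
  rw [pos, pt, projIcc_val]

theorem pos_mem_range (a : Σ k, S.Tri k) : S.pos a ∈ range (S.face a.1.1.1) := by
  rw [pos_eq_pt]; exact pt_mem_range _ _ _

theorem abs_sub_le_len {k : S.Flag} (p q : S.Tri k) : |(p.2 : ℝ) - q.2| ≤ S.len k.1.2 := by
  rw [abs_le]; constructor <;> linarith [p.2.2.1, p.2.2.2, q.2.2.1, q.2.2.2]

theorem triDist_eq (ht0 : 0 < t) (hlen : ∀ e, (1 + t) * S.len e < Real.pi) (k : S.Flag)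
    (p q : S.Tri k) :
    S.triDist t k p q = coneDist p.1 q.1 ((1 + t) * |(p.2 : ℝ) - q.2|) := by
  have h : |(1 + t) * (p.2 : ℝ) - (1 + t) * q.2| = (1 + t) * |(p.2 : ℝ) - q.2| := by
    rw [← mul_sub, abs_mul, abs_of_pos (by linarith : 0 < 1 + t)]
  rw [triDist, sphDist_polar_eq_coneDist, h]
  rw [h]
  exact (mul_le_mul_of_nonneg_left (abs_sub_le_len p q) (by linarith)).trans (hlen _).le

theorem len_lt_pi_of_expansion (ht0 : 0 < t) (hlen : ∀ e, (1 + t) * S.len e < Real.pi) (e : S.E) :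
    S.len e < Real.pi := by
  nlinarith [hlen e, S.len_pos e]

theorem dist_pos_le_triDist (ht0 : 0 < t) (hlen : ∀ e, (1 + t) * S.len e < Real.pi) (k : S.Flag)
    (p q : S.Tri k) : dist (S.pos ⟨k, p⟩) (S.pos ⟨k, q⟩) ≤ S.triDist t k p q := by
  have hpi := Real.pi_pos
  refine (dist_face_le _ _ _).trans ?_
  have h : |S.start k.1.1 k.1.2 + S.dir k.1.1 k.1.2 * p.2 -
      (S.start k.1.1 k.1.2 + S.dir k.1.1 k.1.2 * q.2)| = |(p.2 : ℝ) - q.2| := by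
    rw [add_sub_add_left_eq_sub, ← mul_sub, abs_mul, abs_dir, one_mul]
  rw [triDist_eq ht0 hlen]
  change sphDist (polar p.1 _) (polar q.1 _) ≤ _
  rw [sphDist_polar_eq_coneDist, h]
  · refine coneDist_mono p.1.2.1 (by linarith [p.1.2.2]) q.1.2.1 (by linarith [q.1.2.2])
      (abs_nonneg _) ?_
    nlinarith [abs_nonneg ((p.2 : ℝ) - q.2)]
  · rw [h]
    exact (abs_sub_le_len p q).trans (len_lt_pi_of_expansion ht0 hlen _).le

/-- Each move in an expanded triangle is at least as long as the same move in `Q`, by monotonicity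
of `coneDist` in the angle; this passes to chains. In particular the gluing pseudo-distance of the
expansion identifies no further points. -/
theorem dist_le_dist_toX (ht0 : 0 < t) (hlen : ∀ e, (1 + t) * S.len e < Real.pi) (q q' : Q) :
    dist q q' ≤ dist (S.toX t q) (S.toX t q') := by
  obtain ⟨a, rfl⟩ := S.exists_pos_eq' q
  obtain ⟨b, rfl⟩ := S.exists_pos_eq' q'
  refine le_of_forall_gt fun L hL => ?_
  obtain ⟨M, hM, hc⟩ := exists_chain_lt hL
  refine lt_of_le_of_lt ?_ hM
  clear hL hM
  induction hc with
  | glue h => rw [show S.pos _ = S.pos _ from h, dist_self]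
  | step k p q h _ ih =>
    rw [show S.pos _ = S.pos _ from h]
    exact (dist_triangle _ _ _).trans (add_le_add (dist_pos_le_triDist ht0 hlen k p q) ih)

theorem toX_injective (ht0 : 0 < t) (hlen : ∀ e, (1 + t) * S.len e < Real.pi) :
    Function.Injective (S.toX t) := fun q q' h => by
  have := dist_le_dist_toX ht0 hlen q q'
  rw [h, dist_self] at this
  exact dist_le_zero.1 this

theorem toX_surjective : Function.Surjective (S.toX t) := fun x => by
  obtain ⟨a, rfl⟩ := S.toExp_surjective t x
  exact ⟨S.pos a, toX_pos a⟩

theorem finite_flag : Finite S.Flag := by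
  have := S.finite_F
  have := S.finite_E
  exact inferInstanceAs (Finite {fe : S.F × S.E // S.Incident fe.1 fe.2})

theorem continuous_triDist (k : S.Flag) (p : S.Tri k) : Continuous fun q => S.triDist t k q p := by
  refine continuous_comp_sphDist (continuous_comp_polar ?_ ?_) continuous_const <;> fun_prop

theorem compactSpace_expansion : CompactSpace (S.Expansion t) := by
  have := S.finite_flag
  have hc : ∀ k, Continuous fun p : S.Tri k => S.toExp t ⟨k, p⟩ := fun k => by
    rw [continuous_iff_continuousAt]
    intro p
    rw [ContinuousAt, tendsto_iff_dist_tendsto_zero]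
    have h1 : S.triDist t k p p = 0 := sphDist_self _
    have h2 := (continuous_triDist (t := t) k p).tendsto p
    rw [h1] at h2
    refine squeeze_zero (fun _ => dist_nonneg) (fun q => ?_) h2
    rw [← toX_pos, ← toX_pos]
    exact dist_toX_le k q p
  have hu : (univ : Set (S.Expansion t)) = ⋃ k, range fun p : S.Tri k => S.toExp t ⟨k, p⟩ := by
    refine (eq_univ_of_forall fun x => ?_).symm
    obtain ⟨⟨k, p⟩, rfl⟩ := S.toExp_surjective t x
    exact mem_iUnion.2 ⟨k, p, rfl⟩
  refine ⟨?_⟩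
  rw [hu]
  exact isCompact_iUnion fun k => isCompact_range (hc k)

/-- The inverse of `toX` is a 1-Lipschitz bijection from a compact space to a Hausdorff space. -/
theorem nonempty_homeomorph (ht0 : 0 < t) (hlen : ∀ e, (1 + t) * S.len e < Real.pi) :
    Nonempty (S.Expansion t ≃ₜ Q) := by
  have := compactSpace_expansion (S := S) (t := t)
  let e := (Equiv.ofBijective _ ⟨toX_injective ht0 hlen, toX_surjective (S := S) (t := t)⟩).symm
  have hc : Continuous e := by
    refine LipschitzWith.continuous (K := 1) (LipschitzWith.of_dist_le_mul fun x y => ?_)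
    obtain ⟨q, rfl⟩ := toX_surjective x
    obtain ⟨q', rfl⟩ := toX_surjective y
    have h : ∀ q, e (S.toX t q) = q := fun q => Equiv.ofBijective_symm_apply_apply _ _ q
    rw [h, h, NNReal.coe_one, one_mul]
    exact dist_le_dist_toX ht0 hlen q q'
  exact ⟨hc.homeoOfEquivCompactToT2⟩

/-! ### The expansion is piecewise spherical -/

/-- The vertices of the triangle with two sides `π / 2` that enclose the angle `α`. -/
noncomputable def triVertex (α : ℝ) : Fin 3 → S2 :=
  ![polar 0 0, polar (Real.pi / 2) 0, polar (Real.pi / 2) α]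

theorem linearIndependent_triVertex {α : ℝ} (h0 : 0 < α) (h1 : α < Real.pi) :
    LinearIndependent ℝ fun k => (triVertex α k : E3) := by
  have hs : Real.sin α ≠ 0 := (Real.sin_pos_of_pos_of_lt_pi h0 h1).ne'
  rw [Fintype.linearIndependent_iff]
  intro g hg
  have a0 := congrArg (fun x : E3 => x 0) hg
  have a1 := congrArg (fun x : E3 => x 1) hg
  have a2 := congrArg (fun x : E3 => x 2) hg
  simp [Fin.sum_univ_three, triVertex, hs] at a0 a1 a2
  rw [a1] at a0
  simp at a0
  intro i
  fin_cases i
  exacts [a2, a0, a1]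

theorem sum_triVertex (α : ℝ) (w : Fin 3 → ℝ) (x : E3) :
    x = ∑ k, w k • (triVertex α k : E3) ↔ x 0 = w 1 + w 2 * Real.cos α ∧
      x 1 = w 2 * Real.sin α ∧ x 2 = w 0 := by
  constructor
  · rintro rfl
    simp [Fin.sum_univ_three, triVertex]
  · rintro ⟨h0, h1, h2⟩
    ext i
    fin_cases i
    · simp [Fin.sum_univ_three, triVertex, h0]
    · simp [Fin.sum_univ_three, triVertex, h1]
    · simp [Fin.sum_univ_three, triVertex, h2]

theorem polar_mem_sphTriangle {α r φ : ℝ} (h0 : 0 < α) (h1 : α < Real.pi)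
    (hr : r ∈ Icc 0 (Real.pi / 2)) (hφ : φ ∈ Icc 0 α) : polar r φ ∈ sphTriangle (triVertex α) := by
  have hs : 0 < Real.sin α := Real.sin_pos_of_pos_of_lt_pi h0 h1
  have hsr : 0 ≤ Real.sin r := Real.sin_nonneg_of_nonneg_of_le_pi hr.1 (by linarith [hr.2])
  -- By the sine rule, the equatorial point of longitude `φ` is the combination of those of
  -- longitude `0` and `α` with weights `sin (α - φ) / sin α` and `sin φ / sin α`.
  refine ⟨![Real.cos r, Real.sin r * Real.sin (α - φ) / Real.sin α,
    Real.sin r * Real.sin φ / Real.sin α], ?_, ?_⟩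
  · intro k
    have c0 := Real.cos_nonneg_of_mem_Icc (x := r) ⟨by linarith [hr.1], hr.2⟩
    have c1 : 0 ≤ Real.sin (α - φ) :=
      Real.sin_nonneg_of_nonneg_of_le_pi (by linarith [hφ.2]) (by linarith [hφ.1])
    have c2 : 0 ≤ Real.sin φ :=
      Real.sin_nonneg_of_nonneg_of_le_pi hφ.1 (by linarith [hφ.2])
    fin_cases k
    · exact c0
    · change 0 ≤ Real.sin r * Real.sin (α - φ) / Real.sin α
      positivity
    · change 0 ≤ Real.sin r * Real.sin φ / Real.sin α
      positivity
  · rw [sum_triVertex]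
    simp
    constructor
    · rw [Real.sin_sub]; field_simp; ring
    · field_simp

theorem exists_polar_of_sum {α : ℝ} (h0 : 0 < α) (h1 : α < Real.pi) {x : S2} {w : Fin 3 → ℝ}
    (hw : ∀ k, 0 ≤ w k) (hx : (x : E3) = ∑ k, w k • (triVertex α k : E3)) :
    ∃ r ∈ Icc 0 (Real.pi / 2), ∃ φ ∈ Icc 0 α, polar r φ = x := by
  have hs : 0 < Real.sin α := Real.sin_pos_of_pos_of_lt_pi h0 h1
  obtain ⟨a0, a1, a2⟩ := (sum_triVertex α w x).1 hx
  refine ⟨Real.arccos ((x : E3) 2), ⟨Real.arccos_nonneg _, ?_⟩,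
    Complex.arg ⟨(x : E3) 0, (x : E3) 1⟩, ?_, exists_polar_eq x⟩
  · rw [Real.arccos_le_pi_div_two, a2]; exact hw 0
  · set z : ℂ := ⟨(x : E3) 0, (x : E3) 1⟩
    have hz0 : 0 ≤ z.arg := by
      rw [Complex.arg_nonneg_iff]
      change 0 ≤ (x : E3) 1
      rw [a1]; exact mul_nonneg (hw 2) hs.le
    refine ⟨hz0, ?_⟩
    by_contra! hlt
    have hn : 0 < ‖z‖ := by
      rw [norm_pos_iff]
      intro h
      rw [h, Complex.arg_zero] at hlt
      linarith
    have e1 : ‖z‖ * Real.cos z.arg = (x : E3) 0 := Complex.norm_mul_cos_arg z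
    have e2 : ‖z‖ * Real.sin z.arg = (x : E3) 1 := Complex.norm_mul_sin_arg z
    -- The weight `w 1` is a negative multiple of this sine, so a longitude beyond `α` would make it
    -- negative.
    have e3 : ‖z‖ * Real.sin (z.arg - α) = - (w 1 * Real.sin α) := by
      rw [Real.sin_sub]
      linear_combination Real.cos α * e2 - Real.sin α * e1 + Real.cos α * a1 - Real.sin α * a0
    have e4 : 0 < Real.sin (z.arg - α) :=
      Real.sin_pos_of_pos_of_lt_pi (by linarith) (by linarith [Complex.arg_le_pi z])
    nlinarith [hw 1, mul_pos hn e4, mul_nonneg (hw 1) hs.le]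

theorem triDist_eq_zero_of_polar_eq {k : S.Flag} {p q : S.Tri k}
    (h : polar p.1 ((1 + t) * p.2) = polar q.1 ((1 + t) * q.2)) :
    S.toExp t ⟨k, p⟩ = S.toExp t ⟨k, q⟩ := by
  have h1 := dist_toX_le (t := t) k p q
  rw [triDist, h, sphDist_self, toX_pos, toX_pos] at h1
  exact dist_le_zero.1 h1

theorem pos_eq_iff_toExp_eq (ht0 : 0 < t) (hlen : ∀ e, (1 + t) * S.len e < Real.pi)
    {a b : Σ k, S.Tri k} : S.toExp t a = S.toExp t b ↔ S.pos a = S.pos b := by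
  rw [← toX_pos, ← toX_pos, (toX_injective ht0 hlen).eq_iff]

theorem isPiecewiseSpherical (ht0 : 0 < t) (hlen : ∀ e, (1 + t) * S.len e < Real.pi) :
    IsPiecewiseSpherical (S.Expansion t) := by
  have hpi := Real.pi_pos
  have ht1 : 0 < 1 + t := by linarith
  have hlen' := len_lt_pi_of_expansion ht0 hlen
  have hα0 : ∀ e, 0 < (1 + t) * S.len e := fun e => mul_pos ht1 (S.len_pos e)
  have := S.finite_flag
  obtain ⟨n, ⟨κ⟩⟩ := Finite.exists_equiv_fin S.Flag
  let V : S.Flag → Fin 3 → S2 := fun k => triVertex ((1 + t) * S.len k.1.2)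
  have hco : ∀ k (x : sphTriangle (V k)), ∃ p : S.Tri k, polar p.1 ((1 + t) * p.2) = x.1 := by
    rintro k ⟨x, w, hw, hx⟩
    obtain ⟨r, hr, φ, hφ, h⟩ := exists_polar_of_sum (hα0 _) (hlen _) hw hx
    refine ⟨(⟨r, hr⟩, ⟨φ / (1 + t), div_nonneg hφ.1 ht1.le, ?_⟩), ?_⟩
    · rw [div_le_iff₀ ht1]; linarith [hφ.2]
    · simp only
      rw [mul_div_cancel₀ _ ht1.ne', h]
  choose co hco using hco
  have hmem : ∀ k (p : S.Tri k), polar p.1 ((1 + t) * p.2) ∈ sphTriangle (V k) := fun k p =>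
    polar_mem_sphTriangle (hα0 _) (hlen _) p.1.2 ⟨mul_nonneg ht1.le p.2.2.1,
      mul_le_mul_of_nonneg_left p.2.2.2 ht1.le⟩
  -- At the apex the coordinate `u` is not unique and `co` may return a different one, but the point
  -- of the expansion is the same.
  have hβ : ∀ k (p : S.Tri k), S.toExp t ⟨k, co k ⟨_, hmem k p⟩⟩ = S.toExp t ⟨k, p⟩ := fun k p =>
    triDist_eq_zero_of_polar_eq (hco k _)
  refine ⟨n, fun i => V (κ.symm i), fun i x => S.toExp t ⟨κ.symm i, co _ x⟩, fun i =>
    linearIndependent_triVertex (hα0 _) (hlen _), ?_, ?_, ?_, ?_⟩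
  · intro i x y hxy
    simp only [pos_eq_iff_toExp_eq ht0 hlen, pos_eq_pt] at hxy
    rw [pt_eq_iff (co _ x).1.2 (co _ y).1.2] at hxy
    obtain ⟨hr, h⟩ := hxy
    apply Subtype.ext
    rw [← hco _ x, ← hco _ y, hr]
    rcases h with h | ⟨m, hm⟩
    · rw [hr] at h
      apply S2.ext_coord <;> simp [h]
    · have h1 : ((co (κ.symm i) x).2 : ℝ) = (co (κ.symm i) y).2 := by
        have hrim : S.edge (κ.symm i).1.2 (co (κ.symm i) x).2 =
            S.edge (κ.symm i).1.2 (co (κ.symm i) y).2 := by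
          rw [edge_eq_rim (κ.symm i).2 (co _ x).2.2, edge_eq_rim (κ.symm i).2 (co _ y).2.2,
            rim_eq_iff]
          exact ⟨m, hm⟩
        exact edge_injOn hlen' _ (co _ x).2.2 (co _ y).2.2 hrim
      rw [h1]
  · intro x
    obtain ⟨⟨k, p⟩, rfl⟩ := S.toExp_surjective t x
    obtain ⟨i, rfl⟩ := κ.symm.surjective k
    exact ⟨i, ⟨_, hmem _ p⟩, hβ _ p⟩
  -- Positive weights put the point in the open face, away from the center and from the two bounding
  -- radii. The face and the edge below the point are then determined, and with them the triangle.
  · rintro i j x y hij hxy ⟨w, hw, hx⟩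
    simp only [pos_eq_iff_toExp_eq ht0 hlen, pos_eq_pt] at hxy
    obtain ⟨a0, a1, a2⟩ := (sum_triVertex _ w _).1 hx
    rw [← hco _ x] at a0 a1 a2
    simp only [polar_zero, polar_one, polar_two] at a0 a1 a2
    set p := co _ x with hp
    set q := co _ y with hq
    have hs : 0 < Real.sin ((1 + t) * S.len (κ.symm i).1.2) :=
      Real.sin_pos_of_pos_of_lt_pi (hα0 _) (hlen _)
    have hr1 : (p.1 : ℝ) < Real.pi / 2 := lt_of_le_of_ne p.1.2.2 fun h => by
      rw [h, Real.cos_pi_div_two] at a2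
      exact (hw 0).ne a2
    have hy0 : 0 < Real.sin p.1 * Real.sin ((1 + t) * p.2) := by
      rw [a1]; exact mul_pos (hw 2) hs
    have hsr : 0 ≤ Real.sin p.1 := Real.sin_nonneg_of_nonneg_of_le_pi p.1.2.1 (by linarith)
    have hr0 : (p.1 : ℝ) ≠ 0 := fun h => by simp [h] at hy0
    have hu0 : (0 : ℝ) < p.2 := lt_of_le_of_ne p.2.2.1 fun h => by simp [← h] at hy0
    have hu1 : (p.2 : ℝ) < S.len (κ.symm i).1.2 := lt_of_le_of_ne p.2.2.2 fun h => by
      rw [h] at a0 a1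
      have h2 := mul_right_cancel₀ hs.ne' a1
      rw [h2] at a0
      have := hw 1
      linarith
    have hf : S.pt (κ.symm i).1.1 p.1 (S.start (κ.symm i).1.1 (κ.symm i).1.2 +
        S.dir (κ.symm i).1.1 (κ.symm i).1.2 * p.2) ∈ S.openFace (κ.symm i).1.1 :=
      pt_mem_openFace ⟨p.1.2.1, hr1⟩ _
    have hff : (κ.symm j).1.1 = (κ.symm i).1.1 := by
      refine eq_of_mem_openFace hf ?_
      rw [hxy]; exact pt_mem_range _ _ _
    rw [hff, pt_eq_iff p.1.2 q.1.2] at hxy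
    obtain ⟨m, hm⟩ := hxy.2.resolve_left hr0
    have hj : S.Incident (κ.symm i).1.1 (κ.symm j).1.2 := hff ▸ (κ.symm j).2
    have he : S.edge (κ.symm i).1.2 p.2 = S.edge (κ.symm j).1.2 q.2 := by
      rw [edge_eq_rim (κ.symm i).2 p.2.2, edge_eq_rim hj q.2.2, rim_eq_iff]
      exact ⟨m, hm⟩
    have hee := (edge_eq_edge hlen' ⟨hu0, hu1⟩ q.2.2 he).1
    exact hij (κ.symm.injective (Subtype.ext (Prod.ext hff hee))).symm
  · intro a b
    rw [edist_toExp]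
    refine (glueEDist_comap (T' := fun i => sphTriangle (V (κ.symm i))) (d := S.triDist t)
      (s := S.pattern) (fun a => ⟨κ.symm a.1, co _ a.2⟩) ?_ ?_ ?_ a b).symm
    · intro i x y
      refine ⟨_, _, _, rfl, rfl, ?_⟩
      rw [triDist, hco, hco]
    · intro k p q
      obtain ⟨i, rfl⟩ := κ.symm.surjective k
      exact ⟨i, ⟨_, hmem _ p⟩, ⟨_, hmem _ q⟩, (pos_eq_iff_toExp_eq ht0 hlen).1 (hβ _ p),
        (pos_eq_iff_toExp_eq ht0 hlen).1 (hβ _ q), rfl⟩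
    · intro x y
      exact pos_eq_iff_toExp_eq ht0 hlen

end HemisphereComplex

end Spherical

namespace Spherical

namespace HemisphereComplex

variable {Q : Type*} [MetricSpace Q] {S : HemisphereComplex Q} {t : ℝ}

/-! ### Distances in a single face of the expansion -/

theorem dist_pt_le_of_arc (ht0 : 0 < t) (hlen : ∀ e, (1 + t) * S.len e < Real.pi) {f : S.F}
    {e : S.E} (he : S.Incident f e) {u u' : ℝ} (hu : u ∈ Icc 0 (S.len e))
    (hu' : u' ∈ Icc 0 (S.len e)) {r r' φ φ' : ℝ} (hr : r ∈ Icc 0 (Real.pi / 2))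
    (hr' : r' ∈ Icc 0 (Real.pi / 2)) {n : ℤ}
    (hφ : S.start f e + S.dir f e * u = φ + n * (2 * Real.pi))
    (hφ' : S.start f e + S.dir f e * u' = φ' + n * (2 * Real.pi)) :
    dist (S.toX t (S.pt f r φ)) (S.toX t (S.pt f r' φ')) ≤
      coneDist r r' ((1 + t) * |φ - φ'|) := by
  let k : S.Flag := ⟨(f, e), he⟩
  have h1 := dist_toX_le (t := t) k (⟨r, hr⟩, ⟨u, hu⟩) (⟨r', hr'⟩, ⟨u', hu'⟩)
  rw [triDist_eq ht0 hlen, pos_eq_pt, pos_eq_pt] at h1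
  simp only [k] at h1
  rw [hφ, hφ', pt_add_period, pt_add_period] at h1
  have h2 : |u - u'| = |φ - φ'| := by
    have : φ - φ' = S.dir f e * (u - u') := by linarith
    rw [this, abs_mul, abs_dir, one_mul]
  rwa [h2] at h1

/-- The expanded face is a spherical cone of angle `(1 + t) * 2π` around its center. The bound `P`
holds within the arc of one edge, hence near every longitude on both sides. It propagates by
transitivity as long as the total angle is below `π`, and beyond that the path through the center
suffices. -/
theorem dist_pt_le (ht0 : 0 < t) (hlen : ∀ e, (1 + t) * S.len e < Real.pi) (f : S.F)
    {r r' : ℝ} (hr : r ∈ Icc 0 (Real.pi / 2)) (hr' : r' ∈ Icc 0 (Real.pi / 2)) (φ φ' : ℝ) :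
    dist (S.toX t (S.pt f r φ)) (S.toX t (S.pt f r' φ')) ≤
      coneDist r r' ((1 + t) * |φ - φ'|) := by
  have hpi := Real.pi_pos
  have ht1 : 0 < 1 + t := by linarith
  have hlen' := len_lt_pi_of_expansion ht0 hlen
  let P : ℝ → ℝ → Prop := fun a b => ∀ r ∈ Icc 0 (Real.pi / 2), ∀ r' ∈ Icc 0 (Real.pi / 2),
    dist (S.toX t (S.pt f r a)) (S.toX t (S.pt f r' b)) ≤ coneDist r r' ((1 + t) * |a - b|)
  have hloc : ∀ x, ∀ σ : ℝ, (σ = 1 ∨ σ = -1) → ∃ η > 0, ∀ s ∈ Icc 0 η, P x (x + σ * s) := by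
    intro x σ hσ
    obtain ⟨e, u, η, n, he, hη, hu, hx⟩ := exists_edge_germ hlen' f x hσ
    refine ⟨η, hη, fun s hs r hr r' hr' => ?_⟩
    have h0 := hx 0 ⟨le_rfl, hη.le⟩
    rw [mul_zero, add_zero] at h0
    refine dist_pt_le_of_arc ht0 hlen he h0 (hx s hs) hr hr' hu ?_
    linear_combination hu + σ * s * dir_mul_dir f e
  have hsymm : ∀ a b, P a b → P b a := fun a b h r hr r' hr' => by
    rw [dist_comm, coneDist_comm, abs_sub_comm]
    exact h r' hr' r hr
  -- The intermediate radius `s` is where the great circle arc between the outer points meets the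
  -- ray of longitude `b`, so the two bounds add up without loss.
  have htrans : ∀ a b c, a ≤ b → b ≤ c → (1 + t) * (c - a) < Real.pi → P a b → P b c → P a c := by
    intro a b c hab hbc hlt h1 h2 r hr r' hr'
    obtain ⟨s, hs, hsum⟩ := exists_coneDist_add_eq hr hr' (a := (1 + t) * (b - a))
      (b := (1 + t) * (c - b)) (mul_nonneg ht1.le (by linarith)) (mul_nonneg ht1.le (by linarith))
      (by linarith)
    have k1 := h1 r hr s hs
    have k2 := h2 s hs r' hr'
    rw [abs_sub_comm, abs_of_nonneg (by linarith)] at k1 k2 ⊢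
    rw [← mul_add, add_comm (b - a), sub_add_sub_cancel] at hsum
    linarith [dist_triangle (S.toX t (S.pt f r a)) (S.toX t (S.pt f s b)) (S.toX t (S.pt f r' c))]
  have hself : ∀ a, P a a := fun a => by
    obtain ⟨η, hη, h⟩ := hloc a 1 (.inl rfl)
    simpa using h 0 ⟨le_rfl, hη.le⟩
  have hshort : ∀ a b, a ≤ b → (1 + t) * (b - a) < Real.pi → P a b := by
    intro a b hab hlt
    let G : Set ℝ := {x | x ≤ b ∧ ∀ z ∈ Icc a x, P a z}
    have hGa : a ∈ G := ⟨hab, fun z hz => by rw [le_antisymm hz.2 hz.1]; exact hself a⟩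
    have hGb : BddAbove G := ⟨b, fun x hx => hx.1⟩
    set m := sSup G
    have ham : a ≤ m := le_csSup hGb hGa
    have hmb : m ≤ b := csSup_le ⟨_, hGa⟩ fun x hx => hx.1
    have hbd : ∀ c ≤ b, (1 + t) * (c - a) < Real.pi := fun c hc => by nlinarith
    have hltm : ∀ z, a ≤ z → z < m → P a z := fun z h0 hz => by
      obtain ⟨x, hx, hzx⟩ := exists_lt_of_lt_csSup ⟨_, hGa⟩ hz
      exact hx.2 z ⟨h0, hzx.le⟩
    have hm : P a m := by
      rcases ham.eq_or_lt with h | h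
      · rw [← h]; exact hself a
      obtain ⟨η, hη, hl⟩ := hloc m (-1) (.inr rfl)
      set s := min η (m - a)
      have hs0 : 0 < s := lt_min hη (by linarith)
      have hs1 : s ≤ m - a := min_le_right _ _
      have h1 := hsymm _ _ (hl s ⟨hs0.le, min_le_left _ _⟩)
      exact htrans a (m + -1 * s) m (by linarith) (by linarith) (hbd m hmb)
        (hltm _ (by linarith) (by linarith)) h1
    rcases hmb.eq_or_lt with h | h
    · rwa [h] at hm
    exfalso
    obtain ⟨η, hη, hr⟩ := hloc m 1 (.inl rfl)
    set s := min η (b - m)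
    have hs0 : 0 < s := lt_min hη (by linarith)
    have hs1 : s ≤ b - m := min_le_right _ _
    have hs2 : s ≤ η := min_le_left _ _
    have : m + s ∈ G := by
      refine ⟨by linarith, fun z hz => ?_⟩
      rcases lt_or_ge z m with h2 | h2
      · exact hltm z hz.1 h2
      · have := hr (z - m) ⟨by linarith, by linarith [hz.2]⟩
        rw [one_mul, add_sub_cancel] at this
        exact htrans a m z ham h2 (hbd z (by linarith [hz.2])) hm this
    linarith [le_csSup hGb this]
  have hall : P φ φ' := by
    rcases lt_or_ge ((1 + t) * |φ - φ'|) Real.pi with h | h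
    · rcases le_total φ φ' with h1 | h1
      · exact hshort _ _ h1 (by rwa [abs_sub_comm, abs_of_nonneg (by linarith)] at h)
      · exact hsymm _ _ (hshort _ _ h1 (by rwa [abs_of_nonneg (by linarith)] at h))
    · intro r hr r' hr'
      have h0 : (0 : ℝ) ∈ Icc 0 (Real.pi / 2) := ⟨le_rfl, by positivity⟩
      rw [coneDist_of_pi_le hr.1 hr'.1 (by linarith [hr.2, hr'.2]) h]
      have k1 := hself φ r hr 0 h0
      have k2 := hself φ' 0 h0 r' hr'
      rw [sub_self, abs_zero, mul_zero, coneDist_zero_right _ _ hr.1 (by linarith [hr.2]) le_rfl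
        hpi.le, sub_zero, abs_of_nonneg hr.1] at k1
      rw [sub_self, abs_zero, mul_zero, coneDist_zero_left _ _ hr'.1 (by linarith [hr'.2]),
        pt_zero f φ' φ] at k2
      exact (dist_triangle _ _ _).trans (add_le_add k1 k2)
  exact hall r hr r' hr'

/-! ### Spherical charts of a face -/

/-- The longitude of a point of the sphere. -/
noncomputable def longitude (w : S2) : ℝ := Complex.arg ⟨(w : E3) 0, (w : E3) 1⟩

/-- The points of the northern hemisphere with longitude in `(-π/2, π/2)`. -/
def Forward (w : S2) : Prop := 0 < (w : E3) 0 ∧ 0 ≤ (w : E3) 2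

theorem polar_longitude (w : S2) : polar (Real.arccos ((w : E3) 2)) (longitude w) = w :=
  exists_polar_eq w

theorem Forward.abs_longitude {w : S2} (h : Forward w) : |longitude w| < Real.pi / 2 := by
  rw [longitude, Complex.abs_arg_lt_pi_div_two_iff]
  exact .inl h.1

theorem Forward.arccos_mem {w : S2} (h : Forward w) :
    Real.arccos ((w : E3) 2) ∈ Ioc 0 (Real.pi / 2) := by
  refine ⟨?_, Real.arccos_le_pi_div_two.2 h.2⟩
  rw [Real.arccos_pos]
  have := w.sq_sum
  nlinarith [h.1, sq_nonneg ((w : E3) 1), h.2]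

theorem longitude_polar {r Φ : ℝ} (hr : 0 < Real.sin r) (hΦ : Φ ∈ Ioc (-Real.pi) Real.pi) :
    longitude (polar r Φ) = Φ := by
  have := Complex.arg_mul_cos_add_sin_mul_I hr hΦ
  rw [longitude]
  convert this using 2
  apply Complex.ext <;>
    simp [Complex.cos_ofReal_re, Complex.sin_ofReal_re, Complex.cos_ofReal_im,
      Complex.sin_ofReal_im]

/-- The point of the face `f` that corresponds to the point `w` of the sphere, when the meridian of
longitude `φ` is mapped to the meridian of longitude `0`, and longitudes are multiplied by
`± (1 + t)`. -/
noncomputable def patch (S : HemisphereComplex Q) (t : ℝ) (f : S.F) (φ ε : ℝ) (w : S2) : Q :=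
  S.pt f (Real.arccos ((w : E3) 2)) (φ + ε * (longitude w / (1 + t)))

theorem patch_polar {f : S.F} {φ ε r Φ : ℝ} (hr : r ∈ Ioc 0 (Real.pi / 2))
    (hΦ : Φ ∈ Ioc (-Real.pi) Real.pi) :
    S.patch t f φ ε (polar r Φ) = S.pt f r (φ + ε * (Φ / (1 + t))) := by
  have hpi := Real.pi_pos
  rw [patch, longitude_polar (Real.sin_pos_of_pos_of_lt_pi hr.1 (by linarith [hr.2])) hΦ, polar_two,
    Real.arccos_cos hr.1.le (by linarith [hr.2])]

theorem patch_mem_range (f : S.F) (φ ε : ℝ) (w : S2) : S.patch t f φ ε w ∈ range (S.face f) :=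
  pt_mem_range _ _ _

theorem patch_mem_openFace {f : S.F} {φ ε : ℝ} {w : S2} (h : 0 < (w : E3) 2) :
    S.patch t f φ ε w ∈ S.openFace f :=
  pt_mem_openFace ⟨Real.arccos_nonneg _, Real.arccos_lt_pi_div_two.2 h⟩ _

theorem abs_sub_longitude {w w' : S2} (h : Forward w) (h' : Forward w') :
    |longitude w - longitude w'| < Real.pi := by
  have a := abs_lt.1 h.abs_longitude
  have b := abs_lt.1 h'.abs_longitude
  rw [abs_lt]; constructor <;> linarith [a.1, a.2, b.1, b.2]

theorem dist_patch_le (ht0 : 0 < t) (hlen : ∀ e, (1 + t) * S.len e < Real.pi) {f : S.F} {φ ε : ℝ}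
    (hε : ε = 1 ∨ ε = -1) {w w' : S2} (h : Forward w) (h' : Forward w') :
    dist (S.toX t (S.patch t f φ ε w)) (S.toX t (S.patch t f φ ε w')) ≤ sphDist w w' := by
  have ht1 : 0 < 1 + t := by linarith
  refine (dist_pt_le ht0 hlen f (Ioc_subset_Icc_self h.arccos_mem)
    (Ioc_subset_Icc_self h'.arccos_mem) _ _).trans ?_
  have : (1 + t) * |φ + ε * (longitude w / (1 + t)) - (φ + ε * (longitude w' / (1 + t)))| =
      |longitude w - longitude w'| := by
    rw [add_sub_add_left_eq_sub, ← mul_sub, ← sub_div, abs_mul, abs_div, abs_of_pos ht1]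
    have : |ε| = 1 := by rcases hε with h | h <;> simp [h]
    rw [this]; field_simp
  rw [this, ← sphDist_polar_eq_coneDist (abs_sub_longitude h h').le, polar_longitude,
    polar_longitude]

theorem patch_injective (ht0 : 0 < t) {f : S.F} {φ ε : ℝ}
    (hε : ε = 1 ∨ ε = -1) {w w' : S2} (h : Forward w) (h' : Forward w')
    (heq : S.patch t f φ ε w = S.patch t f φ ε w') : w = w' := by
  have ht1 : 0 < 1 + t := by linarith
  have hpi := Real.pi_pos
  rw [patch, patch, pt_eq_iff (Ioc_subset_Icc_self h.arccos_mem)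
    (Ioc_subset_Icc_self h'.arccos_mem)] at heq
  obtain ⟨n, hn⟩ := heq.2.resolve_left h.arccos_mem.1.ne'
  have h1 : |(n : ℝ) * (2 * Real.pi)| < 2 * Real.pi := by
    have e1 : (n : ℝ) * (2 * Real.pi) = ε * ((longitude w - longitude w') / (1 + t)) := by
      rw [sub_div]; linarith
    have e2 : |ε| = 1 := by rcases hε with h | h <;> simp [h]
    rw [e1, abs_mul, e2, one_mul, abs_div, abs_of_pos ht1, div_lt_iff₀ ht1]
    have := abs_sub_longitude h h'
    nlinarith
  have h2 : n = 0 := by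
    rw [abs_mul, abs_of_pos (by positivity : 0 < 2 * Real.pi)] at h1
    rw [← Int.abs_lt_one_iff]
    have : |(n : ℝ)| < 1 := by
      by_contra! h3
      nlinarith
    exact_mod_cast this
  rw [h2, Int.cast_zero, zero_mul, add_zero] at hn
  have h3 : longitude w = longitude w' := by
    have h4 := add_left_cancel hn
    have h5 : ε ≠ 0 := by rcases hε with h | h <;> simp [h]
    have h6 := mul_left_cancel₀ h5 h4
    field_simp at h6
    exact h6
  rw [← polar_longitude w, ← polar_longitude w', heq.1, h3]

/-- Moves in a triangle of the face `f` are moves in the sphere. -/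
theorem patch_step (ht0 : 0 < t) (hlen : ∀ e, (1 + t) * S.len e < Real.pi) {f : S.F} {φ ε : ℝ}
    (hε : ε = 1 ∨ ε = -1) {w : S2} (h : Forward w) {k : S.Flag} (hk : k.1.1 = f) {p q : S.Tri k}
    (hp : S.patch t f φ ε w = S.pos ⟨k, p⟩)
    (hw : ∀ w' : S2, 0 ≤ (w' : E3) 2 → sphDist w w' ≤ S.triDist t k p q → 0 < (w' : E3) 0) :
    ∃ w', Forward w' ∧ S.patch t f φ ε w' = S.pos ⟨k, q⟩ ∧ sphDist w w' = S.triDist t k p q := by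
  have ht1 : 0 < 1 + t := by linarith
  have hpi := Real.pi_pos
  subst hk
  rw [patch, pos_eq_pt, pt_eq_iff (Ioc_subset_Icc_self h.arccos_mem) p.1.2] at hp
  obtain ⟨hr, h0⟩ := hp
  obtain ⟨n, hn⟩ := h0.resolve_left h.arccos_mem.1.ne'
  simp only at hr hn
  set D := S.dir k.1.1 k.1.2
  have hD : D = 1 ∨ D = -1 := S.dir_eq _ _
  set Φ := longitude w + ε * ((1 + t) * (D * ((q.2 : ℝ) - p.2)))
  have hdist : sphDist w (polar q.1 Φ) = S.triDist t k p q := by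
    conv_lhs => rw [← polar_longitude w, hr]
    refine sphDist_polar_congr ?_
    rcases hε with h1 | h1 <;> rcases hD with h2 | h2
    · congr 1; simp only [Φ, h1, h2]; ring_nf
    · rw [← Real.cos_neg]; congr 1; simp only [Φ, h1, h2]; ring_nf
    · rw [← Real.cos_neg]; congr 1; simp only [Φ, h1, h2]; ring_nf
    · congr 1; simp only [Φ, h1, h2]; ring_nf
  have hz : 0 ≤ (polar q.1 Φ : E3) 2 := by
    rw [polar_two]
    exact Real.cos_nonneg_of_mem_Icc ⟨by linarith [q.1.2.1], q.1.2.2⟩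
  have hx := hw _ hz hdist.le
  have hsq : 0 ≤ Real.sin q.1 := Real.sin_nonneg_of_nonneg_of_le_pi q.1.2.1 (by linarith [q.1.2.2])
  have hcos : 0 < Real.cos Φ := by
    rw [polar_zero] at hx
    exact pos_of_mul_pos_right hx hsq
  have hsq' : 0 < Real.sin q.1 := by
    rw [polar_zero] at hx
    exact pos_of_mul_pos_left hx hcos.le
  have hΦ1 : |Φ - longitude w| < Real.pi := by
    have e1 : |ε| = 1 := by rcases hε with h | h <;> simp [h]
    have e2 : |D| = 1 := by rcases hD with h | h <;> simp [h]
    have : Φ - longitude w = ε * ((1 + t) * (D * ((q.2 : ℝ) - p.2))) := by simp only [Φ]; ring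
    rw [this, abs_mul, e1, one_mul, abs_mul, abs_of_pos ht1, abs_mul, e2, one_mul]
    exact (mul_le_mul_of_nonneg_left (abs_sub_le_len q p) ht1.le).trans_lt (hlen _)
  have hl := abs_lt.1 h.abs_longitude
  have hΦ2 := abs_lt.1 hΦ1
  -- The starting longitude is within `π / 2` of `0` and changes by less than `π`, so `|Φ| < 3π /
  -- 2`; in this range a positive cosine means `|Φ| < π / 2`.
  have hΦ : |Φ| < Real.pi / 2 := by
    rw [abs_lt]
    constructor
    · by_contra! h3
      have := Real.cos_nonpos_of_pi_div_two_le_of_le (x := -Φ) (by linarith)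
        (by linarith [hl.1, hΦ2.1])
      rw [Real.cos_neg] at this
      linarith
    · by_contra! h3
      have := Real.cos_nonpos_of_pi_div_two_le_of_le h3 (by linarith [hl.2, hΦ2.2])
      linarith
  have hΦ' := abs_lt.1 hΦ
  have hq0 : 0 < (q.1 : ℝ) := lt_of_le_of_ne q.1.2.1 fun h3 => by simp [← h3] at hsq'
  refine ⟨polar q.1 Φ, ⟨hx, hz⟩, ?_, hdist⟩
  rw [patch_polar ⟨hq0, q.1.2.2⟩ ⟨by linarith [hΦ'.1], by linarith [hΦ'.2]⟩, pos_eq_pt,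
    pt_eq_iff q.1.2 q.1.2]
  refine ⟨rfl, .inr ⟨n, ?_⟩⟩
  have hε2 : ε * ε = 1 := by rcases hε with h | h <;> simp [h]
  have : ε * (Φ / (1 + t)) = ε * (longitude w / (1 + t)) + D * ((q.2 : ℝ) - p.2) := by
    simp only [Φ]
    field_simp
    linear_combination (1 + t) * D * ((q.2 : ℝ) - p.2) * hε2
  rw [this]
  linarith

end HemisphereComplex

end Spherical

/-! ### Angles on a circle of given length, and conical charts -/

namespace Spherical

theorem exists_abs_sub_eq_norm (θ a b : ℝ) :
    ∃ n : ℤ, |a - (b + n * θ)| = ‖(a : AddCircle θ) - (b : AddCircle θ)‖ := by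
  refine ⟨round (θ⁻¹ * (a - b)), ?_⟩
  rw [← AddCircle.coe_sub, AddCircle.norm_eq]
  congr 1; ring

theorem norm_coe_sub_le (θ a b : ℝ) : ‖(a : AddCircle θ) - (b : AddCircle θ)‖ ≤ |a - b| := by
  rw [← AddCircle.coe_sub]
  exact QuotientAddGroup.norm_mk_le_norm

theorem coe_add_int_mul (θ a : ℝ) (n : ℤ) : ((a + n * θ : ℝ) : AddCircle θ) = a := by
  rw [AddCircle.coe_add, ← zsmul_eq_mul, AddCircle.coe_zsmul, AddCircle.coe_period]
  simp

theorem norm_le_half_period {θ : ℝ} (hθ : 0 < θ) (a b : ℝ) :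
    ‖(a : AddCircle θ) - (b : AddCircle θ)‖ ≤ θ / 2 := by
  have := AddCircle.norm_le_half_period θ (x := (a : AddCircle θ) - b) hθ.ne'
  rwa [abs_of_pos hθ] at this

theorem sphDist_polar_eq_coneDist_norm (x a x' b : ℝ) : sphDist (polar x a) (polar x' b) =
    coneDist x x' ‖(a : AddCircle (2 * Real.pi)) - (b : AddCircle (2 * Real.pi))‖ := by
  obtain ⟨n, hn⟩ := exists_abs_sub_eq_norm (2 * Real.pi) a b
  have h := norm_le_half_period (by positivity : 0 < 2 * Real.pi) a b
  rw [← hn] at h ⊢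
  rw [← sphDist_polar_eq_coneDist (by linarith)]
  apply sphDist_polar_congr
  rw [← sub_sub, Real.cos_sub_int_mul_two_pi]

namespace HemisphereComplex

variable {Q : Type*} [MetricSpace Q] {S : HemisphereComplex Q} {t : ℝ}

/-! ### Conical charts of the expansion -/

/-- `C x a` are polar coordinates at `y`: in the ball of radius `ρ / 3` around `y`, distances are at
most those in the spherical cone of angle `θ`, and in the ball of radius `ρ` every move in a triangle
can be followed in the cone. -/
structure ConeChart (S : HemisphereComplex Q) (t : ℝ) (y : Q) (θ ρ : ℝ) (C : ℝ → ℝ → Q) : Prop where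
  θ_pos : 0 < θ
  ρ_pos : 0 < ρ
  ρ_le : ρ ≤ Real.pi / 2
  periodic : ∀ x, Function.Periodic (C x) θ
  apex : ∀ a, C 0 a = y
  upper : ∀ x ∈ Ico 0 (ρ / 3), ∀ x' ∈ Ico 0 (ρ / 3), ∀ a b, a ≤ b → b - a < Real.pi →
    dist (S.toX t (C x a)) (S.toX t (C x' b)) ≤ coneDist x x' (b - a)
  step : ∀ x ∈ Ico 0 ρ, ∀ a k p q, C x a = S.pos ⟨k, p⟩ → x + S.triDist t k p q < ρ →
    ∃ x' ∈ Ico 0 ρ, ∃ b, C x' b = S.pos ⟨k, q⟩ ∧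
      coneDist x x' ‖(a : AddCircle θ) - (b : AddCircle θ)‖ ≤ S.triDist t k p q
  inj : ∀ x ∈ Ico 0 ρ, ∀ x' ∈ Ico 0 ρ, ∀ a b, C x a = C x' b →
    x = x' ∧ (x = 0 ∨ (a : AddCircle θ) = b)

namespace ConeChart

variable {y : Q} {θ ρ : ℝ} {C : ℝ → ℝ → Q} (h : S.ConeChart t y θ ρ C)
include h

/-- The distance from the apex grows by no more than the cost of a move, so a chain of total cost
less than `ρ - x` never leaves the domain of `step`, and the lifts are joined by the triangle
inequality of the cone. -/
theorem follow {A B : Σ k, S.Tri k} {L : ℝ} (hc : GlueChain (S.triDist t) S.pattern A B L) :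
    ∀ x ∈ Ico 0 ρ, ∀ a, C x a = S.pos A → x + L < ρ → ∃ x' ∈ Ico 0 ρ, ∃ b, C x' b = S.pos B ∧
      coneDist x x' ‖(a : AddCircle θ) - (b : AddCircle θ)‖ ≤ L := by
  have hpi := Real.pi_pos
  have hρ := h.ρ_le
  induction hc with
  | glue hr =>
    intro x hx a ha _
    refine ⟨x, hx, a, ha.trans hr, ?_⟩
    rw [sub_self, norm_zero, coneDist_zero_right x x hx.1 (by linarith [hx.2]) hx.1
      (by linarith [hx.2])]
    simp
  | @step A B L k p q hr hc ih =>
    intro x hx a ha hL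
    have hL0 := hc.nonneg fun k p q => triDist_nonneg k p q
    obtain ⟨x₁, hx₁, b₁, hb₁, hd₁⟩ := h.step x hx a k p q (ha.trans hr) (by linarith)
    have hle := (abs_le.1 (abs_sub_le_coneDist hx.1 (by linarith [hx.2]) hx₁.1 (by linarith [hx₁.2])
      (norm_nonneg ((a : AddCircle θ) - (b₁ : AddCircle θ))))).1
    obtain ⟨x', hx', b, hb, hd⟩ := ih x₁ hx₁ b₁ hb₁ (by linarith)
    refine ⟨x', hx', b, hb, ?_⟩
    have := coneDist_triangle (r := x) (s := x₁) (r' := x') hx.1 hx₁.1 hx'.1 (by linarith [hx.2])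
      (by linarith [hx₁.2]) (by linarith [hx'.2])
      (norm_nonneg ((a : AddCircle θ) - (b : AddCircle θ)))
      (norm_nonneg ((a : AddCircle θ) - (b₁ : AddCircle θ)))
      (norm_nonneg ((b₁ : AddCircle θ) - (b : AddCircle θ)))
      (norm_sub_le_norm_sub_add_norm_sub _ _ _)
    linarith

theorem dist_apex_le {x : ℝ} (hx : x ∈ Ico 0 (ρ / 3)) (a : ℝ) :
    dist (S.toX t (C x a)) (S.toX t y) ≤ x := by
  have hpi := Real.pi_pos
  have := h.upper x hx 0 ⟨le_rfl, by linarith [h.ρ_pos]⟩ a a le_rfl (by simpa using hpi)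
  rwa [h.apex, sub_self, coneDist_zero_right x 0 hx.1 (by linarith [hx.2, h.ρ_le, h.ρ_pos]) le_rfl
    hpi.le, sub_zero, abs_of_nonneg hx.1] at this

theorem dist_le {x x' : ℝ} (hx : x ∈ Ico 0 (ρ / 3)) (hx' : x' ∈ Ico 0 (ρ / 3)) (a b : ℝ) :
    dist (S.toX t (C x a)) (S.toX t (C x' b)) ≤
      coneDist x x' ‖(a : AddCircle θ) - (b : AddCircle θ)‖ := by
  have hρ := h.ρ_le
  have hρ0 := h.ρ_pos
  obtain ⟨n, hn⟩ := exists_abs_sub_eq_norm θ a b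
  have hb : C x' (b + n * θ) = C x' b := by
    have := (h.periodic x').int_mul n b
    simpa using this
  rw [← hn, ← hb]
  set b' := b + n * θ
  rcases lt_or_ge |a - b'| Real.pi with h1 | h1
  · rcases le_total a b' with h2 | h2
    · rw [abs_sub_comm, abs_of_nonneg (by linarith)] at h1 ⊢
      exact h.upper x hx x' hx' a b' h2 h1
    · rw [abs_of_nonneg (by linarith)] at h1 ⊢
      rw [dist_comm, coneDist_comm]
      exact h.upper x' hx' x hx b' a h2 h1
  · rw [coneDist_of_pi_le hx.1 hx'.1 (by linarith [hx.2, hx'.2]) h1]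
    have k1 := h.dist_apex_le hx a
    have k2 := h.dist_apex_le hx' b'
    rw [dist_comm] at k2
    exact (dist_triangle _ _ _).trans (add_le_add k1 k2)

/-- The radius `ρ / 3` is chosen for this argument: the cone distance is at most `x + x' < 2ρ / 3`,
so a chain that undercuts it remains within radius `ρ` and lifts to the cone. By `inj` the lift ends
at the right point, which contradicts the length. -/
theorem dist_eq {x x' : ℝ} (hx : x ∈ Ico 0 (ρ / 3)) (hx' : x' ∈ Ico 0 (ρ / 3)) (a b : ℝ) :
    dist (S.toX t (C x a)) (S.toX t (C x' b)) =
      coneDist x x' ‖(a : AddCircle θ) - (b : AddCircle θ)‖ := by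
  have hpi := Real.pi_pos
  have hρ := h.ρ_le
  have hρ0 := h.ρ_pos
  refine le_antisymm (h.dist_le hx hx' a b) ?_
  by_contra! hlt
  obtain ⟨A, hA⟩ := S.exists_pos_eq' (C x a)
  obtain ⟨B, hB⟩ := S.exists_pos_eq' (C x' b)
  rw [← hA, ← hB] at hlt
  obtain ⟨M, hM, hc⟩ := exists_chain_lt hlt
  have hle : coneDist x x' ‖(a : AddCircle θ) - (b : AddCircle θ)‖ ≤ x + x' :=
    coneDist_le_add hx.1 (by linarith [hx.2]) hx'.1 (by linarith [hx'.2])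
  obtain ⟨z, hz, b', hb', hd⟩ := h.follow hc x ⟨hx.1, by linarith [hx.2]⟩ a hA.symm
    (by linarith [hx.2, hx'.2])
  obtain ⟨hzx, hzb⟩ := h.inj z hz x' ⟨hx'.1, by linarith [hx'.2]⟩ b' b (hb'.trans hB)
  rcases hzb with h0 | h0
  · have hx0 : x' = 0 := hzx.symm.trans h0
    rw [h0, coneDist_comm, coneDist_zero_left _ _ hx.1 (by linarith [hx.2])] at hd
    rw [hx0, coneDist_comm, coneDist_zero_left _ _ hx.1 (by linarith [hx.2])] at hM
    linarith
  · rw [hzx, h0] at hd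
    linarith

theorem dist_apex {x : ℝ} (hx : x ∈ Ico 0 (ρ / 3)) (a : ℝ) :
    dist (S.toX t y) (S.toX t (C x a)) = x := by
  have := h.dist_eq (x := 0) ⟨le_rfl, by linarith [h.ρ_pos]⟩ hx a a
  rwa [h.apex, coneDist_zero_left _ _ hx.1 (by linarith [hx.2, h.ρ_le, h.ρ_pos])] at this

theorem exists_eq {q : Q} (hq : dist (S.toX t y) (S.toX t q) < ρ / 3) :
    ∃ a, C (dist (S.toX t y) (S.toX t q)) a = q := by
  have hρ0 := h.ρ_pos
  obtain ⟨A, hA⟩ := S.exists_pos_eq' (C 0 0)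
  obtain ⟨B, hB⟩ := S.exists_pos_eq' q
  have hq' := hq
  rw [← h.apex 0, ← hA, ← hB] at hq'
  obtain ⟨M, hM, hc⟩ := exists_chain_lt hq'
  obtain ⟨z, hz, b, hb, hd⟩ := h.follow hc 0 ⟨le_rfl, hρ0⟩ 0 hA.symm (by linarith)
  rw [coneDist_zero_left _ _ hz.1 (by linarith [hz.2, h.ρ_le])] at hd
  rw [hB] at hb
  refine ⟨b, ?_⟩
  rw [← hb, h.dist_apex ⟨hz.1, by linarith⟩ b]

theorem hasConeAngle : HasConeAngle (S.toX t y) θ := by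
  have hρ := h.ρ_le
  have hρ0 := h.ρ_pos
  have hper : ∀ x, Function.Periodic (fun a => S.toX t (C x a)) θ := fun x a => by
    simp only [h.periodic x a]
  refine ⟨h.θ_pos, ρ / 3, by positivity, by linarith, fun x => (hper x).lift, ?_, ?_, ?_⟩
  · intro φ
    obtain ⟨a, rfl⟩ := QuotientAddGroup.mk_surjective φ
    change S.toX t (C 0 a) = S.toX t y
    rw [h.apex]
  · intro r hr r' hr' φ φ'
    obtain ⟨a, rfl⟩ := QuotientAddGroup.mk_surjective φ
    obtain ⟨b, rfl⟩ := QuotientAddGroup.mk_surjective φ'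
    change dist (S.toX t (C r a)) (S.toX t (C r' b)) = _
    rw [h.dist_eq hr hr' a b]
    rfl
  · intro x hx
    obtain ⟨q, rfl⟩ := toX_surjective (S := S) (t := t) x
    obtain ⟨a, ha⟩ := h.exists_eq hx
    exact ⟨_, ⟨dist_nonneg, hx⟩, (a : AddCircle θ),
      by change S.toX t (C _ a) = _; rw [ha]⟩

end ConeChart

/-- The chart at the center of a face. -/
theorem coneChart_center (ht0 : 0 < t) (hlen : ∀ e, (1 + t) * S.len e < Real.pi) (f : S.F) :
    S.ConeChart t (S.pt f 0 0) ((1 + t) * (2 * Real.pi)) (Real.pi / 2)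
      (fun x a => S.pt f x (a / (1 + t))) := by
  have hpi := Real.pi_pos
  have ht1 : 0 < 1 + t := by linarith
  refine ⟨by positivity, by positivity, le_rfl, ?_, ?_, ?_, ?_, ?_⟩
  · intro x a
    simp only
    rw [← pt_add_period f x (a / (1 + t)) 1]
    congr 1
    field_simp
    simp
  · intro a
    exact pt_zero f _ _
  · intro x hx x' hx' a b hab _
    refine (dist_pt_le ht0 hlen f ⟨hx.1, by linarith [hx.2]⟩ ⟨hx'.1, by linarith [hx'.2]⟩ _ _).trans
      (le_of_eq ?_)
    rw [← sub_div, abs_div, abs_of_pos ht1, abs_sub_comm, abs_of_nonneg (by linarith)]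
    congr 1
    field_simp
  · intro x hx a k p q hp hlt
    -- A triangle that contains a point of an open face belongs to that face.
    have hkf : k.1.1 = f := by
      refine eq_of_mem_openFace (pt_mem_openFace hx (a / (1 + t))) ?_
      have := pos_mem_range (S := S) ⟨k, p⟩
      rwa [← hp] at this
    subst hkf
    rw [pos_eq_pt, pt_eq_iff ⟨hx.1, hx.2.le⟩ p.1.2] at hp
    simp only at hp
    obtain ⟨hxp, hang⟩ := hp
    have hq1 : (q.1 : ℝ) ≤ Real.pi := by linarith [q.1.2.2]
    have hp1 : (p.1 : ℝ) ≤ Real.pi := by linarith [p.1.2.2]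
    rw [triDist_eq ht0 hlen] at hlt ⊢
    have hδ : 0 ≤ (1 + t) * |(p.2 : ℝ) - q.2| := mul_nonneg ht1.le (abs_nonneg _)
    have := (abs_le.1 (abs_sub_le_coneDist p.1.2.1 hp1 q.1.2.1 hq1 hδ)).1
    refine ⟨q.1, ⟨q.1.2.1, by linarith⟩,
      (1 + t) * (S.start k.1.1 k.1.2 + S.dir k.1.1 k.1.2 * q.2), ?_, ?_⟩
    · rw [pos_eq_pt, mul_div_cancel_left₀ _ ht1.ne']
    · rw [hxp]
      rcases hang with h0 | ⟨n, hn⟩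
      · rw [← hxp, h0, coneDist_zero_left _ _ q.1.2.1 hq1, coneDist_zero_left _ _ q.1.2.1 hq1]
      · refine coneDist_mono p.1.2.1 hp1 q.1.2.1 hq1 (norm_nonneg _) ?_
        have ha : a = (1 + t) * (S.start k.1.1 k.1.2 + S.dir k.1.1 k.1.2 * p.2) +
            n * ((1 + t) * (2 * Real.pi)) := by
          rw [div_eq_iff ht1.ne'] at hn
          rw [hn]; ring
        rw [ha, coe_add_int_mul]
        refine (norm_coe_sub_le _ _ _).trans (le_of_eq ?_)
        rw [← mul_sub, add_sub_add_left_eq_sub, ← mul_sub, abs_mul, abs_mul, abs_of_pos ht1, abs_dir,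
          one_mul]
  · intro x hx x' hx' a b hab
    rw [pt_eq_iff ⟨hx.1, hx.2.le⟩ ⟨hx'.1, hx'.2.le⟩] at hab
    refine ⟨hab.1, hab.2.imp id ?_⟩
    rintro ⟨n, hn⟩
    have ha : a = b + n * ((1 + t) * (2 * Real.pi)) := by
      field_simp at hn
      rw [hn]; ring
    rw [ha, coe_add_int_mul]

/-- Points near a point of the sphere with positive first and last coordinates. -/
theorem exists_pos_radius {w₀ : S2} (h0 : 0 < (w₀ : E3) 0) (h2 : 0 < (w₀ : E3) 2) :
    ∃ ρ, 0 < ρ ∧ ρ ≤ Real.pi / 2 ∧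
      ∀ w, sphDist w₀ w < ρ → 0 < (w : E3) 0 ∧ 0 < (w : E3) 2 := by
  have hpi := Real.pi_pos
  have key : ∀ v w : S2, 0 < inner ℝ (v : E3) (w : E3) ↔ sphDist v w < Real.pi / 2 := fun v w => by
    rw [sphDist_eq_arccos, Real.arccos_lt_pi_div_two]
  have c0 : ∀ w : S2, inner ℝ (polar (Real.pi / 2) 0 : E3) (w : E3) = (w : E3) 0 := fun w => by
    rw [inner_E3]; simp
  have c2 : ∀ w : S2, inner ℝ (polar 0 0 : E3) (w : E3) = (w : E3) 2 := fun w => by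
    rw [inner_E3]; simp
  rw [← c0, key] at h0
  rw [← c2, key] at h2
  refine ⟨min (Real.pi / 2 - sphDist (polar (Real.pi / 2) 0) w₀)
    (Real.pi / 2 - sphDist (polar 0 0) w₀), lt_min (by linarith) (by linarith),
    (min_le_right _ _).trans (by linarith [sphDist_nonneg (polar 0 0) w₀]), fun w hw => ?_⟩
  rw [lt_min_iff] at hw
  rw [← c0, key, ← c2, key]
  constructor <;> linarith [sphDist_triangle (polar (Real.pi / 2) 0) w₀ w,
    sphDist_triangle (polar 0 0) w₀ w]

theorem coe_eq_of_polar_eq {x x' a b : ℝ} (hx : x ∈ Ico 0 (Real.pi / 2))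
    (hx' : x' ∈ Ico 0 (Real.pi / 2)) (h : polar x a = polar x' b) :
    x = x' ∧ (x = 0 ∨ (a : AddCircle (2 * Real.pi)) = b) := by
  have h1 : hemi ⟨x, hx.1, hx.2.le⟩ a = hemi ⟨x', hx'.1, hx'.2.le⟩ b := Subtype.ext h
  rw [hemi_eq_iff] at h1
  refine ⟨congrArg Subtype.val h1.1, h1.2.imp id ?_⟩
  rintro ⟨n, rfl⟩
  exact coe_add_int_mul _ _ _

/-- The chart at an interior point of a face that is not the center. -/
theorem coneChart_patch (ht0 : 0 < t) (hlen : ∀ e, (1 + t) * S.len e < Real.pi) (f : S.F)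
    (φ : ℝ) {ε : ℝ} (hε : ε = 1 ∨ ε = -1) {w₀ : S2} {ρ : ℝ} (hρ0 : 0 < ρ) (hρ : ρ ≤ Real.pi / 2)
    (hpos : ∀ w, sphDist w₀ w < ρ → 0 < (w : E3) 0 ∧ 0 < (w : E3) 2) {M : E3 ≃ₗᵢ[ℝ] E3}
    (hM : mapS2 M (polar 0 0) = w₀) :
    S.ConeChart t (S.patch t f φ ε w₀) (2 * Real.pi) ρ
      (fun x a => S.patch t f φ ε (mapS2 M (polar x a))) := by
  have hpi := Real.pi_pos
  have hdist : ∀ x ∈ Ico 0 ρ, ∀ a, sphDist w₀ (mapS2 M (polar x a)) = x :=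
    fun x hx a => by
      rw [← hM, sphDist_mapS2, sphDist_pole x a ⟨hx.1, by linarith [hx.2]⟩]
  have hpos' : ∀ x ∈ Ico 0 ρ, ∀ a, 0 < (mapS2 M (polar x a) : E3) 0 ∧
      0 < (mapS2 M (polar x a) : E3) 2 := fun x hx a => hpos _ (by rw [hdist x hx]; exact hx.2)
  have hfw : ∀ x ∈ Ico 0 ρ, ∀ a, Forward (mapS2 M (polar x a)) := fun x hx a =>
    ⟨(hpos' x hx a).1, (hpos' x hx a).2.le⟩
  refine ⟨by positivity, hρ0, hρ, ?_, ?_, ?_, ?_, ?_⟩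
  · intro x a
    change S.patch t f φ ε (mapS2 M (polar _ _)) = S.patch t f φ ε (mapS2 M (polar _ _))
    congr 2
    apply S2.ext_coord <;> simp
  · intro a
    have : polar 0 a = polar 0 0 := by apply S2.ext_coord <;> simp
    change S.patch t f φ ε (mapS2 M (polar 0 a)) = _
    rw [this, hM]
  · intro x hx x' hx' a b hab hlt
    refine (dist_patch_le ht0 hlen hε (hfw x ⟨hx.1, by linarith [hx.2]⟩ a)
      (hfw x' ⟨hx'.1, by linarith [hx'.2]⟩ b)).trans (le_of_eq ?_)
    have h1 : |a - b| = b - a := by rw [abs_sub_comm, abs_of_nonneg (by linarith)]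
    rw [sphDist_mapS2, sphDist_polar_eq_coneDist (by rw [h1]; exact hlt.le), h1]
  · intro x hx a k p q hp hlt
    have hkf : k.1.1 = f := by
      refine eq_of_mem_openFace (patch_mem_openFace (t := t) (φ := φ) (ε := ε) (hpos' x hx a).2) ?_
      have := pos_mem_range (S := S) ⟨k, p⟩
      rwa [← hp] at this
    have htri : ∀ w' : S2, sphDist (mapS2 M (polar x a)) w' ≤ S.triDist t k p q →
        sphDist (w₀) w' < ρ := fun w' hw' => by
      have := sphDist_triangle (w₀) (mapS2 M (polar x a)) w'
      rw [hdist x hx] at this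
      linarith
    obtain ⟨w', hw', hq, hd⟩ := patch_step ht0 hlen hε (hfw x hx a) hkf hp
      fun w' _ h => (hpos w' (htri w' h)).1
    obtain ⟨b, hb⟩ := exists_mapS2_polar_eq M w'
    rw [hM] at hb
    refine ⟨_, ⟨sphDist_nonneg _ _, htri w' hd.le⟩, b, ?_, ?_⟩
    · rw [← hb, hq]
    · rw [← sphDist_polar_eq_coneDist_norm, ← sphDist_mapS2 M, ← hb, hd]
  · intro x hx x' hx' a b hab
    have h1 := patch_injective ht0 hε (hfw x hx a) (hfw x' hx' b) hab
    have h2 : polar x a = polar x' b := by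
      apply eq_of_sphDist_eq_zero
      rw [← sphDist_mapS2 M, h1, sphDist_self]
    exact coe_eq_of_polar_eq ⟨hx.1, by linarith [hx.2]⟩ ⟨hx'.1, by linarith [hx'.2]⟩ h2

theorem exists_coneChart_patch (ht0 : 0 < t) (hlen : ∀ e, (1 + t) * S.len e < Real.pi) (f : S.F)
    (φ : ℝ) {ε : ℝ} (hε : ε = 1 ∨ ε = -1) {w₀ : S2} (h0 : 0 < (w₀ : E3) 0) (h2 : 0 < (w₀ : E3) 2) :
    ∃ (ρ : ℝ) (M : E3 ≃ₗᵢ[ℝ] E3), mapS2 M (polar 0 0) = w₀ ∧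
      S.ConeChart t (S.patch t f φ ε w₀) (2 * Real.pi) ρ
        (fun x a => S.patch t f φ ε (mapS2 M (polar x a))) := by
  obtain ⟨M, hM⟩ := exists_mapS2_eq (polar 0 0) w₀
  obtain ⟨ρ, hρ0, hρ, hpos⟩ := exists_pos_radius h0 h2
  exact ⟨ρ, M, hM, coneChart_patch ht0 hlen f φ hε hρ0 hρ hpos hM⟩

end HemisphereComplex

end Spherical

/-! ### Charts around points of the 1-skeleton, and cone angles -/

namespace Spherical

/-- Polar coordinates on the sphere around the point of longitude `0` of the equator; the angle `ψ`
runs from `0` to `π` on the northern hemisphere. -/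
noncomputable def side (x ψ : ℝ) : S2 :=
  ⟨!₂[Real.cos x, -(Real.sin x * Real.cos ψ), Real.sin x * Real.sin ψ], by
    rw [mem_sphere_zero_iff_norm, EuclideanSpace.norm_eq, Real.sqrt_eq_one]
    simp only [Fin.sum_univ_three, Real.norm_eq_abs, sq_abs]
    simp
    linear_combination Real.sin x ^ 2 * Real.sin_sq_add_cos_sq ψ + Real.sin_sq_add_cos_sq x⟩

@[simp] theorem side_zero (x ψ : ℝ) : (side x ψ : E3) 0 = Real.cos x := rfl

@[simp] theorem side_one (x ψ : ℝ) : (side x ψ : E3) 1 = -(Real.sin x * Real.cos ψ) := rfl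

@[simp] theorem side_two (x ψ : ℝ) : (side x ψ : E3) 2 = Real.sin x * Real.sin ψ := rfl

theorem sphDist_side (x ψ x' ψ' : ℝ) :
    sphDist (side x ψ) (side x' ψ') = sphDist (polar x ψ) (polar x' ψ') := by
  rw [sphDist_eq_arccos, sphDist_eq_arccos, inner_polar, inner_E3, Real.cos_sub]
  simp
  congr 1; ring

theorem side_pi (x : ℝ) : side x Real.pi = polar (Real.pi / 2) x := by
  apply S2.ext_coord <;> simp

theorem side_zero_right (x : ℝ) : side x 0 = polar (Real.pi / 2) (-x) := by
  apply S2.ext_coord <;> simp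

theorem side_zero_left (ψ : ℝ) : side 0 ψ = polar (Real.pi / 2) 0 := by
  apply S2.ext_coord <;> simp

theorem exists_side_eq {w : S2} (h : 0 ≤ (w : E3) 2) :
    ∃ ψ ∈ Icc 0 Real.pi, side (Real.arccos ((w : E3) 0)) ψ = w := by
  have hn := w.sq_sum
  have h1 : -1 ≤ (w : E3) 0 := by nlinarith [sq_nonneg ((w : E3) 1), sq_nonneg ((w : E3) 2)]
  have h2 : (w : E3) 0 ≤ 1 := by nlinarith [sq_nonneg ((w : E3) 1), sq_nonneg ((w : E3) 2)]
  have hs : Real.sin (Real.arccos ((w : E3) 0)) = ‖(⟨-(w : E3) 1, (w : E3) 2⟩ : ℂ)‖ := by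
    rw [Real.sin_arccos, Complex.norm_def, Complex.normSq_mk]
    congr 1
    linarith
  refine ⟨Complex.arg ⟨-(w : E3) 1, (w : E3) 2⟩, ⟨Complex.arg_nonneg_iff.2 h, Complex.arg_le_pi _⟩,
    ?_⟩
  apply S2.ext_coord
  · simp [Real.cos_arccos h1 h2]
  · simp [hs, Complex.norm_mul_cos_arg]
  · simp [hs, Complex.norm_mul_sin_arg]

theorem sphDist_side_zero {x : ℝ} (hx : x ∈ Icc 0 Real.pi) (ψ : ℝ) :
    sphDist (side 0 0) (side x ψ) = x := by
  rw [sphDist_side, sphDist_pole _ _ hx]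

theorem side_injective {x ψ x' ψ' : ℝ} (hx : x ∈ Ico 0 (Real.pi / 2))
    (hψ : ψ ∈ Icc 0 Real.pi) (hx' : x' ∈ Ico 0 (Real.pi / 2)) (hψ' : ψ' ∈ Icc 0 Real.pi)
    (h : side x ψ = side x' ψ') : x = x' ∧ (x = 0 ∨ ψ = ψ') := by
  have hpi := Real.pi_pos
  have h0 := congrArg (fun w : S2 => (w : E3) 0) h
  have h1 := congrArg (fun w : S2 => (w : E3) 1) h
  simp only [side_zero, side_one] at h0 h1
  have hxx : x = x' := Real.injOn_cos ⟨hx.1, by linarith [hx.2]⟩ ⟨hx'.1, by linarith [hx'.2]⟩ h0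
  refine ⟨hxx, ?_⟩
  rcases hx.1.eq_or_lt with h2 | h2
  · exact .inl h2.symm
  right
  rw [← hxx, neg_inj] at h1
  have := mul_left_cancel₀ (Real.sin_pos_of_pos_of_lt_pi h2 (by linarith [hx.2])).ne' h1
  exact Real.injOn_cos hψ hψ' this

namespace HemisphereComplex

theorem forward_side {x ψ : ℝ} (hx : x ∈ Ico 0 (Real.pi / 2)) (hψ : ψ ∈ Icc 0 Real.pi) :
    Forward (side x ψ) := by
  have hpi := Real.pi_pos
  refine ⟨?_, ?_⟩
  · rw [side_zero]; exact Real.cos_pos_of_mem_Ioo ⟨by linarith [hx.1], hx.2⟩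
  · rw [side_two]
    exact mul_nonneg (Real.sin_nonneg_of_nonneg_of_le_pi hx.1 (by linarith [hx.2]))
      (Real.sin_nonneg_of_nonneg_of_le_pi hψ.1 hψ.2)

variable {Q : Type*} [MetricSpace Q] {S : HemisphereComplex Q} {t : ℝ} {y : Q}

namespace LinkCycle

/-- Polar coordinates around `y` in the `i`-th face of the link cycle. -/
noncomputable def sec (lc : S.LinkCycle y) (t : ℝ) (i : ℤ) (x ψ : ℝ) : Q :=
  S.patch t (lc.f i) (lc.φ i) (lc.ε i) (side x ψ)

/-- Polar coordinates around `y`. -/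
noncomputable def chart (lc : S.LinkCycle y) (t x a : ℝ) : Q :=
  lc.sec t ⌊a / Real.pi⌋ x (a - ⌊a / Real.pi⌋ * Real.pi)

/-- The radius of the chart around `y`. -/
noncomputable def rad (lc : S.LinkCycle y) (t : ℝ) : ℝ := min (Real.pi / 2) ((1 + t) * lc.η)

variable (lc : S.LinkCycle y)

theorem rad_pos (ht0 : 0 < t) : 0 < lc.rad t :=
  lt_min (by positivity) (mul_pos (by linarith) lc.η_pos)

theorem rad_le : lc.rad t ≤ Real.pi / 2 := min_le_left _ _

theorem mem_of_lt_rad (ht0 : 0 < t) {x : ℝ} (hx : x ∈ Ico 0 (lc.rad t)) :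
    x ∈ Ico 0 (Real.pi / 2) ∧ x / (1 + t) ∈ Icc 0 lc.η := by
  have ht1 : 0 < 1 + t := by linarith
  refine ⟨⟨hx.1, hx.2.trans_le lc.rad_le⟩, div_nonneg hx.1 ht1.le, ?_⟩
  rw [div_le_iff₀ ht1, mul_comm]
  exact hx.2.le.trans (min_le_right _ _)

theorem sec_pi {x : ℝ} (hx : x ∈ Ico 0 (Real.pi / 2)) (i : ℤ) :
    lc.sec t i x Real.pi = S.rim (lc.f i) (lc.φ i + lc.ε i * (x / (1 + t))) := by
  have hpi := Real.pi_pos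
  rw [sec, side_pi, patch_polar ⟨by positivity, le_rfl⟩ ⟨by linarith [hx.1], by linarith [hx.2]⟩,
    pt_half]

theorem sec_zero_right {x : ℝ} (hx : x ∈ Ico 0 (Real.pi / 2)) (i : ℤ) :
    lc.sec t i x 0 = S.rim (lc.f i) (lc.φ i - lc.ε i * (x / (1 + t))) := by
  have hpi := Real.pi_pos
  rw [sec, side_zero_right, patch_polar ⟨by positivity, le_rfl⟩
    ⟨by linarith [hx.2], by linarith [hx.1]⟩, pt_half]
  congr 1; ring

theorem sec_zero_left (i : ℤ) (ψ : ℝ) : lc.sec t i 0 ψ = y := by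
  have hpi := Real.pi_pos
  rw [sec, side_zero_left, patch_polar ⟨by positivity, le_rfl⟩ ⟨by linarith, hpi.le⟩, pt_half]
  simp [lc.base]

/-- The two sides of a sector are boundary arcs of the face, described in the arc length `x / (1 +
t)` of `Q`; the link cycle glues consecutive ones. -/
theorem sec_glue (ht0 : 0 < t) {x : ℝ} (hx : x ∈ Ico 0 (lc.rad t)) (i : ℤ) :
    lc.sec t i x Real.pi = lc.sec t (i + 1) x 0 := by
  obtain ⟨h1, h2⟩ := lc.mem_of_lt_rad ht0 hx
  rw [sec_pi _ h1, sec_zero_right _ h1, lc.glue i _ h2]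

theorem sec_add_mul (i n : ℤ) (x ψ : ℝ) : lc.sec t (i + n * lc.k) x ψ = lc.sec t i x ψ := by
  obtain ⟨h1, h2, h3⟩ := lc.periodic i n
  rw [sec, h1, h2, h3, sec]

theorem sec_mem_range (i : ℤ) (x ψ : ℝ) : lc.sec t i x ψ ∈ range (S.face (lc.f i)) :=
  patch_mem_range _ _ _ _

theorem sec_mem_openFace {x ψ : ℝ} (hx : x ∈ Ioo 0 (Real.pi / 2)) (hψ : ψ ∈ Ioo 0 Real.pi) (i : ℤ) :
    lc.sec t i x ψ ∈ S.openFace (lc.f i) := by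
  refine patch_mem_openFace ?_
  rw [side_two]
  exact mul_pos (Real.sin_pos_of_pos_of_lt_pi hx.1 (by linarith [hx.2, Real.pi_pos]))
    (Real.sin_pos_of_mem_Ioo hψ)

theorem floor_mem (a : ℝ) : a - ⌊a / Real.pi⌋ * Real.pi ∈ Ico 0 Real.pi := by
  have hpi := Real.pi_pos
  have h1 := Int.floor_le (a / Real.pi)
  have h2 := Int.lt_floor_add_one (a / Real.pi)
  rw [le_div_iff₀ hpi] at h1
  rw [div_lt_iff₀ hpi] at h2
  constructor <;> linarith

/-- The closed range for `ψ` matters: at `ψ = π` the floor already jumps to `i + 1`, and the two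
descriptions agree by `sec_glue`. -/
theorem chart_eq (ht0 : 0 < t) {x : ℝ} (hx : x ∈ Ico 0 (lc.rad t)) (i : ℤ) {ψ : ℝ}
    (hψ : ψ ∈ Icc 0 Real.pi) : lc.chart t x (i * Real.pi + ψ) = lc.sec t i x ψ := by
  have hpi := Real.pi_pos
  rcases hψ.2.eq_or_lt with h | h
  · have : ⌊(i * Real.pi + ψ) / Real.pi⌋ = i + 1 := by
      rw [h, Int.floor_eq_iff]
      push_cast
      constructor
      · rw [le_div_iff₀ hpi]; linarith
      · rw [div_lt_iff₀ hpi]; linarith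
    rw [chart, this, h, sec_glue _ ht0 hx]
    congr 1
    push_cast; ring
  · have : ⌊(i * Real.pi + ψ) / Real.pi⌋ = i := by
      rw [Int.floor_eq_iff]
      constructor
      · rw [le_div_iff₀ hpi]; linarith [hψ.1]
      · rw [div_lt_iff₀ hpi]; linarith
    rw [chart, this]
    congr 1; ring

theorem chart_eq_of_mem (ht0 : 0 < t) {x : ℝ} (hx : x ∈ Ico 0 (lc.rad t)) (i : ℤ) {a : ℝ}
    (ha : a - i * Real.pi ∈ Icc 0 Real.pi) : lc.chart t x a = lc.sec t i x (a - i * Real.pi) := by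
  rw [← chart_eq _ ht0 hx i ha]
  congr 1; ring

theorem chart_zero (a : ℝ) : lc.chart t 0 a = y := lc.sec_zero_left _ _

theorem chart_int_mul_pi (ht0 : 0 < t) {x : ℝ} (hx : x ∈ Ico 0 (lc.rad t)) (i : ℤ) :
    lc.chart t x (i * Real.pi) = S.rim (lc.f i) (lc.φ i - lc.ε i * (x / (1 + t))) := by
  have := lc.chart_eq ht0 hx i (ψ := 0) ⟨le_rfl, Real.pi_pos.le⟩
  rw [add_zero] at this
  rw [this, sec_zero_right _ (lc.mem_of_lt_rad ht0 hx).1]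

theorem eq_mul_pi_of_mem_skel {x a : ℝ} (hx : x ∈ Ioo 0 (lc.rad t))
    (h : lc.chart t x a ∈ S.skel) : a = ⌊a / Real.pi⌋ * Real.pi := by
  have h1 := floor_mem a
  rcases h1.1.eq_or_lt with h2 | h2
  · linarith
  · exact absurd (lc.sec_mem_openFace (t := t) ⟨hx.1, hx.2.trans_le lc.rad_le⟩ ⟨h2, h1.2⟩
      ⌊a / Real.pi⌋) (h _)

/-- Points of a face near `y` lie in a sector of the chart that belongs to the face. -/
theorem exists_sec (ht0 : 0 < t) {x a : ℝ} (hx : x ∈ Ico 0 (lc.rad t)) {g : S.F}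
    (hg : lc.chart t x a ∈ range (S.face g)) :
    ∃ j, ∃ ψ ∈ Icc 0 Real.pi, lc.f j = g ∧ lc.chart t x a = lc.sec t j x ψ ∧
      (x = 0 ∨ j * Real.pi + ψ = a) := by
  have hpi := Real.pi_pos
  rcases hx.1.eq_or_lt with h0 | h0
  · rw [← h0, chart_zero] at hg ⊢
    obtain ⟨j, hj⟩ := lc.faces g hg
    exact ⟨j, 0, ⟨le_rfl, hpi.le⟩, hj, (lc.sec_zero_left _ _).symm, .inl rfl⟩
  set i := ⌊a / Real.pi⌋ with hi
  have hψ := floor_mem a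
  rw [← hi] at hψ
  have hc : lc.chart t x a = lc.sec t i x (a - i * Real.pi) := rfl
  by_cases hgi : lc.f i = g
  · exact ⟨i, _, Ico_subset_Icc_self hψ, hgi, hc, .inr (by ring)⟩
  -- On the ray between two sectors the point is interior to an edge, and the only other face there
  -- is that of sector `i - 1`; off these rays it lies in a single face.
  rcases hψ.1.eq_or_lt with h1 | h1
  · rw [← h1] at hc
    have hj := lc.sec_glue ht0 hx (i - 1)
    rw [sub_add_cancel] at hj
    refine ⟨i - 1, Real.pi, ⟨hpi.le, le_rfl⟩, ?_, hc.trans hj.symm, .inr (by push_cast; linarith)⟩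
    obtain ⟨hx1, hx2⟩ := lc.mem_of_lt_rad ht0 hx
    obtain ⟨e, u, τ, hτ, hu, hin, hedge, hfaces⟩ := lc.edges (i - 1)
    have hx0 : 0 < x / (1 + t) := by positivity
    have hmem : lc.chart t x a ∈ S.openCell (.inr (.inl e)) := by
      rw [hc, ← hj, sec_pi _ hx1, hedge _ hx2]
      exact ⟨_, hin _ ⟨hx0, hx2.2⟩, rfl⟩
    rw [sub_add_cancel] at hfaces
    rcases (hfaces g).1 (incident_of_mem hmem hg) with h | h
    · exact h.symm
    · exact absurd h.symm hgi
  · rw [hc] at hg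
    exact absurd (eq_of_mem_openFace (lc.sec_mem_openFace ⟨h0, hx.2.trans_le lc.rad_le⟩ ⟨h1, hψ.2⟩ i)
      hg).symm hgi

theorem dist_sec_le (ht0 : 0 < t) (hlen : ∀ e, (1 + t) * S.len e < Real.pi) (i : ℤ) {x ψ x' ψ' : ℝ}
    (hx : x ∈ Ico 0 (Real.pi / 2)) (hψ : ψ ∈ Icc 0 Real.pi) (hx' : x' ∈ Ico 0 (Real.pi / 2))
    (hψ' : ψ' ∈ Icc 0 Real.pi) :
    dist (S.toX t (lc.sec t i x ψ)) (S.toX t (lc.sec t i x' ψ')) ≤ coneDist x x' |ψ - ψ'| := by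
  refine (dist_patch_le ht0 hlen (lc.ε_eq i) (forward_side hx hψ) (forward_side hx' hψ')).trans ?_
  rw [sphDist_side, sphDist_polar_eq_coneDist]
  rw [abs_le]; constructor <;> linarith [hψ.1, hψ.2, hψ'.1, hψ'.2]

/-- The chart at a point of the `1`-skeleton. -/
theorem coneChart (ht0 : 0 < t) (hlen : ∀ e, (1 + t) * S.len e < Real.pi) :
    S.ConeChart t y (lc.k * Real.pi) (lc.rad t) (lc.chart t) := by
  have hpi := Real.pi_pos
  have hk : (0 : ℝ) < lc.k := by have := lc.two_le; positivity
  have hrad := lc.rad_le (t := t)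
  have hrad0 := lc.rad_pos ht0
  have hper : ∀ (a b : ℝ) (n : ℤ), a = b + n * (lc.k * Real.pi) →
      (a : AddCircle (lc.k * Real.pi)) = b := fun a b n h => by rw [h, coe_add_int_mul]
  refine ⟨by positivity, hrad0, hrad, ?_, lc.chart_zero, ?_, ?_, ?_⟩
  · intro x a
    have : ⌊(a + lc.k * Real.pi) / Real.pi⌋ = ⌊a / Real.pi⌋ + (lc.k : ℤ) := by
      rw [add_div, mul_div_cancel_right₀ _ hpi.ne', Int.floor_add_natCast]
    have h2 := lc.sec_add_mul (t := t) ⌊a / Real.pi⌋ 1 x (a - ⌊a / Real.pi⌋ * Real.pi)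
    rw [one_mul] at h2
    rw [chart, this, chart, ← h2]
    congr 1
    push_cast; ring
  · intro x hx x' hx' a b hab hlt
    have hxr : x ∈ Ico 0 (lc.rad t) := ⟨hx.1, by linarith [hx.2]⟩
    have hxr' : x' ∈ Ico 0 (lc.rad t) := ⟨hx'.1, by linarith [hx'.2]⟩
    have key : ∀ (i : ℤ) (z z' c d : ℝ), z ∈ Ico 0 (lc.rad t) → z' ∈ Ico 0 (lc.rad t) →
        i * Real.pi ≤ c → c ≤ d → d ≤ i * Real.pi + Real.pi →
        dist (S.toX t (lc.chart t z c)) (S.toX t (lc.chart t z' d)) ≤ coneDist z z' (d - c) := by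
      intro i z z' c d hz hz' h1 h2 h3
      rw [lc.chart_eq_of_mem ht0 hz i (a := c) ⟨by linarith, by linarith⟩,
        lc.chart_eq_of_mem ht0 hz' i (a := d) ⟨by linarith, by linarith⟩]
      refine (lc.dist_sec_le ht0 hlen i ⟨hz.1, by linarith [hz.2]⟩ ⟨by linarith, by linarith⟩
        ⟨hz'.1, by linarith [hz'.2]⟩ ⟨by linarith, by linarith⟩).trans (le_of_eq ?_)
      rw [abs_sub_comm, abs_of_nonneg (by linarith)]
      congr 1; ring
    set i := ⌊a / Real.pi⌋ with hi
    have ha := floor_mem a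
    rw [← hi] at ha
    rcases le_or_gt b (i * Real.pi + Real.pi) with hb | hb
    · exact key i x x' a b hxr hxr' (by linarith [ha.1]) hab hb
    -- Since `b - a < π`, the arc crosses only the gluing ray `m`. It is cut there at radius `s ≤ x
    -- + (x + x')`, which is below the radius of the chart because `x` and `x'` are less than a
    -- third of it.
    · set m := i * Real.pi + Real.pi
      obtain ⟨s, hs, hsum⟩ := exists_coneDist_add_eq (r := x) (r' := x') (a := m - a) (b := b - m)
        ⟨hx.1, by linarith [hx.2]⟩ ⟨hx'.1, by linarith [hx'.2]⟩ (by linarith [ha.2]) (by linarith)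
        (by linarith)
      rw [show m - a + (b - m) = b - a by ring] at hsum
      have hle : coneDist x x' (b - a) ≤ x + x' :=
        coneDist_le_add hx.1 (by linarith [hx.2]) hx'.1 (by linarith [hx'.2])
      have hsx := (abs_le.1 (abs_sub_le_coneDist (r := x) (r' := s) (δ := m - a) hx.1
        (by linarith [hx.2]) hs.1 (by linarith [hs.2]) (by linarith [ha.2]))).1
      have hnn := coneDist_nonneg s x' (b - m)
      have hsr : s ∈ Ico 0 (lc.rad t) := ⟨hs.1, by linarith [hx.2, hx'.2]⟩
      have k1 := key i x s a m hxr hsr (by linarith [ha.1]) (by linarith [ha.2]) le_rfl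
      have k2 := key (i + 1) s x' m b hsr hxr' (by push_cast; linarith) hb.le
        (by push_cast; linarith [ha.2])
      linarith [dist_triangle (S.toX t (lc.chart t x a)) (S.toX t (lc.chart t s m))
        (S.toX t (lc.chart t x' b))]
  -- A move stays in one face, hence in one sector, where it is a move on the sphere. Its endpoint
  -- is within `π / 2` of the base point, which is the positivity that `patch_step` asks for.
  · intro x hx a k p q hp hlt
    have hg : lc.chart t x a ∈ range (S.face k.1.1) := by
      have := pos_mem_range (S := S) ⟨k, p⟩
      rwa [← hp] at this
    obtain ⟨j, ψ, hψ, hj, hc, ha⟩ := lc.exists_sec ht0 hx hg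
    rw [hc, sec] at hp
    have hx2 : x ∈ Ico 0 (Real.pi / 2) := ⟨hx.1, by linarith [hx.2]⟩
    have hcos : ∀ w' : S2, Real.cos (sphDist (side 0 0) w') = (w' : E3) 0 := fun w' => by
      rw [cos_sphDist, inner_E3]; simp
    have htri : ∀ w' : S2, sphDist (side x ψ) w' ≤ S.triDist t k p q →
        sphDist (side 0 0) w' < lc.rad t := fun w' h => by
      have := sphDist_triangle (side 0 0) (side x ψ) w'
      rw [sphDist_side_zero ⟨hx.1, by linarith [hx.2]⟩] at this
      linarith
    obtain ⟨w', hw', hq, hd⟩ := patch_step ht0 hlen (lc.ε_eq j) (forward_side hx2 hψ) hj.symm hp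
      fun w' _ h => by
        rw [← hcos]
        exact Real.cos_pos_of_mem_Ioo ⟨by linarith [sphDist_nonneg (side 0 0) w'],
          by linarith [htri w' h]⟩
    obtain ⟨ψ', hψ', hside⟩ := exists_side_eq hw'.2
    set x' := Real.arccos ((w' : E3) 0)
    have hx' : x' = sphDist (side 0 0) w' := by
      rw [← Real.arccos_cos (sphDist_nonneg (side 0 0) w') (sphDist_le_pi _ _), hcos]
    have hx'r : x' ∈ Ico 0 (lc.rad t) := ⟨hx' ▸ sphDist_nonneg _ _, hx' ▸ htri w' hd.le⟩
    refine ⟨x', hx'r, j * Real.pi + ψ', ?_, ?_⟩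
    · rw [lc.chart_eq ht0 hx'r j hψ', sec, hside, hq]
    · rw [← hd]
      rcases ha with h0 | h0
      · rw [h0, coneDist_zero_left _ _ hx'r.1 (by linarith [hx'r.2]), hx', side_zero_left,
          side_zero_left]
      · have habs : |ψ - ψ'| ≤ Real.pi := by
          rw [abs_le]; constructor <;> linarith [hψ.1, hψ.2, hψ'.1, hψ'.2]
        rw [← hside, sphDist_side, sphDist_polar_eq_coneDist habs]
        refine coneDist_mono hx.1 (by linarith [hx.2]) hx'r.1 (by linarith [hx'r.2]) (norm_nonneg _)
          ((norm_coe_sub_le _ _ _).trans (le_of_eq ?_))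
        rw [← h0]; congr 1; ring
  · intro x hx x' hx' a b hab
    have hg : lc.chart t x' b ∈ range (S.face (lc.f ⌊a / Real.pi⌋)) := by
      rw [← hab]; exact lc.sec_mem_range _ _ _
    obtain ⟨j, ψ, hψ, hj, hc, hb⟩ := lc.exists_sec ht0 hx' hg
    obtain ⟨n, hn⟩ := lc.inj _ _ hj
    -- Equal points lie in sectors of the same face, and a face occurs once per period, so
    -- injectivity of a single sector decides.
    have hj' : j = ⌊a / Real.pi⌋ + n * lc.k := by rw [mul_comm]; omega
    rw [hc, hj', sec_add_mul, chart, sec, sec] at hab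
    have hψa := floor_mem a
    have h2 := patch_injective ht0 (lc.ε_eq _) (forward_side ⟨hx.1, by linarith [hx.2]⟩
      (Ico_subset_Icc_self hψa)) (forward_side ⟨hx'.1, by linarith [hx'.2]⟩ hψ) hab
    obtain ⟨h3, h4⟩ := side_injective ⟨hx.1, by linarith [hx.2]⟩ (Ico_subset_Icc_self hψa)
      ⟨hx'.1, by linarith [hx'.2]⟩ hψ h2
    refine ⟨h3, ?_⟩
    rcases h4 with h4 | h4
    · exact .inl h4
    rcases hb with hb | hb
    · exact .inl (h3.trans hb)
    right
    symm
    refine hper b a n ?_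
    rw [← hb, hj', ← h4]
    push_cast; ring

end LinkCycle

/-! ### Cone points -/

/-- The cone points are the vertices, with angle `k * π` and `k ≥ 3`, and the centers of the faces,
with angle `(1 + t) * 2π`. Inside an edge `k = 2`, and elsewhere in an open face the chart is a
piece of the sphere. -/
theorem exists_cone_points (ht0 : 0 < t) (hlen : ∀ e, (1 + t) * S.len e < Real.pi)
    (hQ : Nonempty (Q ≃ₜ S2)) (hP : S.IsPolyhedral) :
    ∃ K : Set (S.Expansion t), K.Finite ∧ (∀ x ∉ K, HasConeAngle x (2 * Real.pi)) ∧
      ∀ x ∈ K, ∃ θ, 2 * Real.pi < θ ∧ HasConeAngle x θ := by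
  have hpi := Real.pi_pos
  have hlen' := len_lt_pi_of_expansion ht0 hlen
  have := S.finite_V
  have := S.finite_F
  refine ⟨S.toX t '' (range S.vert ∪ range fun f => S.pt f 0 0),
    ((finite_range _).union (finite_range _)).image _, ?_, ?_⟩
  · intro x hx
    obtain ⟨q, rfl⟩ := toX_surjective (S := S) (t := t) x
    rcases skel_or_openFace (S := S) q with hq | ⟨f, hf⟩
    · rcases skel_cases hq with ⟨v, rfl⟩ | ⟨e, he⟩
      · exact absurd ⟨_, .inl ⟨v, rfl⟩, rfl⟩ hx
      · obtain ⟨lc⟩ := exists_linkCycle hlen' hQ hq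
        have h := (lc.coneChart ht0 hlen).hasConeAngle
        rwa [lc.k_eq_two he] at h
    · obtain ⟨r, hr, φ, rfl⟩ := mem_openFace_iff.1 hf
      rcases hr.1.eq_or_lt with h0 | h0
      · refine absurd ⟨_, .inr ⟨f, rfl⟩, ?_⟩ hx
        simp only
        rw [← h0, pt_zero f φ 0]
      · obtain ⟨ρ, M, hM, h⟩ := exists_coneChart_patch ht0 hlen f φ (.inl rfl) (w₀ := polar r 0)
          (by simpa using Real.sin_pos_of_pos_of_lt_pi h0 (by linarith [hr.2]))
          (by simpa using Real.cos_pos_of_mem_Ioo ⟨by linarith, hr.2⟩)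
        have h := h.hasConeAngle
        rwa [patch_polar ⟨h0, hr.2.le⟩ ⟨by linarith, hpi.le⟩, zero_div, mul_zero, add_zero] at h
  · rintro _ ⟨q, ⟨v, rfl⟩ | ⟨f, rfl⟩, rfl⟩
    · obtain ⟨lc⟩ := exists_linkCycle hlen' hQ (vert_mem_skel v)
      refine ⟨_, ?_, (lc.coneChart ht0 hlen).hasConeAngle⟩
      have h3 : (3 : ℝ) ≤ lc.k := by exact_mod_cast lc.three_le hlen' hP rfl
      nlinarith
    · exact ⟨_, by nlinarith, (coneChart_center ht0 hlen f).hasConeAngle⟩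

end HemisphereComplex

end Spherical

/-! ### Germs of geodesics and unique continuation -/

namespace Spherical

/-- The difference of the radii is attained only along a common ray; this shows that a geodesic
leaving the apex follows a ray. -/
theorem eq_zero_of_coneDist_eq_abs_sub {r r' δ : ℝ} (hr : r ∈ Ioo 0 Real.pi)
    (hr' : r' ∈ Ioo 0 Real.pi) (hδ : 0 ≤ δ) (h : coneDist r r' δ = |r - r'|) : δ = 0 := by
  have hpi := Real.pi_pos
  have h1 := congrArg Real.cos h
  rw [coneDist_eq_sphDist, cos_sphDist, inner_polar, Real.cos_abs, zero_sub, Real.cos_neg,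
    Real.cos_sub] at h1
  have h2 := mul_pos (Real.sin_pos_of_mem_Ioo hr) (Real.sin_pos_of_mem_Ioo hr')
  have h3 : Real.cos (min δ Real.pi) = 1 := by
    have : Real.sin r * Real.sin r' * (Real.cos (min δ Real.pi) - 1) = 0 := by linarith
    rcases mul_eq_zero.1 this with h4 | h4 <;> linarith
  have h5 : min δ Real.pi = 0 := by
    rw [Real.cos_eq_one_iff_of_lt_of_lt] at h3
    · exact h3
    · have : 0 ≤ min δ Real.pi := le_min hδ hpi.le
      linarith
    · linarith [min_le_right δ Real.pi]
  rcases min_choice δ Real.pi with h6 | h6 <;> linarith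

theorem coe_eq_pi_of_pi_le_norm {z : AddCircle (2 * Real.pi)} (h : Real.pi ≤ ‖z‖) :
    z = (Real.pi : ℝ) := by
  have hpi := Real.pi_pos
  obtain ⟨c, rfl⟩ := QuotientAddGroup.mk_surjective z
  change Real.pi ≤ ‖(c : AddCircle (2 * Real.pi))‖ at h
  change (c : AddCircle (2 * Real.pi)) = _
  obtain ⟨n, hn⟩ := exists_abs_sub_eq_norm (2 * Real.pi) c 0
  have h1 := norm_le_half_period (by positivity : 0 < 2 * Real.pi) c 0
  rw [AddCircle.coe_zero, sub_zero] at hn h1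
  rw [← hn] at h h1
  have h2 : |c - (0 + n * (2 * Real.pi))| = Real.pi := by linarith
  rcases (abs_eq hpi.le).1 h2 with h3 | h3
  · rw [show c = Real.pi + n * (2 * Real.pi) by linarith, coe_add_int_mul]
  · rw [show c = Real.pi + (n - 1 : ℤ) * (2 * Real.pi) by push_cast; linarith, coe_add_int_mul]

namespace HemisphereComplex

variable {Q : Type*} [MetricSpace Q] {S : HemisphereComplex Q} {t : ℝ}

/-! ### Local geodesics of the expansion -/

/-- The curve `σ`, as a curve in the `t`-expansion, is a shortest path near `u`. -/
def GeodesicAt (S : HemisphereComplex Q) (t : ℝ) (σ : ℝ → Q) (u : ℝ) : Prop :=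
  ∃ ε > 0, ∀ a ∈ Ioo (u - ε) (u + ε), ∀ b ∈ Ioo (u - ε) (u + ε),
    dist (S.toX t (σ a)) (S.toX t (σ b)) = |a - b|

theorem GeodesicAt.continuousAt {σ : ℝ → Q} {u : ℝ} (h : S.GeodesicAt t σ u) (ht0 : 0 < t)
    (hlen : ∀ e, (1 + t) * S.len e < Real.pi) : ContinuousAt σ u := by
  obtain ⟨ε, hε, h⟩ := h
  rw [Metric.continuousAt_iff]
  intro δ hδ
  refine ⟨min ε δ, lt_min hε hδ, fun s hs => ?_⟩
  rw [Real.dist_eq, lt_min_iff] at hs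
  have := abs_lt.1 hs.1
  refine (dist_le_dist_toX ht0 hlen _ _).trans_lt ?_
  rw [h s ⟨by linarith, by linarith⟩ u ⟨by linarith, by linarith⟩]
  exact hs.2

theorem GeodesicAt.reverse {σ : ℝ → Q} {u : ℝ} (h : S.GeodesicAt t σ (-u)) :
    S.GeodesicAt t (fun s => σ (-s)) u := by
  obtain ⟨ε, hε, h⟩ := h
  refine ⟨ε, hε, fun a ha b hb => ?_⟩
  rw [h (-a) ⟨by linarith [ha.2], by linarith [ha.1]⟩ (-b) ⟨by linarith [hb.2], by linarith [hb.1]⟩,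
    abs_sub_comm]
  congr 1; ring

namespace ConeChart

variable {y : Q} {θ ρ : ℝ} {C : ℝ → ℝ → Q}

theorem congr (h : S.ConeChart t y θ ρ C) (x : ℝ) {a b : ℝ} (hab : (a : AddCircle θ) = b) :
    C x a = C x b :=
  congrArg (h.periodic x).lift hab

/-- A geodesic through the center of a chart consists of two rays with an angle of at least `π`. -/
theorem germ (h : S.ConeChart t y θ ρ C) {σ : ℝ → Q} {u : ℝ} (hσ : S.GeodesicAt t σ u)
    (hu : σ u = y) : ∃ δ > 0, δ ≤ ρ / 3 ∧ ∃ a b : ℝ,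
      (∀ x ∈ Ico 0 δ, σ (u + x) = C x a ∧ σ (u - x) = C x b) ∧
      Real.pi ≤ ‖(a : AddCircle θ) - (b : AddCircle θ)‖ := by
  have hpi := Real.pi_pos
  obtain ⟨ε, hε, hσ⟩ := hσ
  have hρ0 := h.ρ_pos
  have hρ := h.ρ_le
  have hδ : 0 < min ε (ρ / 3) := lt_min hε (by positivity)
  have hδε : min ε (ρ / 3) ≤ ε := min_le_left _ _
  have hδρ : min ε (ρ / 3) ≤ ρ / 3 := min_le_right _ _
  set δ := min ε (ρ / 3)
  -- On each side of `u` the curve is at distance `x` from the apex at time `x`, and distances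
  -- within that side are differences of radii, so the angular coordinate is constant.
  have hray : ∀ κ : ℝ, κ = 1 ∨ κ = -1 → ∃ a, ∀ x ∈ Ico 0 δ, σ (u + κ * x) = C x a := by
    intro κ hκ
    have hκ1 : |κ| = 1 := by rcases hκ with h | h <;> simp [h]
    have hmem : ∀ x ∈ Ico 0 δ, u + κ * x ∈ Ioo (u - ε) (u + ε) := fun x hx => by
      rcases hκ with h | h <;> rw [h] <;> constructor <;> linarith [hx.1, hx.2]
    have hex : ∀ x ∈ Ico 0 δ, ∃ a, C x a = σ (u + κ * x) := fun x hx => by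
      have h1 := hσ u ⟨by linarith, by linarith⟩ _ (hmem x hx)
      rw [sub_add_cancel_left, abs_neg, abs_mul, hκ1, one_mul, abs_of_nonneg hx.1, hu] at h1
      obtain ⟨a, ha⟩ := h.exists_eq (q := σ (u + κ * x)) (by rw [h1]; linarith [hx.2])
      rw [h1] at ha
      exact ⟨a, ha⟩
    obtain ⟨a, ha⟩ := hex (δ / 2) ⟨by linarith, by linarith⟩
    refine ⟨a, fun x hx => ?_⟩
    obtain ⟨b, hb⟩ := hex x hx
    rw [← hb]
    rcases hx.1.eq_or_lt with h0 | h0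
    · rw [← h0, h.apex, h.apex]
    refine h.congr x ?_
    have h1 := hσ _ (hmem x hx) _ (hmem (δ / 2) ⟨by linarith, by linarith⟩)
    rw [← ha, ← hb, h.dist_eq ⟨hx.1, by linarith [hx.2]⟩ ⟨by linarith, by linarith⟩,
      add_sub_add_left_eq_sub, ← mul_sub, abs_mul, hκ1, one_mul] at h1
    have := eq_zero_of_coneDist_eq_abs_sub ⟨h0, by linarith [hx.2]⟩ ⟨by linarith, by linarith⟩
      (norm_nonneg _) h1
    exact sub_eq_zero.1 (norm_eq_zero.1 this)
  obtain ⟨a, ha⟩ := hray 1 (.inl rfl)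
  obtain ⟨b, hb⟩ := hray (-1) (.inr rfl)
  refine ⟨δ, hδ, hδρ, a, b, fun x hx => ⟨by rw [← ha x hx]; congr 1; ring,
    by rw [← hb x hx]; congr 1; ring⟩, ?_⟩
  have h1 := hσ (u + 1 * (δ / 2)) ⟨by linarith, by linarith⟩ (u + -1 * (δ / 2))
    ⟨by linarith, by linarith⟩
  rw [ha _ ⟨by linarith, by linarith⟩, hb _ ⟨by linarith, by linarith⟩,
    h.dist_eq ⟨by linarith, by linarith⟩ ⟨by linarith, by linarith⟩] at h1
  refine pi_le_of_coneDist_eq_add (r := δ / 2) (r' := δ / 2) (by linarith) (by linarith)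
    (by linarith) (norm_nonneg _) (h1.trans ?_)
  rw [abs_of_nonneg (by linarith)]; ring

/-- Near a point that is not a cone point, geodesics are determined by their germs. -/
theorem eq_of_frequently (h : S.ConeChart t y (2 * Real.pi) ρ C) {σ τ : ℝ → Q} {u : ℝ}
    (hσ : S.GeodesicAt t σ u) (hτ : S.GeodesicAt t τ u) (hσu : σ u = y) (hτu : τ u = y)
    (hfreq : ∀ ε > 0, ∃ x, x ≠ 0 ∧ |x| < ε ∧ σ (u + x) = τ (u + x)) :
    ∃ ε > 0, ∀ s ∈ Ioo (u - ε) (u + ε), σ s = τ s := by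
  obtain ⟨δ, hδ, hδρ, a, b, hab, hn⟩ := h.germ hσ hσu
  obtain ⟨δ', hδ', -, a', b', hab', hn'⟩ := h.germ hτ hτu
  have hρ0 := h.ρ_pos
  have e1 := coe_eq_pi_of_pi_le_norm hn
  have e2 := coe_eq_pi_of_pi_le_norm hn'
  obtain ⟨x, hx0, hxl, hx⟩ := hfreq (min δ δ') (lt_min hδ hδ')
  rw [lt_min_iff] at hxl
  -- When the cone angle is `2π`, an angle of at least `π` is exactly `π`. Each germ is thus a pair
  -- of opposite rays, and one common point different from the center determines both.
  have key : (a : AddCircle (2 * Real.pi)) = a' ∧ (b : AddCircle (2 * Real.pi)) = b' := by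
    rcases lt_or_gt_of_ne hx0 with h0 | h0
    · rw [abs_of_neg h0] at hxl
      have k1 := (hab (-x) ⟨by linarith, hxl.1⟩).2
      have k2 := (hab' (-x) ⟨by linarith, hxl.2⟩).2
      rw [sub_neg_eq_add] at k1 k2
      have := (h.inj (-x) ⟨by linarith, by linarith⟩ (-x) ⟨by linarith, by linarith⟩ b b'
        (k1.symm.trans (hx.trans k2))).2.resolve_left (by linarith)
      refine ⟨?_, this⟩
      rw [sub_eq_iff_eq_add.1 e1, sub_eq_iff_eq_add.1 e2, this]
    · rw [abs_of_pos h0] at hxl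
      have k1 := (hab x ⟨by linarith, hxl.1⟩).1
      have k2 := (hab' x ⟨by linarith, hxl.2⟩).1
      have := (h.inj x ⟨by linarith, by linarith⟩ x ⟨by linarith, by linarith⟩ a a'
        (k1.symm.trans (hx.trans k2))).2.resolve_left (by linarith)
      refine ⟨this, ?_⟩
      rw [← sub_sub_cancel (a : AddCircle (2 * Real.pi)) b, e1, this, ← e2, sub_sub_cancel]
  refine ⟨min δ δ', lt_min hδ hδ', fun s hs => ?_⟩
  have l1 : min δ δ' ≤ δ := min_le_left _ _
  have l2 : min δ δ' ≤ δ' := min_le_right _ _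
  rcases le_total u s with hus | hus
  · have k1 := (hab (s - u) ⟨by linarith, by linarith [hs.2]⟩).1
    have k2 := (hab' (s - u) ⟨by linarith, by linarith [hs.2]⟩).1
    rw [add_sub_cancel] at k1 k2
    rw [k1, k2, h.congr _ key.1]
  · have k1 := (hab (u - s) ⟨by linarith, by linarith [hs.1]⟩).2
    have k2 := (hab' (u - s) ⟨by linarith, by linarith [hs.1]⟩).2
    rw [sub_sub_cancel] at k1 k2
    rw [k1, k2, h.congr _ key.2]

end ConeChart

/-! ### Geodesics inside a face -/

/-- The chart at an interior point that is not the center is a ball of the round sphere, so `patch`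
is an isometry near it. -/
theorem exists_dist_patch_eq (ht0 : 0 < t) (hlen : ∀ e, (1 + t) * S.len e < Real.pi) (f : S.F)
    (φ : ℝ) {ε : ℝ} (hε : ε = 1 ∨ ε = -1) {w₀ : S2} (h0 : 0 < (w₀ : E3) 0) (h2 : 0 < (w₀ : E3) 2) :
    ∃ ρ > 0, ∀ w w', sphDist w₀ w < ρ → sphDist w₀ w' < ρ →
      dist (S.toX t (S.patch t f φ ε w)) (S.toX t (S.patch t f φ ε w')) = sphDist w w' := by
  obtain ⟨ρ, M, rfl, h⟩ := exists_coneChart_patch ht0 hlen f φ hε h0 h2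
  have := h.ρ_pos
  refine ⟨ρ / 3, by positivity, fun w w' hw hw' => ?_⟩
  obtain ⟨a, ha⟩ := exists_mapS2_polar_eq M w
  obtain ⟨b, hb⟩ := exists_mapS2_polar_eq M w'
  have h1 := h.dist_eq ⟨sphDist_nonneg _ _, hw⟩ ⟨sphDist_nonneg _ _, hw'⟩ a b
  have e : sphDist w w' = sphDist (mapS2 M (polar (sphDist (mapS2 M (polar 0 0)) w) a))
      (mapS2 M (polar (sphDist (mapS2 M (polar 0 0)) w') b)) := by rw [← ha, ← hb]
  rw [e, sphDist_mapS2, sphDist_polar_eq_coneDist_norm, ← h1]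
  change _ = dist (S.toX t (S.patch t f φ ε (mapS2 M (polar _ a))))
    (S.toX t (S.patch t f φ ε (mapS2 M (polar _ b))))
  rw [← ha, ← hb]

theorem geodesicAt_patch (ht0 : 0 < t) (hlen : ∀ e, (1 + t) * S.len e < Real.pi) (f : S.F)
    (φ : ℝ) {ε : ℝ} (hε : ε = 1 ∨ ε = -1) {W : ℝ → S2}
    (hW : ∀ s s', |s - s'| ≤ Real.pi → sphDist (W s) (W s') = |s - s'|) {u : ℝ}
    (h0 : 0 < (W u : E3) 0) (h2 : 0 < (W u : E3) 2) :
    S.GeodesicAt t (fun s => S.patch t f φ ε (W s)) u := by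
  have hpi := Real.pi_gt_three
  obtain ⟨ρ, hρ, h⟩ := exists_dist_patch_eq ht0 hlen f φ hε h0 h2
  have hδ : 0 < min ρ 1 := lt_min hρ one_pos
  have l1 : min ρ 1 ≤ ρ := min_le_left _ _
  have l2 : min ρ 1 ≤ 1 := min_le_right _ _
  refine ⟨min ρ 1, hδ, fun a ha b hb => ?_⟩
  have key : ∀ s ∈ Ioo (u - min ρ 1) (u + min ρ 1), sphDist (W u) (W s) < ρ := fun s hs => by
    have : |u - s| < min ρ 1 := by rw [abs_lt]; constructor <;> linarith [hs.1, hs.2]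
    rw [hW u s (by linarith)]
    linarith
  rw [h _ _ (key a ha) (key b hb), hW]
  rw [abs_le]; constructor <;> linarith [ha.1, ha.2, hb.1, hb.2]

/-- Unique continuation: the times near which the curve agrees with the great circle form an open
set, and by `ConeChart.eq_of_frequently` it is closed in the interval, as the great circle meets no
cone point there. -/
theorem eq_patch_of_eventually (ht0 : 0 < t) (hlen : ∀ e, (1 + t) * S.len e < Real.pi) (f : S.F)
    (φ : ℝ) {ε : ℝ} (hε : ε = 1 ∨ ε = -1) {W : ℝ → S2}
    (hW : ∀ s s', |s - s'| ≤ Real.pi → sphDist (W s) (W s') = |s - s'|) {α β : ℝ}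
    (hpos : ∀ s ∈ Ioo α β, 0 < (W s : E3) 0 ∧ 0 < (W s : E3) 2) {σ : ℝ → Q}
    (hσ : ∀ u, S.GeodesicAt t σ u) {u₀ : ℝ} (hu₀ : u₀ ∈ Ioo α β) {δ : ℝ} (hδ : 0 < δ)
    (hloc : ∀ s ∈ Ioo (u₀ - δ) (u₀ + δ), σ s = S.patch t f φ ε (W s)) :
    ∀ s ∈ Ioo α β, σ s = S.patch t f φ ε (W s) := by
  set τ : ℝ → Q := fun s => S.patch t f φ ε (W s) with hτ
  have hτg : ∀ u ∈ Ioo α β, S.GeodesicAt t τ u := fun u hu =>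
    geodesicAt_patch ht0 hlen f φ hε hW (hpos u hu).1 (hpos u hu).2
  let G : Set ℝ := {s | ∃ δ > 0, ∀ s' ∈ Ioo (s - δ) (s + δ), σ s' = τ s'}
  have hGo : IsOpen G := by
    rw [Metric.isOpen_iff]
    rintro s ⟨δ, hδ, h⟩
    refine ⟨δ / 2, by positivity, fun s' hs' => ⟨δ / 2, by positivity, fun z hz => h z ?_⟩⟩
    rw [Metric.mem_ball, Real.dist_eq, abs_lt] at hs'
    constructor <;> linarith [hz.1, hz.2]
  have hmem : ∀ s ∈ G, σ s = τ s := fun s ⟨δ, hδ, h⟩ => h s ⟨by linarith, by linarith⟩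
  have hsub : Ioo α β ⊆ G := by
    refine isPreconnected_Ioo.subset_of_closure_inter_subset hGo ⟨u₀, hu₀, δ, hδ, hloc⟩ ?_
    rintro s ⟨hs, hsI⟩
    by_cases hsG : s ∈ G
    · exact hsG
    rw [Metric.mem_closure_iff] at hs
    have hfreq : ∀ ε > 0, ∃ x, x ≠ 0 ∧ |x| < ε ∧ σ (s + x) = τ (s + x) := fun ε hε => by
      obtain ⟨z, hz, hd⟩ := hs ε hε
      refine ⟨z - s, fun h0 => hsG ?_, ?_, ?_⟩
      · rwa [← sub_eq_zero.1 h0]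
      · rwa [Real.dist_eq, abs_sub_comm] at hd
      · rw [add_sub_cancel]; exact hmem z hz
    have hst : σ s = τ s := by
      apply toX_injective ht0 hlen
      obtain ⟨ε₁, hε₁, h1⟩ := hσ s
      obtain ⟨ε₂, hε₂, h2⟩ := hτg s hsI
      rw [← dist_le_zero]
      refine le_of_forall_pos_le_add fun r hr => ?_
      obtain ⟨x, -, hx, hxe⟩ := hfreq (min (min ε₁ ε₂) (r / 2)) (by positivity)
      rw [lt_min_iff, lt_min_iff] at hx
      have b1 := abs_lt.1 hx.1.1
      have b2 := abs_lt.1 hx.1.2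
      have k1 := h1 s ⟨by linarith, by linarith⟩ (s + x) ⟨by linarith, by linarith⟩
      have k2 := h2 (s + x) ⟨by linarith, by linarith⟩ s ⟨by linarith, by linarith⟩
      rw [sub_add_cancel_left, abs_neg] at k1
      rw [add_sub_cancel_left, ← hxe] at k2
      have := dist_triangle (S.toX t (σ s)) (S.toX t (σ (s + x))) (S.toX t (τ s))
      linarith [hx.2]
    obtain ⟨ρ, M, -, h⟩ := exists_coneChart_patch ht0 hlen f φ hε (hpos s hsI).1 (hpos s hsI).2
    exact h.eq_of_frequently (hσ s) (hτg s hsI) hst rfl hfreq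
  exact fun s hs => hmem s (hsub hs)

end HemisphereComplex

end Spherical

/-! ### Great circle arcs and crossings of open faces -/

namespace Spherical

/-- The half great circle whose highest point has longitude `0` and distance `c` from the pole. -/
noncomputable def circ (c x : ℝ) : S2 :=
  ⟨!₂[Real.sin c * Real.cos x, Real.sin x, Real.cos c * Real.cos x], by
    rw [mem_sphere_zero_iff_norm, EuclideanSpace.norm_eq, Real.sqrt_eq_one]
    simp only [Fin.sum_univ_three, Real.norm_eq_abs, sq_abs]
    simp
    linear_combination Real.cos x ^ 2 * Real.sin_sq_add_cos_sq c + Real.sin_sq_add_cos_sq x⟩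

@[simp] theorem circ_zero (c x : ℝ) : (circ c x : E3) 0 = Real.sin c * Real.cos x := rfl

@[simp] theorem circ_one (c x : ℝ) : (circ c x : E3) 1 = Real.sin x := rfl

@[simp] theorem circ_two (c x : ℝ) : (circ c x : E3) 2 = Real.cos c * Real.cos x := rfl

theorem sphDist_circ (c : ℝ) {x x' : ℝ} (h : |x - x'| ≤ Real.pi) :
    sphDist (circ c x) (circ c x') = |x - x'| := by
  rw [sphDist_eq_arccos, ← Real.arccos_cos (abs_nonneg (x - x')) h, Real.cos_abs, Real.cos_sub,
    inner_E3]
  simp only [circ_zero, circ_one, circ_two]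
  congr 1
  linear_combination Real.cos x * Real.cos x' * Real.sin_sq_add_cos_sq c

/-- Normal forms of the great circle through a point at distance `r` from the pole: either it is a
meridian, or it is obtained from `circ c` by a rotation or reflection. -/
theorem greatCircle_cases {r b₀ b₁ b₂ : ℝ} (hr : r ∈ Ioo 0 (Real.pi / 2))
    (hn : b₀ ^ 2 + b₁ ^ 2 + b₂ ^ 2 = 1) (ho : Real.sin r * b₀ + Real.cos r * b₂ = 0) :
    (b₁ = 0 ∧ ∃ κ : ℝ, (κ = 1 ∨ κ = -1) ∧ b₀ = κ * Real.cos r ∧ b₂ = -κ * Real.sin r) ∨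
    ∃ c ∈ Ioo 0 (Real.pi / 2), ∃ m ∈ Ioo (-(Real.pi / 2)) (Real.pi / 2), ∃ ε Φ : ℝ,
      (ε = 1 ∨ ε = -1) ∧ ∀ x,
        Real.cos x * Real.sin r + Real.sin x * b₀ =
          Real.cos Φ * (Real.sin c * Real.cos (x - m)) - ε * Real.sin Φ * Real.sin (x - m) ∧
        Real.sin x * b₁ =
          Real.sin Φ * (Real.sin c * Real.cos (x - m)) + ε * Real.cos Φ * Real.sin (x - m) ∧
        Real.cos x * Real.cos r + Real.sin x * b₂ = Real.cos c * Real.cos (x - m) := by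
  have hpi := Real.pi_pos
  have hs : 0 < Real.sin r := Real.sin_pos_of_pos_of_lt_pi hr.1 (by linarith [hr.2])
  have hc : 0 < Real.cos r := Real.cos_pos_of_mem_Ioo ⟨by linarith [hr.1], hr.2⟩
  have hsc := Real.sin_sq_add_cos_sq r
  -- By `ho` the direction has no component along the base point, so its meridional part is `β`
  -- times the unit vector `(cos r, -sin r)` in the coordinates 0 and 2. The curve is a meridian
  -- exactly when `b₁ = 0`.
  have e0 : b₀ = (b₀ * Real.cos r - b₂ * Real.sin r) * Real.cos r := by
    linear_combination -b₀ * hsc + Real.sin r * ho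
  have e2 : b₂ = -(b₀ * Real.cos r - b₂ * Real.sin r) * Real.sin r := by
    linear_combination -b₂ * hsc + Real.cos r * ho
  set β := b₀ * Real.cos r - b₂ * Real.sin r
  have hβ : β ^ 2 + b₁ ^ 2 = 1 := by
    have h0 : b₀ ^ 2 = (β * Real.cos r) ^ 2 := by rw [← e0]
    have h2 : b₂ ^ 2 = (-β * Real.sin r) ^ 2 := by rw [← e2]
    linear_combination hn - h0 - h2 - β ^ 2 * hsc
  by_cases h1 : b₁ = 0
  · refine .inl ⟨h1, β, ?_, e0, e2⟩
    rw [h1] at hβ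
    exact mul_self_eq_one_iff.1 (by linarith)
  right
  -- The time `m` at which the height `cos x * cos r + sin x * b₂` is maximal; `R` is this maximum,
  -- so the highest point is at distance `arccos R` from the pole.
  set m := Real.arctan (b₂ / Real.cos r)
  have hm := Real.arctan_mem_Ioo (b₂ / Real.cos r)
  have hcm : 0 < Real.cos m := Real.cos_arctan_pos _
  have hsm : Real.sin m * Real.cos r = b₂ * Real.cos m := by
    have := Real.tan_arctan (b₂ / Real.cos r)
    rw [Real.tan_eq_sin_div_cos, div_eq_div_iff hcm.ne' hc.ne'] at this
    exact this
  have hscm := Real.sin_sq_add_cos_sq m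
  set R := Real.cos r / Real.cos m with hR
  have hR1 : R * Real.cos m = Real.cos r := div_mul_cancel₀ _ hcm.ne'
  have hR2 : R * Real.sin m = b₂ := by
    rw [hR, div_mul_eq_mul_div, div_eq_iff hcm.ne']; linarith
  have hR0 : 0 < R := div_pos hc hcm
  have hb1 : 0 < b₁ ^ 2 := by positivity
  have hRlt : R ^ 2 < 1 := by
    have : R ^ 2 = Real.cos r ^ 2 + b₂ ^ 2 := by
      rw [← hR1, ← hR2]; linear_combination -R ^ 2 * hscm
    rw [this, e2]
    have h2 : 0 < Real.sin r ^ 2 * b₁ ^ 2 := by positivity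
    have h3 : Real.cos r ^ 2 + (-β * Real.sin r) ^ 2 = 1 - Real.sin r ^ 2 * b₁ ^ 2 := by
      linear_combination hsc + Real.sin r ^ 2 * hβ
    linarith
  -- At time `m` the position has horizontal part `(P₀, P₁)` and the velocity is the horizontal unit
  -- vector `(p, q)`. They are orthogonal, so the velocity is a quarter turn from the longitude `Φ`
  -- of the highest point, and `ε` is its sense.
  set p := -Real.sin m * Real.sin r + Real.cos m * b₀
  set q := Real.cos m * b₁
  set P₀ := Real.cos m * Real.sin r + Real.sin m * b₀
  set P₁ := Real.sin m * b₁
  have hP : P₀ ^ 2 + P₁ ^ 2 = 1 - R ^ 2 := by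
    have k1 : Real.cos m * Real.cos r + Real.sin m * b₂ = R := by
      rw [← hR1, ← hR2]; linear_combination R * hscm
    simp only [P₀, P₁]
    rw [← k1]
    linear_combination Real.cos m ^ 2 * hsc + Real.sin m ^ 2 * hn + hscm +
      2 * Real.cos m * Real.sin m * ho
  have hpq2 : -Real.sin m * Real.cos r + Real.cos m * b₂ = 0 := by linarith
  have hpq : p ^ 2 + q ^ 2 = 1 := by
    simp only [p, q]
    linear_combination Real.sin m ^ 2 * hsc + Real.cos m ^ 2 * hn + hscm -
      2 * Real.cos m * Real.sin m * ho -
      (-Real.sin m * Real.cos r + Real.cos m * b₂) * hpq2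
  have hPp : P₀ * p + P₁ * q = 0 := by
    simp only [p, q, P₀, P₁]
    linear_combination -Real.cos m * Real.sin m * hsc + Real.cos m * Real.sin m * hn +
      (Real.cos m ^ 2 - Real.sin m ^ 2) * ho -
      (Real.cos m * Real.cos r + Real.sin m * b₂) * hpq2
  set c := Real.arccos R
  have hR1' : R ≤ 1 := by nlinarith
  have hcc : Real.cos c = R := Real.cos_arccos (by linarith) hR1'
  have hc0 : 0 < c := Real.arccos_pos.2 (by nlinarith)
  have hc1 : c < Real.pi / 2 := Real.arccos_lt_pi_div_two.2 hR0
  have hsinc : 0 < Real.sin c := Real.sin_pos_of_pos_of_lt_pi hc0 (by linarith)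
  have hnorm : ‖(⟨P₀, P₁⟩ : ℂ)‖ = Real.sin c := by
    rw [Complex.norm_def, Complex.normSq_mk, Real.sin_arccos]
    congr 1; linarith
  set Φ := Complex.arg ⟨P₀, P₁⟩
  have hP0 : Real.sin c * Real.cos Φ = P₀ := by
    rw [← hnorm]; exact Complex.norm_mul_cos_arg _
  have hP1 : Real.sin c * Real.sin Φ = P₁ := by
    rw [← hnorm]; exact Complex.norm_mul_sin_arg _
  have hperp : p * Real.cos Φ + q * Real.sin Φ = 0 := by
    have : Real.sin c * (p * Real.cos Φ + q * Real.sin Φ) = 0 := by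
      linear_combination p * hP0 + q * hP1 + hPp
    exact (mul_eq_zero.1 this).resolve_left hsinc.ne'
  have hscΦ := Real.sin_sq_add_cos_sq Φ
  refine ⟨c, ⟨hc0, hc1⟩, m, hm, q * Real.cos Φ - p * Real.sin Φ, Φ, ?_, fun x => ?_⟩
  · apply mul_self_eq_one_iff.1
    linear_combination (p ^ 2 + q ^ 2) * hscΦ + hpq - (p * Real.cos Φ + q * Real.sin Φ) * hperp
  · have hx1 : Real.cos x = Real.cos (x - m) * Real.cos m - Real.sin (x - m) * Real.sin m := by
      rw [← Real.cos_add, sub_add_cancel]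
    have hx2 : Real.sin x = Real.sin (x - m) * Real.cos m + Real.cos (x - m) * Real.sin m := by
      rw [← Real.sin_add, sub_add_cancel]
    have hp : p = -(q * Real.cos Φ - p * Real.sin Φ) * Real.sin Φ := by
      linear_combination -p * hscΦ + Real.cos Φ * hperp
    have hq : q = (q * Real.cos Φ - p * Real.sin Φ) * Real.cos Φ := by
      linear_combination -q * hscΦ + Real.sin Φ * hperp
    refine ⟨?_, ?_, ?_⟩
    · have k : Real.cos x * Real.sin r + Real.sin x * b₀ =
          Real.cos (x - m) * P₀ + Real.sin (x - m) * p := by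
        rw [hx1, hx2]; simp only [P₀, p]; ring
      rw [k]
      linear_combination -Real.cos (x - m) * hP0 + Real.sin (x - m) * hp
    · have k : Real.sin x * b₁ = Real.cos (x - m) * P₁ + Real.sin (x - m) * q := by
        rw [hx2]; simp only [P₁, q]; ring
      rw [k]
      linear_combination -Real.cos (x - m) * hP1 + Real.sin (x - m) * hq
    · rw [hcc, hx1, hx2, ← hR1, ← hR2]
      linear_combination R * Real.cos (x - m) * hscm

theorem eq_right_of_eqOn {X : Type*} [TopologicalSpace X] [T2Space X] {σ τ : ℝ → X} {α β : ℝ}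
    (hαβ : α < β) (hσ : ContinuousAt σ β) (hτ : ContinuousAt τ β) (h : ∀ s ∈ Ioo α β, σ s = τ s) :
    σ β = τ β := by
  have h1 : Filter.Tendsto σ (nhdsWithin β (Iio β)) (nhds (σ β)) := hσ.mono_left nhdsWithin_le_nhds
  have h2 : Filter.Tendsto τ (nhdsWithin β (Iio β)) (nhds (τ β)) := hτ.mono_left nhdsWithin_le_nhds
  refine tendsto_nhds_unique h1 (h2.congr' ?_)
  filter_upwards [Ioo_mem_nhdsLT hαβ] with s hs using (h s hs).symm

theorem eq_left_of_eqOn {X : Type*} [TopologicalSpace X] [T2Space X] {σ τ : ℝ → X} {α β : ℝ}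
    (hαβ : α < β) (hσ : ContinuousAt σ α) (hτ : ContinuousAt τ α) (h : ∀ s ∈ Ioo α β, σ s = τ s) :
    σ α = τ α := by
  have h1 : Filter.Tendsto σ (nhdsWithin α (Ioi α)) (nhds (σ α)) := hσ.mono_left nhdsWithin_le_nhds
  have h2 : Filter.Tendsto τ (nhdsWithin α (Ioi α)) (nhds (τ α)) := hτ.mono_left nhdsWithin_le_nhds
  refine tendsto_nhds_unique h1 (h2.congr' ?_)
  filter_upwards [Ioo_mem_nhdsGT hαβ] with s hs using (h s hs).symm

namespace HemisphereComplex

variable {Q : Type*} [MetricSpace Q] {S : HemisphereComplex Q} {t : ℝ}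

/-- The curve `σ` crosses the open face `f` during the time interval `(a, a + π)`, from the boundary
point of longitude `φ₁` to that of longitude `φ₂`. -/
structure Crossing (S : HemisphereComplex Q) (t : ℝ) (σ : ℝ → Q) (f : S.F) (a φ₁ φ₂ : ℝ) : Prop where
  inside : ∀ s ∈ Ioo a (a + Real.pi), σ s ∈ S.openFace f
  left : σ a = S.rim f φ₁
  right : σ (a + Real.pi) = S.rim f φ₂
  pi_div_le : Real.pi / (1 + t) ≤ |φ₂ - φ₁|
  le_pi : |φ₂ - φ₁| ≤ Real.pi

/-- Unique continuation along a radius, where `m` is the time at the center. The two endpoints, the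
center and the boundary point, are reached by continuity. -/
theorem eq_radius_of_eventually (ht0 : 0 < t) (hlen : ∀ e, (1 + t) * S.len e < Real.pi) {f : S.F}
    {σ : ℝ → Q} (hσ : ∀ u, S.GeodesicAt t σ u) {φ m u₀ δ : ℝ}
    (hu₀ : u₀ ∈ Ioo m (m + Real.pi / 2)) (hδ : 0 < δ)
    (hloc : ∀ s ∈ Ioo (u₀ - δ) (u₀ + δ), σ s = S.pt f (s - m) φ) :
    ∀ s ∈ Icc m (m + Real.pi / 2), σ s = S.pt f (s - m) φ := by
  have hpi := Real.pi_pos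
  have hpatch : ∀ s ∈ Ioo m (m + Real.pi / 2),
      S.patch t f φ 1 (polar (s - m) 0) = S.pt f (s - m) φ := fun s hs => by
    rw [patch_polar ⟨by linarith [hs.1], by linarith [hs.2]⟩ ⟨by linarith, hpi.le⟩]
    simp
  have hopen : ∀ s ∈ Ioo m (m + Real.pi / 2), σ s = S.pt f (s - m) φ := by
    intro s hs
    rw [← hpatch s hs]
    have hδ' : 0 < min δ (min (u₀ - m) (m + Real.pi / 2 - u₀)) :=
      lt_min hδ (lt_min (by linarith [hu₀.1]) (by linarith [hu₀.2]))
    have l1 : min δ (min (u₀ - m) (m + Real.pi / 2 - u₀)) ≤ δ := min_le_left _ _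
    have l2 := (min_le_right δ (min (u₀ - m) (m + Real.pi / 2 - u₀))).trans (min_le_left _ _)
    have l3 := (min_le_right δ (min (u₀ - m) (m + Real.pi / 2 - u₀))).trans (min_le_right _ _)
    refine eq_patch_of_eventually ht0 hlen f φ (.inl rfl) (W := fun s => polar (s - m) 0) ?_ ?_ hσ hu₀
      hδ' ?_ s hs
    · intro s s' h
      rw [sphDist_polar, sub_self, Real.cos_zero, mul_one, ← Real.cos_sub, sub_sub_sub_cancel_right,
        ← Real.cos_abs, Real.arccos_cos (abs_nonneg _) h]
    · intro s hs
      rw [polar_zero, polar_two, Real.cos_zero, mul_one]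
      exact ⟨Real.sin_pos_of_pos_of_lt_pi (by linarith [hs.1]) (by linarith [hs.2]),
        Real.cos_pos_of_mem_Ioo ⟨by linarith [hs.1], by linarith [hs.2]⟩⟩
    · intro s hs
      rw [hloc s ⟨by linarith [hs.1], by linarith [hs.2]⟩,
        hpatch s ⟨by linarith [hs.1], by linarith [hs.2]⟩]
  have hc : Continuous fun s => S.pt f (s - m) φ :=
    continuous_pt f (by fun_prop) (by fun_prop)
  intro s hs
  rcases hs.1.eq_or_lt with h | h
  · rw [← h]
    exact eq_left_of_eqOn (by linarith) ((hσ m).continuousAt ht0 hlen) hc.continuousAt hopen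
  rcases hs.2.eq_or_lt with h' | h'
  · rw [h']
    exact eq_right_of_eqOn (by linarith) ((hσ _).continuousAt ht0 hlen) hc.continuousAt hopen
  · exact hopen s ⟨h, h'⟩

/-- The two radii enclose an angle of at least `π` in the expansion, because the curve is a
geodesic, and at most `(1 + t) * π`, half of the cone angle. Division by `1 + t` gives the bounds in
`Q`. The integer `n` selects the representative of the longitude that realizes this angle. -/
theorem crossing_of_center (ht0 : 0 < t) (hlen : ∀ e, (1 + t) * S.len e < Real.pi) {f : S.F}
    {σ : ℝ → Q} (hσ : ∀ u, S.GeodesicAt t σ u) {m : ℝ} (hm : σ m = S.pt f 0 0) :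
    ∃ φ₁ φ₂, S.Crossing t σ f (m - Real.pi / 2) φ₁ φ₂ := by
  have hpi := Real.pi_pos
  have ht1 : 0 < 1 + t := by linarith
  obtain ⟨δ, hδ, hδρ, a, b, hab, hn⟩ := (coneChart_center ht0 hlen f).germ (hσ m) hm
  obtain ⟨n, hn'⟩ := exists_abs_sub_eq_norm ((1 + t) * (2 * Real.pi)) a b
  have hle := norm_le_half_period (by positivity : 0 < (1 + t) * (2 * Real.pi)) a b
  rw [← hn'] at hle hn
  have h1 : ∀ s ∈ Icc m (m + Real.pi / 2), σ s = S.pt f (s - m) (a / (1 + t)) := by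
    refine eq_radius_of_eventually ht0 hlen hσ (u₀ := m + δ / 2) (δ := δ / 2)
      ⟨by linarith, by linarith⟩ (by linarith) fun s hs => ?_
    have := (hab (s - m) ⟨by linarith [hs.1], by linarith [hs.2]⟩).1
    rwa [add_sub_cancel] at this
  have h2 : ∀ s ∈ Icc (-m) (-m + Real.pi / 2), σ (-s) = S.pt f (s - -m) (b / (1 + t)) := by
    refine eq_radius_of_eventually ht0 hlen (fun u => (hσ (-u)).reverse) (u₀ := -m + δ / 2)
      (δ := δ / 2) ⟨by linarith, by linarith⟩ (by linarith) fun s hs => ?_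
    have := (hab (s - -m) ⟨by linarith [hs.1], by linarith [hs.2]⟩).2
    rwa [show m - (s - -m) = -s by ring] at this
  have h2' : ∀ s ∈ Icc (m - Real.pi / 2) m, σ s = S.pt f (m - s) (b / (1 + t)) := fun s hs => by
    have := h2 (-s) ⟨by linarith [hs.2], by linarith [hs.1]⟩
    rw [neg_neg] at this
    rw [this]; congr 1; ring
  have hdiff : |a / (1 + t) - (b + n * ((1 + t) * (2 * Real.pi))) / (1 + t)| =
      |a - (b + n * ((1 + t) * (2 * Real.pi)))| / (1 + t) := by
    rw [← sub_div, abs_div, abs_of_pos ht1]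
  refine ⟨(b + n * ((1 + t) * (2 * Real.pi))) / (1 + t), a / (1 + t), ?_, ?_, ?_, ?_, ?_⟩
  · intro s hs
    rcases le_total m s with h | h
    · rw [h1 s ⟨h, by linarith [hs.2]⟩]
      exact pt_mem_openFace ⟨by linarith, by linarith [hs.2]⟩ _
    · rw [h2' s ⟨by linarith [hs.1], h⟩]
      exact pt_mem_openFace ⟨by linarith, by linarith [hs.1]⟩ _
  · rw [h2' _ ⟨le_rfl, by linarith⟩, sub_sub_cancel, ← pt_half, ← pt_add_period f _ _ n]
    congr 1
    field_simp
  · rw [h1 _ ⟨by linarith, by linarith⟩, ← pt_half]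
    congr 1
    ring
  · rw [hdiff]
    gcongr
  · rw [hdiff, div_le_iff₀ ht1]
    linarith

/-- Between its two boundary points a great circle that avoids the pole sweeps the longitude `π` in
the expansion, hence exactly `π / (1 + t)` in `Q`. -/
theorem crossing_of_circ (ht0 : 0 < t) (hlen : ∀ e, (1 + t) * S.len e < Real.pi) {f : S.F}
    {σ : ℝ → Q} (hσ : ∀ u, S.GeodesicAt t σ u) {c m φ ε u₀ δ : ℝ} (hc : c ∈ Ioo 0 (Real.pi / 2))
    (hε : ε = 1 ∨ ε = -1) (hu₀ : u₀ ∈ Ioo (m - Real.pi / 2) (m + Real.pi / 2)) (hδ : 0 < δ)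
    (hloc : ∀ s ∈ Ioo (u₀ - δ) (u₀ + δ), σ s = S.patch t f φ ε (circ c (s - m))) :
    ∃ φ₁ φ₂, S.Crossing t σ f (m - Real.pi / 2) φ₁ φ₂ := by
  have hpi := Real.pi_pos
  have ht1 : 0 < 1 + t := by linarith
  have hsc : 0 < Real.sin c := Real.sin_pos_of_pos_of_lt_pi hc.1 (by linarith [hc.2])
  have hcc : 0 < Real.cos c := Real.cos_pos_of_mem_Ioo ⟨by linarith [hc.1], hc.2⟩
  have hpos : ∀ s ∈ Ioo (m - Real.pi / 2) (m + Real.pi / 2),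
      0 < (circ c (s - m) : E3) 0 ∧ 0 < (circ c (s - m) : E3) 2 := fun s hs => by
    have := Real.cos_pos_of_mem_Ioo (x := s - m) ⟨by linarith [hs.1], by linarith [hs.2]⟩
    rw [circ_zero, circ_two]
    exact ⟨mul_pos hsc this, mul_pos hcc this⟩
  have hopen := eq_patch_of_eventually ht0 hlen f φ hε (W := fun s => circ c (s - m))
    (fun s s' h => by
      rw [← sub_sub_sub_cancel_right s s' m] at h ⊢
      exact sphDist_circ c h) hpos hσ hu₀ hδ hloc
  -- The argument of a complex number is continuous off the real axis, which covers the endpoints of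
  -- the half circle, where `sin (s - m) = ±1`.
  have hcont : ∀ s, Real.sin (s - m) ≠ 0 →
      ContinuousAt (fun s => S.patch t f φ ε (circ c (s - m))) s := by
    intro s hs
    have k1 : Continuous fun s => Real.arccos (Real.cos c * Real.cos (s - m)) :=
      Real.continuous_arccos.comp (by fun_prop)
    have k0 : Continuous fun s => (⟨Real.sin c * Real.cos (s - m), Real.sin (s - m)⟩ : ℂ) := by
      have : Continuous fun s => Complex.equivRealProdCLM.symm
          (Real.sin c * Real.cos (s - m), Real.sin (s - m)) :=
        Complex.equivRealProdCLM.symm.continuous.comp (by fun_prop)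
      exact this
    have k2 : ContinuousAt (fun s => longitude (circ c (s - m))) s := by
      have := ContinuousAt.comp (g := Complex.arg)
        (f := fun s => (⟨Real.sin c * Real.cos (s - m), Real.sin (s - m)⟩ : ℂ)) (x := s)
        (Complex.continuousAt_arg (.inr hs)) k0.continuousAt
      exact this
    have k3 : ContinuousAt (fun s => φ + ε * (longitude (circ c (s - m)) / (1 + t))) s := by
      fun_prop
    have k4 := (continuous_pt f continuous_fst continuous_snd : Continuous fun p : ℝ × ℝ =>
      S.pt f p.1 p.2).continuousAt.comp (k1.continuousAt.prodMk k3)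
    exact k4
  have e1 : circ c (m - Real.pi / 2 - m) = polar (Real.pi / 2) (-(Real.pi / 2)) := by
    rw [sub_right_comm, sub_self, zero_sub]
    apply S2.ext_coord <;> simp
  have e2 : circ c (m + Real.pi / 2 - m) = polar (Real.pi / 2) (Real.pi / 2) := by
    rw [add_sub_cancel_left]
    apply S2.ext_coord <;> simp
  refine ⟨φ + ε * (-(Real.pi / 2) / (1 + t)), φ + ε * (Real.pi / 2 / (1 + t)), ?_, ?_, ?_, ?_, ?_⟩
  · intro s hs
    have hs' : s ∈ Ioo (m - Real.pi / 2) (m + Real.pi / 2) := ⟨hs.1, by linarith [hs.2]⟩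
    rw [hopen s hs']
    exact patch_mem_openFace (hpos s hs').2
  · rw [eq_left_of_eqOn (by linarith) ((hσ _).continuousAt ht0 hlen)
      (hcont _ (by simp)) hopen]
    rw [e1, patch_polar ⟨by positivity, le_rfl⟩ ⟨by linarith, by linarith⟩, pt_half]
  · rw [show m - Real.pi / 2 + Real.pi = m + Real.pi / 2 by ring,
      eq_right_of_eqOn (by linarith) ((hσ _).continuousAt ht0 hlen) (hcont _ (by simp)) hopen]
    rw [e2, patch_polar ⟨by positivity, le_rfl⟩ ⟨by linarith, by linarith⟩, pt_half]
  all_goals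
    have hε1 : |ε| = 1 := by rcases hε with h | h <;> simp [h]
    have : φ + ε * (Real.pi / 2 / (1 + t)) - (φ + ε * (-(Real.pi / 2) / (1 + t))) =
        ε * (Real.pi / (1 + t)) := by ring
    rw [this, abs_mul, hε1, one_mul, abs_of_pos (by positivity)]
  rw [div_le_iff₀ ht1]
  nlinarith

/-- In the spherical chart at `σ u` the germ consists of two opposite rays, that is, of a great
circle with initial direction `B`. -/
theorem exists_greatCircle_germ (ht0 : 0 < t) (hlen : ∀ e, (1 + t) * S.len e < Real.pi) {f : S.F}
    {σ : ℝ → Q} {u r φ : ℝ} (hσ : S.GeodesicAt t σ u) (hr : r ∈ Ioo 0 (Real.pi / 2))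
    (hu : σ u = S.pt f r φ) :
    ∃ B : S2, inner ℝ (polar r 0 : E3) (B : E3) = 0 ∧ ∃ δ > 0, ∀ x, |x| < δ → ∀ w : S2,
      (w : E3) = Real.cos x • (polar r 0 : E3) + Real.sin x • (B : E3) →
      σ (u + x) = S.patch t f φ 1 w := by
  have hpi := Real.pi_pos
  obtain ⟨ρ, M, hM, h⟩ := exists_coneChart_patch ht0 hlen f φ (.inl rfl) (w₀ := polar r 0)
    (by simpa using Real.sin_pos_of_pos_of_lt_pi hr.1 (by linarith [hr.2]))
    (by simpa using Real.cos_pos_of_mem_Ioo ⟨by linarith [hr.1], hr.2⟩)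
  have hpt : S.patch t f φ 1 (polar r 0) = S.pt f r φ := by
    rw [patch_polar ⟨hr.1, hr.2.le⟩ ⟨by linarith, hpi.le⟩]; simp
  obtain ⟨δ, hδ, -, a, b, hab, hn⟩ := h.germ hσ (hu.trans hpt.symm)
  have hb : (b : AddCircle (2 * Real.pi)) = ((a - Real.pi : ℝ) : AddCircle (2 * Real.pi)) := by
    rw [AddCircle.coe_sub, ← coe_eq_pi_of_pi_le_norm hn, sub_sub_cancel]
  have hcoe : ∀ v : S2, (mapS2 M v : E3) = M (v : E3) := fun _ => rfl
  refine ⟨mapS2 M (polar (Real.pi / 2) a), ?_, δ, hδ, fun x hx w hw => ?_⟩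
  · rw [← hM, hcoe, hcoe, LinearIsometryEquiv.inner_map_map, inner_polar]
    simp
  have hw' : w = mapS2 M (polar x a) := by
    apply Subtype.ext
    rw [hw, ← hM, hcoe, hcoe, hcoe, ← map_smul, ← map_smul, ← map_add]
    congr 1
    ext i
    fin_cases i <;> simp
  rw [hw']
  rcases le_total 0 x with h0 | h0
  · rw [abs_of_nonneg h0] at hx
    exact (hab x ⟨h0, hx⟩).1
  · rw [abs_of_nonpos h0] at hx
    have h1 := (hab (-x) ⟨by linarith, hx⟩).2
    rw [sub_neg_eq_add] at h1
    rw [h1, h.congr _ hb]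
    congr 2
    apply S2.ext_coord <;> simp [Real.cos_sub_pi, Real.sin_sub_pi]

/-- A geodesic that meets an open face crosses it. -/
theorem exists_crossing (ht0 : 0 < t) (hlen : ∀ e, (1 + t) * S.len e < Real.pi) {f : S.F}
    {σ : ℝ → Q} (hσ : ∀ u, S.GeodesicAt t σ u) {u : ℝ} (hu : σ u ∈ S.openFace f) :
    ∃ a φ₁ φ₂, u ∈ Ioo a (a + Real.pi) ∧ S.Crossing t σ f a φ₁ φ₂ := by
  have hpi := Real.pi_pos
  have ht1 : 0 < 1 + t := by linarith
  obtain ⟨r, hr, φ, hrφ⟩ := mem_openFace_iff.1 hu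
  rcases hr.1.eq_or_lt with h0 | h0
  · rw [← h0, pt_zero f φ 0] at hrφ
    obtain ⟨φ₁, φ₂, h⟩ := crossing_of_center ht0 hlen hσ hrφ
    exact ⟨_, φ₁, φ₂, ⟨by linarith, by linarith⟩, h⟩
  obtain ⟨B, hB, δ, hδ, hloc⟩ := exists_greatCircle_germ ht0 hlen (hσ u) ⟨h0, hr.2⟩ hrφ
  rw [inner_E3] at hB
  simp only [polar_zero, polar_one, polar_two, Real.cos_zero, Real.sin_zero, mul_one, mul_zero,
    zero_mul, add_zero] at hB
  rcases greatCircle_cases ⟨h0, hr.2⟩ B.sq_sum hB with ⟨h1, κ, hκ, hB0, hB2⟩ |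
    ⟨c, hc, m, hm, ε, Φ, hε, hx⟩
  -- A meridian: the curve follows the radius up to the center, which it reaches at time `u - κ *
  -- r`, and the crossing is the one through the center.
  · have hκ1 : |κ| = 1 := by rcases hκ with h | h <;> simp [h]
    have hsin : ∀ x, Real.sin (κ * x) = κ * Real.sin x := fun x => by
      rcases hκ with h | h <;> simp [h]
    have hcos : ∀ x, Real.cos (κ * x) = Real.cos x := fun x => by
      rcases hκ with h | h <;> simp [h]
    have hrad : ∀ x, |x| < min δ (min r (Real.pi / 2 - r)) → σ (u + x) = S.pt f (r + κ * x) φ := by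
      intro x hx
      rw [lt_min_iff, lt_min_iff] at hx
      have hκx : |κ * x| = |x| := by rw [abs_mul, hκ1, one_mul]
      have b1 := abs_lt.1 (hκx.trans_lt hx.2.1)
      have b2 := abs_lt.1 (hκx.trans_lt hx.2.2)
      rw [hloc x hx.1 (polar (r + κ * x) 0), patch_polar ⟨by linarith, by linarith⟩
        ⟨by linarith, hpi.le⟩]
      · simp
      · ext i
        fin_cases i
        · simp [hB0, Real.sin_add, hsin, hcos]; ring
        · simp [h1]
        · simp [hB2, Real.cos_add, hsin, hcos]; ring
    have hδ' : 0 < min δ (min r (Real.pi / 2 - r)) :=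
      lt_min hδ (lt_min h0 (by linarith [hr.2]))
    have hcenter : σ (u - κ * r) = S.pt f 0 0 := by
      rcases hκ with h | h
      · have := eq_radius_of_eventually ht0 hlen hσ (f := f) (φ := φ) (m := u - r) (u₀ := u)
          ⟨by linarith, by linarith [hr.2]⟩ hδ' (fun s hs => by
            have := hrad (s - u) (by rw [abs_lt]; constructor <;> linarith [hs.1, hs.2])
            rw [add_sub_cancel, h] at this
            rw [this]; congr 1; ring) (u - r) ⟨le_rfl, by linarith⟩
        rw [h, one_mul, this, sub_self, pt_zero f φ 0]
      · have := eq_radius_of_eventually ht0 hlen (fun u => (hσ (-u)).reverse) (f := f) (φ := φ)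
          (m := -u - r) (u₀ := -u) ⟨by linarith, by linarith [hr.2]⟩ hδ' (fun s hs => by
            have := hrad (-s - u) (by rw [abs_lt]; constructor <;> linarith [hs.1, hs.2])
            rw [add_sub_cancel, h] at this
            rw [this]; congr 1; ring) (-u - r) ⟨le_rfl, by linarith⟩
        rw [sub_self, pt_zero f φ 0] at this
        rw [← this, h]
        congr 1; ring
    obtain ⟨φ₁, φ₂, hcr⟩ := crossing_of_center ht0 hlen hσ hcenter
    refine ⟨_, φ₁, φ₂, ?_, hcr⟩
    have hr2 := hr.2
    rcases hκ with h | h <;> rw [h] <;> constructor <;> linarith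
  · -- longitude and distance from the pole along the normal form
    have hεε : ε * ε = 1 := by rcases hε with h | h <;> simp [h]
    have hcosε : ∀ x, Real.cos (ε * x) = Real.cos x := fun x => by
      rcases hε with h | h <;> simp [h]
    have hsinε : ∀ x, Real.sin (ε * x) = ε * Real.sin x := fun x => by
      rcases hε with h | h <;> simp [h]
    have hsc : 0 < Real.sin c := Real.sin_pos_of_pos_of_lt_pi hc.1 (by linarith [hc.2])
    have hcc : 0 < Real.cos c := Real.cos_pos_of_mem_Ioo ⟨by linarith [hc.1], hc.2⟩
    have hfw : ∀ y ∈ Ioo (-(Real.pi / 2)) (Real.pi / 2), Forward (circ c y) := fun y hy => by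
      have := Real.cos_pos_of_mem_Ioo hy
      exact ⟨by rw [circ_zero]; positivity, by rw [circ_two]; positivity⟩
    have hw : ∀ x, (polar (Real.arccos ((circ c (x - m) : E3) 2))
        (Φ + ε * longitude (circ c (x - m))) : E3) =
        Real.cos x • (polar r 0 : E3) + Real.sin x • (B : E3) := by
      intro x
      have hp := polar_longitude (circ c (x - m))
      have p0 := congrArg (fun w : S2 => (w : E3) 0) hp
      have p1 := congrArg (fun w : S2 => (w : E3) 1) hp
      have p2 := congrArg (fun w : S2 => (w : E3) 2) hp
      simp only [polar_zero, polar_one, polar_two, circ_zero, circ_one] at p0 p1 p2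
      obtain ⟨x0, x1, x2⟩ := hx x
      ext i
      fin_cases i
      · simp only [Fin.zero_eta, polar_zero, PiLp.add_apply, PiLp.smul_apply, smul_eq_mul,
          Real.cos_zero, mul_one]
        rw [x0, ← p0, Real.cos_add, hcosε, hsinε]
        linear_combination -ε * Real.sin Φ * p1
      · simp only [Fin.mk_one, polar_one, PiLp.add_apply, PiLp.smul_apply, smul_eq_mul,
          Real.sin_zero, mul_zero, zero_add]
        rw [x1, ← p0, Real.sin_add, hcosε, hsinε]
        linear_combination ε * Real.cos Φ * p1
      · simp only [Fin.reduceFinMk, polar_two, PiLp.add_apply, PiLp.smul_apply, smul_eq_mul]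
        rw [x2, p2, circ_two]
    have hm0 : 0 - m ∈ Ioo (-(Real.pi / 2)) (Real.pi / 2) := ⟨by linarith [hm.2], by linarith [hm.1]⟩
    -- The normal form reaches longitude `0` at time `u` only up to `n` full turns. These must be
    -- removed, because `patch` divides longitudes by `1 + t` and so does not respect full turns.
    obtain ⟨n, hn⟩ : ∃ n : ℤ, Φ + ε * longitude (circ c (0 - m)) = 0 + n * (2 * Real.pi) := by
      have h1 := hw 0
      rw [Real.cos_zero, Real.sin_zero, one_smul, zero_smul, add_zero] at h1
      have h2 : hemi ⟨_, Ioc_subset_Icc_self (hfw _ hm0).arccos_mem⟩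
          (Φ + ε * longitude (circ c (0 - m))) = hemi ⟨r, h0.le, hr.2.le⟩ 0 :=
        Subtype.ext (Subtype.ext h1)
      rw [hemi_eq_iff] at h2
      exact h2.2.resolve_left (hfw _ hm0).arccos_mem.1.ne'
    set δ' := min δ (min (Real.pi / 2 + m) (Real.pi / 2 - m))
    have hδ' : 0 < δ' := lt_min hδ (lt_min (by linarith [hm.1]) (by linarith [hm.2]))
    have hδ1 : δ' ≤ δ := min_le_left _ _
    have hδ2 : δ' ≤ Real.pi / 2 + m := (min_le_right _ _).trans (min_le_left _ _)
    have hδ3 : δ' ≤ Real.pi / 2 - m := (min_le_right _ _).trans (min_le_right _ _)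
    obtain ⟨φ₁, φ₂, hcr⟩ := crossing_of_circ ht0 hlen hσ (f := f) (m := u + m)
      (φ := φ + (Φ - n * (2 * Real.pi)) / (1 + t)) (u₀ := u) hc hε
      ⟨by linarith [hm.2], by linarith [hm.1]⟩ hδ' (fun s hs => by
        have hx : |s - u| < δ := by rw [abs_lt]; constructor <;> linarith [hs.1, hs.2]
        have hy : s - u - m ∈ Ioo (-(Real.pi / 2)) (Real.pi / 2) :=
          ⟨by linarith [hs.1], by linarith [hs.2]⟩
        have hl := abs_lt.1 (hfw _ hy).abs_longitude
        have hl0 := abs_lt.1 (hfw _ hm0).abs_longitude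
        have k1 := hloc (s - u) hx _ (hw (s - u))
        have k2 : polar (Real.arccos ((circ c (s - u - m) : E3) 2))
            (Φ + ε * longitude (circ c (s - u - m))) =
            polar (Real.arccos ((circ c (s - u - m) : E3) 2))
            (Φ - n * (2 * Real.pi) + ε * longitude (circ c (s - u - m))) := by
          have : Φ - n * (2 * Real.pi) + ε * longitude (circ c (s - u - m)) =
              Φ + ε * longitude (circ c (s - u - m)) - n * (2 * Real.pi) := by ring
          rw [this]
          apply S2.ext_coord <;> simp only [polar_zero, polar_one, polar_two,
            Real.cos_sub_int_mul_two_pi, Real.sin_sub_int_mul_two_pi]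
        rw [add_sub_cancel, k2, patch_polar (hfw _ hy).arccos_mem (by
          have : Φ - n * (2 * Real.pi) = -(ε * longitude (circ c (0 - m))) := by linarith
          rw [this]
          rcases hε with h | h <;> rw [h] <;> constructor <;> linarith)] at k1
        rw [k1, ← sub_sub, patch]
        congr 1
        ring)
    refine ⟨_, φ₁, φ₂, ⟨by linarith [hm.2], by linarith [hm.1]⟩, hcr⟩

end HemisphereComplex

end Spherical

namespace Spherical

namespace HemisphereComplex

variable {Q : Type*} [MetricSpace Q] {S : HemisphereComplex Q} {t : ℝ}

/-! ### Geodesics near the skeleton -/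

/-- A geodesic that leaves an open face does not return to this face immediately. -/
theorem GeodesicAt.exit (ht0 : 0 < t) (hlen : ∀ e, (1 + t) * S.len e < Real.pi)
    (hQ : Nonempty (Q ≃ₜ S2)) {σ : ℝ → Q} {u : ℝ} (hσ : S.GeodesicAt t σ u) (hu : σ u ∈ S.skel)
    {g : S.F} {r : ℝ} (hr : 0 < r) (hin : ∀ x ∈ Ioo 0 r, σ (u - x) ∈ S.openFace g) :
    ∃ δ > 0, ∀ x ∈ Ioo 0 δ, σ (u + x) ∉ range (S.face g) := by
  have hpi := Real.pi_pos
  obtain ⟨lc⟩ := exists_linkCycle (len_lt_pi_of_expansion ht0 hlen) hQ hu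
  have h := lc.coneChart ht0 hlen
  obtain ⟨δ, hδ, hδρ, a, b, hab, hn⟩ := h.germ hσ rfl
  have hρ0 := h.ρ_pos
  have hρ := h.ρ_le
  refine ⟨δ, hδ, fun x hx hg => ?_⟩
  rw [(hab x ⟨hx.1.le, hx.2⟩).1] at hg
  obtain ⟨j, ψ, hψ, hj, -, ha⟩ := lc.exists_sec ht0 ⟨hx.1.le, by linarith [hx.2]⟩ hg
  replace ha := ha.resolve_left hx.1.ne'
  have hz : 0 < min δ r / 2 := half_pos (lt_min hδ hr)
  have hzδ : min δ r / 2 < δ := by linarith [min_le_left δ r]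
  have hzr : min δ r / 2 < r := by linarith [min_le_right δ r]
  set z := min δ r / 2
  have hz1 : z ∈ Ico 0 (lc.rad t) := ⟨hz.le, by linarith⟩
  have hz2 := (lc.mem_of_lt_rad ht0 hz1).1
  have hg' := hin z ⟨hz, hzr⟩
  rw [(hab z ⟨hz.le, hzδ⟩).2] at hg'
  obtain ⟨j', ψ', hψ', hj', hsec, hb⟩ := lc.exists_sec ht0 hz1 (openFace_subset g hg')
  replace hb := hb.resolve_left hz.ne'
  rw [hsec] at hg'
  have h0 : 0 < ψ' := lt_of_le_of_ne hψ'.1 fun h0 => by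
    rw [← h0, lc.sec_zero_right hz2] at hg'
    exact rim_mem_skel _ _ g hg'
  have h1 : ψ' < Real.pi := lt_of_le_of_ne hψ'.2 fun h1 => by
    rw [h1, lc.sec_pi hz2] at hg'
    exact rim_mem_skel _ _ g hg'
  -- Both rays of the germ would lie in the sector of `g`, which is unique up to the period. The
  -- incoming ray is strictly inside it, so the angle would be less than `π`.
  obtain ⟨n, hn'⟩ := lc.inj _ _ (hj.trans hj'.symm)
  have hjj : (j : ℝ) = j' + lc.k * n := by
    have : j = j' + lc.k * n := by omega
    exact_mod_cast this
  have ha' : (a : AddCircle (lc.k * Real.pi)) = ((j' * Real.pi + ψ : ℝ) : AddCircle _) := by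
    rw [← coe_add_int_mul _ (j' * Real.pi + ψ) n, ← ha, hjj]
    congr 1; ring
  rw [ha', ← hb] at hn
  have h3 := hn.trans (norm_coe_sub_le _ _ _)
  rw [add_sub_add_left_eq_sub] at h3
  have h4 : |ψ - ψ'| < Real.pi := by
    rw [abs_lt]; constructor <;> linarith [hψ.1, hψ.2]
  linarith

theorem GeodesicAt.exit_reverse (ht0 : 0 < t) (hlen : ∀ e, (1 + t) * S.len e < Real.pi)
    (hQ : Nonempty (Q ≃ₜ S2)) {σ : ℝ → Q} {u : ℝ} (hσ : S.GeodesicAt t σ u) (hu : σ u ∈ S.skel)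
    {g : S.F} {r : ℝ} (hr : 0 < r) (hin : ∀ x ∈ Ioo 0 r, σ (u + x) ∈ S.openFace g) :
    ∃ δ > 0, ∀ x ∈ Ioo 0 δ, σ (u - x) ∉ range (S.face g) := by
  have h1 : S.GeodesicAt t (fun s => σ (-s)) (-u) := GeodesicAt.reverse (by rwa [neg_neg])
  obtain ⟨δ, hδ, h⟩ := h1.exit ht0 hlen hQ (by rwa [neg_neg]) hr (g := g) fun x hx => by
    rw [neg_sub, sub_neg_eq_add, add_comm]; exact hin x hx
  refine ⟨δ, hδ, fun x hx => ?_⟩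
  have := h x hx
  rwa [neg_add, neg_neg, ← sub_eq_add_neg] at this

/-- A geodesic in the skeleton follows an edge. -/
theorem GeodesicAt.exists_edge (ht0 : 0 < t) (hlen : ∀ e, (1 + t) * S.len e < Real.pi)
    (hQ : Nonempty (Q ≃ₜ S2)) {σ : ℝ → Q} {u : ℝ} (hσ : S.GeodesicAt t σ u) {r : ℝ} (hr : 0 < r)
    (hin : ∀ x ∈ Ico 0 r, σ (u + x) ∈ S.skel) :
    ∃ (e : S.E) (v τ δ : ℝ), 0 < δ ∧ (τ = 1 ∨ τ = -1) ∧
      ∀ x ∈ Icc 0 δ, v + τ * x ∈ Icc 0 (S.len e) ∧ σ (u + (1 + t) * x) = S.edge e (v + τ * x) := by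
  have ht1 : 0 < 1 + t := by linarith
  have hu : σ u ∈ S.skel := by simpa using hin 0 ⟨le_rfl, hr⟩
  obtain ⟨lc⟩ := exists_linkCycle (len_lt_pi_of_expansion ht0 hlen) hQ hu
  have h := lc.coneChart ht0 hlen
  have hρ0 := h.ρ_pos
  obtain ⟨δ, hδ, hδρ, a, b, hab, -⟩ := h.germ hσ rfl
  have hz : 0 < min δ r / 2 := half_pos (lt_min hδ hr)
  have hzδ : min δ r / 2 < δ := by linarith [min_le_left δ r]
  have hzr : min δ r / 2 < r := by linarith [min_le_right δ r]
  set z := min δ r / 2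
  have hz' := hin z ⟨hz.le, hzr⟩
  rw [(hab z ⟨hz.le, hzδ⟩).1] at hz'
  -- In the chart the `1`-skeleton consists of the rays at multiples of `π`; the ray at `j * π` is
  -- the edge between the faces `j - 1` and `j`.
  have ha := lc.eq_mul_pi_of_mem_skel ⟨hz, by linarith⟩ hz'
  set j := ⌊a / Real.pi⌋
  obtain ⟨e, v, τ, hτ, hv, hin', hedge, -⟩ := lc.edges (j - 1)
  refine ⟨e, v, τ, z / (1 + t), by positivity, hτ, fun x hx => ?_⟩
  have hx1 : (1 + t) * x ≤ z := by rw [mul_comm]; exact (le_div_iff₀ ht1).1 hx.2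
  have hx0 : 0 ≤ (1 + t) * x := mul_nonneg ht1.le hx.1
  have hxr : (1 + t) * x ∈ Ico 0 (lc.rad t) := ⟨hx0, by linarith⟩
  have hxη := (lc.mem_of_lt_rad ht0 hxr).2
  rw [mul_div_cancel_left₀ _ ht1.ne'] at hxη
  constructor
  · rcases hx.1.eq_or_lt with h0 | h0
    · rw [← h0, mul_zero, add_zero]; exact hv
    · exact Ioo_subset_Icc_self (hin' x ⟨h0, hxη.2⟩)
  · have hg := lc.glue (j - 1) x hxη
    rw [sub_add_cancel] at hg
    rw [(hab _ ⟨hx0, by linarith⟩).1, ha, lc.chart_int_mul_pi ht0 hxr, mul_div_cancel_left₀ _ ht1.ne',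
      ← hg, hedge x hxη]

theorem GeodesicAt.exists_edge_reverse (ht0 : 0 < t) (hlen : ∀ e, (1 + t) * S.len e < Real.pi)
    (hQ : Nonempty (Q ≃ₜ S2)) {σ : ℝ → Q} {u : ℝ} (hσ : S.GeodesicAt t σ u) {r : ℝ} (hr : 0 < r)
    (hin : ∀ x ∈ Ico 0 r, σ (u - x) ∈ S.skel) :
    ∃ (e : S.E) (v τ δ : ℝ), 0 < δ ∧ (τ = 1 ∨ τ = -1) ∧
      ∀ x ∈ Icc 0 δ, v + τ * x ∈ Icc 0 (S.len e) ∧ σ (u - (1 + t) * x) = S.edge e (v + τ * x) := by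
  have h1 : S.GeodesicAt t (fun s => σ (-s)) (-u) := GeodesicAt.reverse (by rwa [neg_neg])
  obtain ⟨e, v, τ, δ, hδ, hτ, h⟩ := h1.exists_edge ht0 hlen hQ hr fun x hx => by
    rw [neg_add, neg_neg, ← sub_eq_add_neg]; exact hin x hx
  refine ⟨e, v, τ, δ, hδ, hτ, fun x hx => ?_⟩
  have := h x hx
  rwa [neg_add, neg_neg, ← sub_eq_add_neg] at this

theorem GeodesicAt.exists_ne {σ : ℝ → Q} {u : ℝ} (hσ : S.GeodesicAt t σ u) :
    ∃ δ > 0, ∀ x ∈ Ioo 0 δ, σ (u - x) ≠ σ (u + x) := by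
  obtain ⟨r, hr, h⟩ := hσ
  refine ⟨r, hr, fun x hx heq => ?_⟩
  have := h (u - x) ⟨by linarith [hx.2], by linarith [hx.1]⟩ (u + x)
    ⟨by linarith [hx.1], by linarith [hx.2]⟩
  rw [heq, dist_self, eq_comm, abs_eq_zero] at this
  linarith [hx.1]

/-- The closed curve obtained by closing up a path in the `1`-skeleton. -/
theorem edgeLoop_of_path {τ : ℝ → Q} {T : ℝ} (hT : 0 < T) (h0 : τ 0 = τ T)
    (right : ∀ s ∈ Ico 0 T, ∃ (e : S.E) (v κ δ : ℝ), 0 < δ ∧ (κ = 1 ∨ κ = -1) ∧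
      ∀ x ∈ Icc 0 δ, v + κ * x ∈ Icc 0 (S.len e) ∧ τ (s + x) = S.edge e (v + κ * x))
    (left : ∀ s ∈ Ioc 0 T, ∃ (e : S.E) (v κ δ : ℝ), 0 < δ ∧ (κ = 1 ∨ κ = -1) ∧
      ∀ x ∈ Icc 0 δ, v + κ * x ∈ Icc 0 (S.len e) ∧ τ (s - x) = S.edge e (v + κ * x))
    (turn : ∀ s ∈ Ioo 0 T, ∃ δ > 0, ∀ x ∈ Ioo 0 δ, τ (s - x) ≠ τ (s + x))
    (close : ∃ δ > 0, ∀ x ∈ Ioo 0 δ, τ (T - x) ≠ τ x) :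
    S.EdgeLoop (fun s => τ (toIcoMod hT 0 s)) T := by
  set σ : ℝ → Q := fun s => τ (toIcoMod hT 0 s)
  have hper : Function.Periodic σ T := fun s => by
    simp only [σ, toIcoMod_add_right]
  have hσ : ∀ s ∈ Icc 0 T, σ s = τ s := fun s hs => by
    rcases hs.2.eq_or_lt with h | h
    · have : σ (0 + T) = σ 0 := hper 0
      rw [zero_add] at this
      rw [h, this, ← h0]
      simp only [σ]
      rw [(toIcoMod_eq_self hT).2 ⟨le_rfl, by linarith⟩]
    · simp only [σ]
      rw [(toIcoMod_eq_self hT).2 ⟨hs.1, by linarith⟩]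
  have hshift : ∀ s, ∃ s₀ ∈ Ico 0 T, ∀ x, σ (s + x) = σ (s₀ + x) := fun s => by
    have hm := toIcoMod_mem_Ico hT 0 s
    rw [zero_add] at hm
    refine ⟨_, hm, fun x => ?_⟩
    have h1 := toIcoMod_add_toIcoDiv_zsmul hT 0 s
    conv_lhs => rw [← h1]
    rw [add_right_comm]
    exact hper.zsmul _ _
  have hshift' : ∀ s, ∃ s₀ ∈ Ioc 0 T, ∀ x, σ (s + x) = σ (s₀ + x) := fun s => by
    obtain ⟨s₀, hs₀, h⟩ := hshift s
    rcases hs₀.1.eq_or_lt with h1 | h1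
    · refine ⟨T, ⟨hT, le_rfl⟩, fun x => ?_⟩
      rw [h, ← h1, zero_add, add_comm, hper]
    · exact ⟨s₀, ⟨h1, hs₀.2.le⟩, h⟩
  refine ⟨hT, hper, fun s => ?_, fun s => ?_, fun s ε hε => ?_⟩
  · obtain ⟨s₀, hs₀, h⟩ := hshift s
    obtain ⟨e, v, κ, δ, hδ, hκ, hx⟩ := right s₀ hs₀
    refine ⟨e, v, κ, min δ (T - s₀), lt_min hδ (by linarith [hs₀.2]), hκ, fun x h1 => ?_⟩
    have h2 := le_min_iff.1 h1.2
    rw [h, hσ _ ⟨by linarith [hs₀.1, h1.1], by linarith⟩]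
    exact hx x ⟨h1.1, h2.1⟩
  · obtain ⟨s₀, hs₀, h⟩ := hshift' s
    obtain ⟨e, v, κ, δ, hδ, hκ, hx⟩ := left s₀ hs₀
    refine ⟨e, v, κ, min δ s₀, lt_min hδ hs₀.1, hκ, fun x h1 => ?_⟩
    have h2 := le_min_iff.1 h1.2
    rw [sub_eq_add_neg, h, ← sub_eq_add_neg, hσ _ ⟨by linarith, by linarith [hs₀.2, h1.1]⟩]
    exact hx x ⟨h1.1, h2.1⟩
  · obtain ⟨s₀, hs₀, h⟩ := hshift s
    rcases hs₀.1.eq_or_lt with h1 | h1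
    · obtain ⟨δ, hδ, hx⟩ := close
      have h3 : 0 < min ε (min δ T) := by positivity
      have h4 : min ε (min δ T) ≤ ε := min_le_left _ _
      have h5 : min ε (min δ T) ≤ δ := (min_le_right _ _).trans (min_le_left _ _)
      have h6 : min ε (min δ T) ≤ T := (min_le_right _ _).trans (min_le_right _ _)
      refine ⟨min ε (min δ T) / 2, ⟨by linarith, by linarith⟩, ?_⟩
      have k1 := h (-(min ε (min δ T) / 2))
      rw [← h1, zero_add, ← hper (-(min ε (min δ T) / 2)), neg_add_eq_sub, ← sub_eq_add_neg] at k1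
      rw [k1, h, ← h1, zero_add, hσ _ ⟨by linarith, by linarith⟩, hσ _ ⟨by linarith, by linarith⟩]
      exact hx _ ⟨by linarith, by linarith⟩
    · obtain ⟨δ, hδ, hx⟩ := turn s₀ ⟨h1, hs₀.2⟩
      have h2 : 0 < T - s₀ := by linarith [hs₀.2]
      have h3 : 0 < min ε (min δ (min s₀ (T - s₀))) := by positivity
      set z := min ε (min δ (min s₀ (T - s₀)))
      have h4 : z ≤ ε := min_le_left _ _
      have h5 : z ≤ δ := (min_le_right _ _).trans (min_le_left _ _)
      have h6 : z ≤ s₀ := (min_le_right _ _).trans ((min_le_right _ _).trans (min_le_left _ _))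
      have h7 : z ≤ T - s₀ := (min_le_right _ _).trans ((min_le_right _ _).trans (min_le_right _ _))
      refine ⟨z / 2, ⟨by linarith, by linarith⟩, ?_⟩
      rw [sub_eq_add_neg, h, h, ← sub_eq_add_neg, hσ _ ⟨by linarith, by linarith⟩,
        hσ _ ⟨by linarith, by linarith⟩]
      exact hx _ ⟨by linarith, by linarith⟩

/-! ### Closed geodesics -/

/-- A closed geodesic in the skeleton. -/
theorem two_pi_le_of_skel (hS : S.IsIdeallyAdmissible) (ht0 : 0 < t)
    (hlen : ∀ e, (1 + t) * S.len e < Real.pi) {σ : ℝ → Q} (hσ : ∀ u, S.GeodesicAt t σ u) {L : ℝ}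
    (hL : 0 < L) (hper : Function.Periodic σ L) (hskel : ∀ s, σ s ∈ S.skel) :
    (1 + t) * (2 * Real.pi) ≤ L := by
  have ht1 : 0 < 1 + t := by linarith
  -- Edges are stretched by `1 + t` in the expansion; undoing this gives arc length in `Q`.
  have h : S.EdgeLoop (fun s => σ ((1 + t) * s)) (L / (1 + t)) := by
    refine ⟨by positivity, fun s => ?_, fun s => ?_, fun s => ?_, fun s ε hε => ?_⟩
    · rw [mul_add, mul_div_cancel₀ _ ht1.ne', hper]
    · simp only [mul_add]
      exact (hσ _).exists_edge ht0 hlen hS.sphere one_pos fun x _ => hskel _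
    · simp only [mul_sub]
      exact (hσ _).exists_edge_reverse ht0 hlen hS.sphere one_pos fun x _ => hskel _
    · obtain ⟨δ, hδ, hx⟩ := (hσ ((1 + t) * s)).exists_ne
      have h0 : 0 < min ε (δ / (1 + t)) := by positivity
      have h1 : min ε (δ / (1 + t)) ≤ ε := min_le_left _ _
      have h2 : min ε (δ / (1 + t)) ≤ δ / (1 + t) := min_le_right _ _
      refine ⟨min ε (δ / (1 + t)) / 2, ⟨by linarith, by linarith⟩, ?_⟩
      simp only [mul_sub, mul_add]
      refine hx _ ⟨by positivity, ?_⟩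
      rw [mul_comm, ← lt_div_iff₀ ht1]
      linarith
  have := h.two_pi_le hS
  rw [le_div_iff₀ ht1] at this
  linarith

/-- A closed geodesic that crosses a single face. -/
theorem two_pi_lt_of_crossing (hS : S.IsIdeallyAdmissible) (ht0 : 0 < t)
    (hlen : ∀ e, (1 + t) * S.len e < Real.pi) {σ : ℝ → Q} (hσ : ∀ u, S.GeodesicAt t σ u) {L : ℝ}
    (hL : Real.pi < L) (hper : Function.Periodic σ L) {f : S.F} {a φ₁ φ₂ : ℝ}
    (hc : S.Crossing t σ f a φ₁ φ₂) (hskel : ∀ s ∈ Icc (a + Real.pi) (a + L), σ s ∈ S.skel) :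
    2 * Real.pi < L := by
  have hpi := Real.pi_pos
  have ht1 : 0 < 1 + t := by linarith
  have hlen' := hS.len_lt_pi
  by_contra! hL2
  set D := |φ₂ - φ₁| with hD
  have hD0 : 0 < D := lt_of_lt_of_le (by positivity) hc.pi_div_le
  have hD1 : D ≤ Real.pi := hc.le_pi
  obtain ⟨κ, hκ, hφ⟩ : ∃ κ : ℝ, (κ = 1 ∨ κ = -1) ∧ φ₂ = φ₁ + κ * D := by
    rcases abs_choice (φ₂ - φ₁) with h | h
    · exact ⟨1, .inl rfl, by rw [hD, h]; ring⟩
    · exact ⟨-1, .inr rfl, by rw [hD, h]; ring⟩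
  have hκ1 : |κ| = 1 := by rcases hκ with h | h <;> simp [h]
  have hκ' : -κ = 1 ∨ -κ = -1 := by rcases hκ with h | h <;> simp [h]
  -- The crossing, of length `π`, is replaced by the boundary arc of `f` of length `D ≤ π` with the
  -- same endpoints; the rest of the curve is rescaled to arc length in `Q`. If `L ≤ 2π`, the new
  -- loop is shorter than `2π`.
  set T := D + (L - Real.pi) / (1 + t) with hT
  have hLT : 0 < (L - Real.pi) / (1 + t) := div_pos (by linarith) ht1
  have hTe : (1 + t) * (T - D) = L - Real.pi := by
    rw [hT, add_sub_cancel_left, mul_div_cancel₀ _ ht1.ne']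
  have hσL : σ (a + L) = σ a := hper a
  let τ : ℝ → Q := fun s =>
    if s ≤ D then S.rim f (φ₁ + κ * s) else σ (a + Real.pi + (1 + t) * (s - D))
  have hτ1 : ∀ s ≤ D, τ s = S.rim f (φ₁ + κ * s) := fun s hs => if_pos hs
  have hτ2 : ∀ s, D ≤ s → τ s = σ (a + Real.pi + (1 + t) * (s - D)) := fun s hs => by
    rcases hs.eq_or_lt with h | h
    · rw [← h, hτ1 D le_rfl, ← hφ, sub_self, mul_zero, add_zero, hc.right]
    · exact if_neg (by linarith)
  have hscale : ∀ s ∈ Icc D T, a + Real.pi + (1 + t) * (s - D) ∈ Icc (a + Real.pi) (a + L) :=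
    fun s hs => by
      have h1 : 0 ≤ (1 + t) * (s - D) := mul_nonneg ht1.le (by linarith [hs.1])
      have h2 : (1 + t) * (s - D) ≤ (1 + t) * (T - D) :=
        mul_le_mul_of_nonneg_left (by linarith [hs.2]) ht1.le
      constructor <;> linarith
  -- Just after and just before the crossing the geodesic is outside the closed face `f`, so the
  -- loop does not backtrack where the boundary arc is inserted.
  have hout : ∃ δ > 0, ∀ x ∈ Ioo 0 δ, σ (a + Real.pi + x) ∉ range (S.face f) :=
    (hσ _).exit ht0 hlen hS.sphere (hc.right ▸ rim_mem_skel _ _) hpi fun x hx =>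
      hc.inside _ ⟨by linarith [hx.2], by linarith [hx.1]⟩
  have hinn : ∃ δ > 0, ∀ x ∈ Ioo 0 δ, σ (a - x) ∉ range (S.face f) :=
    (hσ _).exit_reverse ht0 hlen hS.sphere (hc.left ▸ rim_mem_skel _ _) hpi fun x hx =>
      hc.inside _ ⟨by linarith [hx.1], by linarith [hx.2]⟩
  have hloop := edgeLoop_of_path (S := S) (τ := τ) (T := T) (by linarith) ?_ ?_ ?_ ?_ ?_
  · have h1 := hloop.two_pi_le hS
    have h2 : (L - Real.pi) / (1 + t) < Real.pi := by
      rw [div_lt_iff₀ ht1]; nlinarith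
    linarith
  · rw [hτ1 0 hD0.le, hτ2 T (by linarith), hTe, mul_zero, add_zero,
      show a + Real.pi + (L - Real.pi) = a + L by ring, hσL, hc.left]
  · intro s hs
    rcases lt_or_ge s D with h | h
    · obtain ⟨e, v, κ', η, -, -, -, -, hη, hκ'', -, hv, hin, hrim, -⟩ :=
        exists_neighbour hlen' f (φ₁ + κ * s) hκ
      refine ⟨e, v, κ', min η (D - s), lt_min hη (by linarith), hκ'', fun x hx => ?_⟩
      have h2 := le_min_iff.1 hx.2
      refine ⟨?_, ?_⟩
      · rcases hx.1.eq_or_lt with h0 | h0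
        · rw [← h0, mul_zero, add_zero]; exact hv
        · exact Ioo_subset_Icc_self (hin x ⟨h0, h2.1⟩)
      · rw [hτ1 _ (by linarith), ← hrim x ⟨hx.1, h2.1⟩]
        congr 1; ring
    · have hr : 0 < (1 + t) * (T - s) := mul_pos ht1 (by linarith [hs.2])
      obtain ⟨e, v, κ', η, hη, hκ'', hx⟩ :=
        (hσ (a + Real.pi + (1 + t) * (s - D))).exists_edge ht0 hlen hS.sphere hr fun x hx =>
          hskel _ ⟨by linarith [(hscale s ⟨h, hs.2.le⟩).1, hx.1], by nlinarith [hx.2]⟩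
      refine ⟨e, v, κ', η, hη, hκ'', fun x hx' => ⟨(hx x hx').1, ?_⟩⟩
      rw [← (hx x hx').2, hτ2 _ (by linarith [hx'.1])]
      congr 1; ring
  · intro s hs
    rcases le_or_gt s D with h | h
    · obtain ⟨e, v, κ', η, -, -, -, -, hη, hκ'', -, hv, hin, hrim, -⟩ :=
        exists_neighbour hlen' f (φ₁ + κ * s) hκ'
      refine ⟨e, v, κ', η, hη, hκ'', fun x hx => ⟨?_, ?_⟩⟩
      · rcases hx.1.eq_or_lt with h0 | h0
        · rw [← h0, mul_zero, add_zero]; exact hv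
        · exact Ioo_subset_Icc_self (hin x ⟨h0, hx.2⟩)
      · rw [hτ1 _ (by linarith [hx.1]), ← hrim x hx]
        congr 1; ring
    · have hr : 0 < (1 + t) * (s - D) := mul_pos ht1 (by linarith)
      obtain ⟨e, v, κ', η, hη, hκ'', hx⟩ :=
        (hσ (a + Real.pi + (1 + t) * (s - D))).exists_edge_reverse ht0 hlen hS.sphere hr fun x hx =>
          hskel _ ⟨by linarith [hx.2], by linarith [(hscale s ⟨h.le, hs.2⟩).2, hx.1]⟩
      refine ⟨e, v, κ', min η (s - D), lt_min hη (by linarith), hκ'', fun x hx' => ?_⟩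
      have h2 := le_min_iff.1 hx'.2
      obtain ⟨h3, h4⟩ := hx x ⟨hx'.1, h2.1⟩
      refine ⟨h3, ?_⟩
      rw [← h4, hτ2 _ (by linarith)]
      congr 1; ring
  · intro s hs
    rcases lt_trichotomy s D with h | h | h
    · refine ⟨min (D - s) Real.pi, lt_min (by linarith) hpi, fun x hx heq => ?_⟩
      have h2 := lt_min_iff.1 hx.2
      rw [hτ1 _ (by linarith [hx.1]), hτ1 _ (by linarith)] at heq
      have hd : φ₁ + κ * (s - x) - (φ₁ + κ * (s + x)) = -(κ * (2 * x)) := by ring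
      have := eq_of_rim_eq heq (by
        rw [hd, abs_neg, abs_mul, hκ1, one_mul, abs_of_pos (by linarith [hx.1])]; linarith)
      have h3 : κ * (2 * x) = 0 := by linarith
      rcases mul_eq_zero.1 h3 with h4 | h4
      · rw [h4, abs_zero] at hκ1; linarith
      · linarith [hx.1]
    · obtain ⟨δ, hδ, hx⟩ := hout
      refine ⟨δ / (1 + t), by positivity, fun x hx' heq => ?_⟩
      refine hx ((1 + t) * x) ⟨mul_pos ht1 hx'.1, ?_⟩ ?_
      · rw [mul_comm, ← lt_div_iff₀ ht1]; exact hx'.2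
      · rw [hτ2 (s + x) (by linarith [hx'.1]), h, add_sub_cancel_left] at heq
        rw [← heq, hτ1 _ (by linarith [hx'.1])]
        exact rim_mem_range _ _
    · obtain ⟨δ, hδ, hx⟩ := (hσ (a + Real.pi + (1 + t) * (s - D))).exists_ne
      refine ⟨min (s - D) (δ / (1 + t)), lt_min (by linarith) (by positivity), fun x hx' => ?_⟩
      have h2 := lt_min_iff.1 hx'.2
      rw [lt_div_iff₀ ht1] at h2
      rw [hτ2 _ (by linarith), hτ2 _ (by linarith [hx'.1])]
      have := hx ((1 + t) * x) ⟨mul_pos ht1 hx'.1, by linarith⟩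
      convert this using 2 <;> ring
  · obtain ⟨δ, hδ, hx⟩ := hinn
    refine ⟨min D (min ((L - Real.pi) / (1 + t)) (δ / (1 + t))), by positivity,
      fun x hx' heq => ?_⟩
    obtain ⟨h2, h3⟩ := lt_min_iff.1 hx'.2
    obtain ⟨h3, h4⟩ := lt_min_iff.1 h3
    rw [lt_div_iff₀ ht1] at h4
    refine hx ((1 + t) * x) ⟨mul_pos ht1 hx'.1, by linarith⟩ ?_
    rw [hτ2 _ (by linarith), hτ1 _ h2.le] at heq
    have e : a + Real.pi + (1 + t) * (T - x - D) = a - (1 + t) * x + L := by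
      linear_combination hTe
    rw [e, hper] at heq
    rw [heq]
    exact rim_mem_range _ _

/-- The endpoints of a crossing of `f` do not both lie in another face. -/
theorem Crossing.not_mem_range (hS : S.IsIdeallyAdmissible) (ht0 : 0 < t)
    (hlen : ∀ e, (1 + t) * S.len e < Real.pi) {σ : ℝ → Q} {f g : S.F} {a φ₁ φ₂ : ℝ}
    (hc : S.Crossing t σ f a φ₁ φ₂) (hfg : f ≠ g) (h1 : σ a ∈ range (S.face g))
    (h2 : σ (a + Real.pi) ∈ range (S.face g)) : False := by
  have hpi := Real.pi_pos
  have ht1 : 0 < 1 + t := by linarith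
  have hpos : 0 < Real.pi / (1 + t) := by positivity
  have hlt : Real.pi / (1 + t) < Real.pi := by rw [div_lt_iff₀ ht1]; nlinarith
  have hle1 := hc.pi_div_le
  have hle2 := hc.le_pi
  have f1 : σ a ∈ range (S.face f) := hc.left ▸ rim_mem_range _ _
  have f2 : σ (a + Real.pi) ∈ range (S.face f) := hc.right ▸ rim_mem_range _ _
  -- The endpoints would both lie in one vertex or one edge. Their longitudes differ by at least `π
  -- / (1 + t)` and at most `π`, so they are different points; and an edge is shorter than `π / (1 +
  -- t)`.
  rcases exists_common_cell hS.polyhedral hfg f1 h1 with ⟨v, hv⟩ | ⟨e, hfe, -, he⟩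
  · have h := (hv _ f2 h2).trans (hv _ f1 h1).symm
    rw [hc.left, hc.right] at h
    have := eq_of_rim_eq h (by linarith)
    rw [this, sub_self, abs_zero] at hle1
    linarith
  · obtain ⟨u, hu, hu'⟩ := he _ f1 h1
    obtain ⟨v, hv, hv'⟩ := he _ f2 h2
    rw [hc.left, edge_eq_rim hfe hu] at hu'
    rw [hc.right, edge_eq_rim hfe hv] at hv'
    obtain ⟨m, hm⟩ := rim_eq_iff.1 hu'
    obtain ⟨n, hn⟩ := rim_eq_iff.1 hv'
    have huv : |S.dir f e * (v - u)| < Real.pi / (1 + t) := by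
      rw [abs_mul, abs_dir, one_mul, lt_div_iff₀ ht1]
      have : |v - u| ≤ S.len e := by
        rw [abs_le]; constructor <;> linarith [hu.1, hu.2, hv.1, hv.2]
      nlinarith [hlen e]
    have hrim : S.rim f (φ₂ - φ₁) = S.rim f (S.dir f e * (v - u)) :=
      rim_eq_iff.2 ⟨m - n, by push_cast; linarith⟩
    have := eq_of_rim_eq hrim (by
      have := abs_sub (φ₂ - φ₁) (S.dir f e * (v - u))
      linarith)
    rw [this] at hle1
    linarith

/-- The cases are no crossing of an open face, one, or at least two. Each crossing takes time `π`,
so only in the last case with `L = 2π` is a further argument needed: the two crossings fill the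
whole geodesic and have the same endpoints. -/
theorem two_pi_lt_of_isClosedGeodesic (hS : S.IsIdeallyAdmissible) (ht0 : 0 < t)
    (hlen : ∀ e, (1 + t) * S.len e < Real.pi) {γ : ℝ → S.Expansion t} {L : ℝ}
    (hγ : IsClosedGeodesic γ L) : 2 * Real.pi < L := by
  have hpi := Real.pi_pos
  have ht1 : 0 < 1 + t := by linarith
  obtain ⟨hL, hper, hloc⟩ := hγ
  choose σ hσγ using fun s => toX_surjective (S := S) (t := t) (γ s)
  have hσ : ∀ u, S.GeodesicAt t σ u := fun u => by
    obtain ⟨ε, hε, h⟩ := hloc u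
    exact ⟨ε, hε, fun a ha b hb => by rw [hσγ, hσγ, h a ha b hb]⟩
  have hσper : Function.Periodic σ L := fun s =>
    toX_injective ht0 hlen (by rw [hσγ, hσγ, hper])
  by_cases hskel : ∀ s, σ s ∈ S.skel
  · have := two_pi_le_of_skel hS ht0 hlen hσ hL hσper hskel
    nlinarith
  push Not at hskel
  obtain ⟨s, hs⟩ := hskel
  obtain ⟨f, hf⟩ := (skel_or_openFace (S := S) (σ s)).resolve_left hs
  obtain ⟨a, φ₁, φ₂, -, hc⟩ := exists_crossing ht0 hlen hσ hf
  have hpos : 0 < Real.pi / (1 + t) := by positivity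
  have hle1 := hc.pi_div_le
  have hle2 := hc.le_pi
  have ha : σ a ∈ S.skel := hc.left ▸ rim_mem_skel _ _
  have hb : σ (a + Real.pi) ∈ S.skel := hc.right ▸ rim_mem_skel _ _
  have haL : σ (a + L) ∈ S.skel := by rwa [hσper a]
  have hpL : Real.pi < L := by
    -- A period of exactly `π` would identify the two different endpoints of the crossing; a shorter
    -- one would put the boundary point `σ (a + L) = σ a` inside the open face.
    by_contra! h
    rcases h.eq_or_lt with h | h
    · have h1 : σ (a + Real.pi) = σ a := by rw [← h]; exact hσper a
      rw [hc.left, hc.right] at h1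
      have := eq_of_rim_eq h1 (by linarith)
      rw [this, sub_self, abs_zero] at hle1
      linarith
    · exact haL f (hc.inside _ ⟨by linarith, by linarith⟩)
  by_cases hskel : ∀ s ∈ Icc (a + Real.pi) (a + L), σ s ∈ S.skel
  · exact two_pi_lt_of_crossing hS ht0 hlen hσ hpL hσper hc hskel
  push Not at hskel
  obtain ⟨s', hs', hs''⟩ := hskel
  obtain ⟨g, hg⟩ := (skel_or_openFace (S := S) (σ s')).resolve_left hs''
  obtain ⟨b, ψ₁, ψ₂, hsb, hc'⟩ := exists_crossing ht0 hlen hσ hg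
  -- The curve is in the `1`-skeleton at the times `a + π` and `a + L`, so the second crossing fits
  -- between them.
  have h1 : a + Real.pi ≤ b := by
    by_contra! h
    exact hb g (hc'.inside _ ⟨h, by linarith [hsb.2, hs'.1]⟩)
  have h2 : b + Real.pi ≤ a + L := by
    by_contra! h
    exact haL g (hc'.inside _ ⟨by linarith [hsb.1, hs'.2], h⟩)
  by_contra! hL2
  have hb' : b = a + Real.pi := by linarith
  have hL' : L = 2 * Real.pi := by linarith
  have hfg : f ≠ g := by
    rintro rfl
    obtain ⟨δ, hδ, h⟩ := (hσ (a + Real.pi)).exit ht0 hlen hS.sphere hb hpi (g := f) fun x hx =>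
      hc.inside _ ⟨by linarith [hx.2], by linarith [hx.1]⟩
    have h0 : 0 < min δ Real.pi := lt_min hδ hpi
    have h3 : min δ Real.pi ≤ δ := min_le_left _ _
    have h4 : min δ Real.pi ≤ Real.pi := min_le_right _ _
    exact h (min δ Real.pi / 2) ⟨by linarith, by linarith⟩
      (openFace_subset f (hc'.inside _ ⟨by linarith, by linarith⟩))
  refine hc.not_mem_range hS ht0 hlen hfg ?_ ?_
  · have : σ a = σ (b + Real.pi) := by
      rw [← hσper a]; congr 1; linarith
    rw [this, hc'.right]
    exact rim_mem_range _ _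
  · rw [← hb', hc'.left]
    exact rim_mem_range _ _

/-- The condition on `t` in terms of the lengths of the edges. -/
theorem len_lt_of_lt_longestEdge (ht0 : 0 < t) (ht : t < Real.pi / S.longestEdge - 1) (e : S.E) :
    (1 + t) * S.len e < Real.pi := by
  have := S.finite_E
  have hle : S.len e ≤ S.longestEdge := le_ciSup (finite_range S.len).bddAbove e
  have hpos : 0 < S.longestEdge := (S.len_pos e).trans_le hle
  have h1 : 1 + t < Real.pi / S.longestEdge := by linarith
  rw [lt_div_iff₀ hpos] at h1
  nlinarith

end HemisphereComplex

end Spherical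

/-! ### Admissibility of the expansion -/

theorem theorem4p4 {Q : Type*} [MetricSpace Q] (S : Spherical.HemisphereComplex Q)
    (hS : S.IsIdeallyAdmissible) (t : ℝ) (ht0 : 0 < t)
    (ht : t < Real.pi / S.longestEdge - 1) :
    Spherical.IsAdmissible (S.Expansion t) := by
  have hlen := Spherical.HemisphereComplex.len_lt_of_lt_longestEdge ht0 ht
  obtain ⟨e⟩ := Spherical.HemisphereComplex.nonempty_homeomorph (S := S) ht0 hlen
  obtain ⟨e'⟩ := hS.sphere
  exact ⟨⟨e.trans e'⟩, Spherical.HemisphereComplex.isPiecewiseSpherical ht0 hlen,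
    Spherical.HemisphereComplex.exists_cone_points ht0 hlen hS.sphere hS.polyhedral,
    fun _ _ h => Spherical.HemisphereComplex.two_pi_lt_of_isClosedGeodesic hS ht0 hlen h⟩
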